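/- **Setting.** Fix $\gamma\in[0,1)$, $\lambda>0$ and Lipschitz functions $\sigma,\varphi:\mathbb R\to\mathbb R$ (applied entrywise to matrices). Consider a sequence of problems, each consisting of the following data (the index of the sequence is suppressed). There is a finite Markov reward process with a set $\mathcal S\subset\mathbb R^d$ of states, state matrix $S\in\mathbb R^{d\times|\mathcal S|}$ (its columns are the states) and reward function $r(\cdot,\cdot)$; a data set of $n\ge 1$ transitions $(s_i,r_i,s_i')$ of the process with $r_i=r(s_i,s_i')$; $X_n=[s_1,\dots,s_n]$, $X_n'=[s_1',\dots,s_n']$, $r=(r_1,\dots,r_n)^T$. Let $\hat S\in\mathbb R^{d\times m}$ be the matrix of the $m$ distinct states occurring in the data, and let $\hat U_n,\hat V_n\in\mathbb R^{m\times n}$ be such that $\sqrt n\,\hat U_n$ and $\sqrt n\,\hat V_n$ have one-hot columns with $X_n=\sqrt n\,\hat S\hat U_n$, $X_n'=\sqrt n\,\hat S\hat V_n$. Let $N\ge1$, let $W=\varphi(\tilde W)\in\mathbb R^{N\times d}$, where $\tilde W$ has i.i.d. $\mathcal N(0,1)$ entries (for different members of the sequence the matrices $\tilde W$ live on one probability space,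 with an arbitrary joint law), and put $\Sigma_A=\sigma(WA)$. Regularized LSTD returns $$\hat\theta=\bigl[\Sigma_{X_n}(\Sigma_{X_n}-\gamma\Sigma_{X_n'})^T+\lambda mn\,I_N\bigr]^{-1}\Sigma_{X_n}r,\qquad \widehat{\mathrm{MSBE}}(\hat\theta)=\tfrac1n\bigl\|r+\gamma\Sigma_{X_n'}^T\hat\theta-\Sigma_{X_n}^T\hat\theta\bigr\|^2 ,$$ and the resolvent is $Q_m=\bigl[\tfrac1{mn}(\Sigma_{X_n}-\gamma\Sigma_{X_n'})^T\Sigma_{X_n}+\lambda I_n\bigr]^{-1}$. **Assumptions.** (1) Along the sequence $m$ increases strictly; the ratios $N/m$, $d/m$, $m/|\mathcal S|$ are eventually bounded away from $0$ and from $\infty$; the operator norms $\|S\|$ are eventually bounded; and the reward functions are uniformly bounded. (2) There are constants $0<\xi_{\min}<\xi_{\max}$ and a sequence of scales $a>0$ such that for every member of the sequence all eigenvalues of the symmetric part of $\hat A_m=\hat U_n(\hat U_n-\gamma\hat V_n)^T$ lie in $[a\,\xi_{\min},a\,\xi_{\max}]$. **Deterministic quantities.** Let $\Phi=\mathbb E\bigl[\sigma(w^T\hat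 S)^T\sigma(w^T\hat S)\bigr]\in\mathbb R^{m\times m}$, where $w=\varphi(\tilde w)$ with $\tilde w\sim\mathcal N(0,I_d)$. For $\delta\ge0$ let $\bar Q_m=\bigl[\tfrac Nm\tfrac1{1+\delta}(\hat U_n-\gamma\hat V_n)^T\Phi\hat U_n+\lambda I_n\bigr]^{-1}$, where $\delta$ is chosen as the solution of $$\delta=\tfrac1m\operatorname{Tr}\bigl((\hat U_n-\gamma\hat V_n)^T\Phi\,\hat U_n\,\bar Q_m\bigr).\qquad(*)$$ Further let $\Psi_1=\tfrac Nm\tfrac1{1+\delta}\hat U_n^T\Phi\hat U_n$, $\Psi_2=\tfrac Nm\tfrac1{1+\delta}(\hat U_n-\gamma\hat V_n)^T\Phi(\hat U_n-\gamma\hat V_n)$ and $$\hat\Delta=\frac{\lambda^2}{n}\,\frac{\tfrac1N\operatorname{Tr}(\bar Q_m\Psi_2\bar Q_m^T)}{1-\tfrac1N\operatorname{Tr}(\Psi_2\bar Q_m^T\Psi_1\bar Q_m)}\;r^T\bar Q_m^T\Psi_1\bar Q_m r .$$ **Theorem.** Under these assumptions: (i) for every member of the sequence and every realization of $\tilde W$,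 the matrices inverted in $\hat\theta$ and $Q_m$ are invertible and $\widehat{\mathrm{MSBE}}(\hat\theta)=\frac{\lambda^2}{n}\|Q_m r\|^2$; (ii) for every member of the sequence, $(*)$ has exactly one solution $\delta\ge0$, and $\delta>0$ if $\Phi\ne0$; for this $\delta$ the matrix inverted in $\bar Q_m$ is invertible and the denominator in $\hat\Delta$ is positive; (iii) almost surely, $\widehat{\mathrm{MSBE}}(\hat\theta)-\Bigl(\frac{\lambda^2}{n}\|\bar Q_m r\|^2+\hat\Delta\Bigr)\to0$ along the sequence. -/

import Mathlib

open Filter Topology MeasureTheory ProbabilityTheory Matrix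

namespace RegLSTD

noncomputable section

/-- A finite Markov reward process with states in `ℝ^d` (the discount factor is kept separate).
The columns of `state` are the pairwise distinct states, `P` is the transition matrix and
`reward j l` is the reward of the transition from state `j` to state `l`. -/
structure MRP (d : ℕ) where
  card : ℕ
  state : Matrix (Fin d) (Fin card) ℝ
  state_injective : Function.Injective fun j : Fin card => stateᵀ j
  P : Matrix (Fin card) (Fin card) ℝ
  P_nonneg : ∀ j l, 0 ≤ P j l
  P_sum : ∀ j, ∑ l, P j l = 1
  reward : Fin card → Fin card → ℝ

/-- A data set of `n` transitions `src i → dst i` that the process can make. -/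
structure Dataset {d : ℕ} (M : MRP d) (n : ℕ) where
  src : Fin n → Fin M.card
  dst : Fin n → Fin M.card
  possible : ∀ i, 0 < M.P (src i) (dst i)

/-- The operator norm of a matrix for the Euclidean norms. -/
def opNorm {p q : ℕ} (A : Matrix (Fin p) (Fin q) ℝ) : ℝ :=
  ‖LinearMap.toContinuousLinearMap (Matrix.toLpLin 2 2 A)‖

/-- The squared Euclidean norm `‖v‖²`. -/
def sqNorm {ι : Type*} [Fintype ι] (v : ι → ℝ) : ℝ := v ⬝ᵥ v

/-- The quadratic form `‖v‖²_A = vᵀ A v`. -/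
def sqNormWith {ι : Type*} [Fintype ι] (A : Matrix ι ι ℝ) (v : ι → ℝ) : ℝ := v ⬝ᵥ (A *ᵥ v)

/-- The symmetric part `H(A)`. -/
def symPart {ι : Type*} (A : Matrix ι ι ℝ) : Matrix ι ι ℝ := (1 / 2 : ℝ) • (A + Aᵀ)

/-- The random features `σ(W A)` of the columns of `A`, where `W = φ(Wt)`; both functions are
applied entrywise. -/
def features (σ φ : ℝ → ℝ) {N d : ℕ} {ι : Type*} (Wt : Matrix (Fin N) (Fin d) ℝ)
    (A : Matrix (Fin d) ι ℝ) : Matrix (Fin N) ι ℝ :=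
  (Wt.map φ * A).map σ

namespace Dataset

variable {d n : ℕ} {M : MRP d} (D : Dataset M n)

/-- The set of distinct states occurring in the data, as a current or as a next state. -/
def visited : Finset (Fin M.card) := Finset.univ.image D.src ∪ Finset.univ.image D.dst

/-- The number `m` of distinct visited states. -/
def numVisited : ℕ := D.visited.card

/-- The matrix of visited states. -/
def visitedStates : Matrix (Fin d) D.visited ℝ := Matrix.of fun a j => M.state a j

/-- The sample matrix `X_n` of current states. -/
def srcStates : Matrix (Fin d) (Fin n) ℝ := Matrix.of fun a i => M.state a (D.src i)

/-- The sample matrix `X'_n` of next states. -/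
def dstStates : Matrix (Fin d) (Fin n) ℝ := Matrix.of fun a i => M.state a (D.dst i)

/-- The vector of observed rewards. -/
def rewards : Fin n → ℝ := fun i => M.reward (D.src i) (D.dst i)

/-- The matrix `Û_n`: `√n Û_n` has one-hot columns marking the current states. -/
def U : Matrix D.visited (Fin n) ℝ :=
  Matrix.of fun j i => if D.src i = j then 1 / Real.sqrt n else 0

/-- The matrix `V̂_n`: `√n V̂_n` has one-hot columns marking the next states. -/
def V : Matrix D.visited (Fin n) ℝ :=
  Matrix.of fun j i => if D.dst i = j then 1 / Real.sqrt n else 0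

/-- The empirical transition model matrix `Û (Û - γ V̂)ᵀ`. -/
def transitionModel (γ : ℝ) : Matrix D.visited D.visited ℝ := D.U * (D.U - γ • D.V)ᵀ

/-- The empirical mean-squared Bellman error of the parameter vector `θ`. -/
def empiricalMSBE (σ φ : ℝ → ℝ) (γ : ℝ) {N : ℕ} (Wt : Matrix (Fin N) (Fin d) ℝ)
    (θ : Fin N → ℝ) : ℝ :=
  1 / (n : ℝ) * sqNorm (D.rewards + γ • ((features σ φ Wt D.dstStates)ᵀ *ᵥ θ)
    - (features σ φ Wt D.srcStates)ᵀ *ᵥ θ)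

/-- The matrix inverted by regularized LSTD with effective regularization parameter `lamEff`. -/
def lstdMatrix (σ φ : ℝ → ℝ) (γ lamEff : ℝ) {N : ℕ} (Wt : Matrix (Fin N) (Fin d) ℝ) :
    Matrix (Fin N) (Fin N) ℝ :=
  features σ φ Wt D.srcStates *
      (features σ φ Wt D.srcStates - γ • features σ φ Wt D.dstStates)ᵀ
    + lamEff • (1 : Matrix (Fin N) (Fin N) ℝ)

/-- The regularized LSTD parameter vector with effective regularization parameter `lamEff`. -/
def lstd (σ φ : ℝ → ℝ) (γ lamEff : ℝ) {N : ℕ} (Wt : Matrix (Fin N) (Fin d) ℝ) : Fin N → ℝ :=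
  (D.lstdMatrix σ φ γ lamEff Wt)⁻¹ *ᵥ (features σ φ Wt D.srcStates *ᵥ D.rewards)

/-- The matrix whose inverse is the resolvent `Q_m(lam)`. -/
def resolventMatrix (σ φ : ℝ → ℝ) (γ lam : ℝ) {N : ℕ} (Wt : Matrix (Fin N) (Fin d) ℝ) :
    Matrix (Fin n) (Fin n) ℝ :=
  (1 / ((D.numVisited : ℝ) * n)) •
      ((features σ φ Wt D.srcStates - γ • features σ φ Wt D.dstStates)ᵀ *
        features σ φ Wt D.srcStates)
    + lam • (1 : Matrix (Fin n) (Fin n) ℝ)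

/-- The resolvent `Q_m(lam)`. -/
def resolvent (σ φ : ℝ → ℝ) (γ lam : ℝ) {N : ℕ} (Wt : Matrix (Fin N) (Fin d) ℝ) :
    Matrix (Fin n) (Fin n) ℝ :=
  (D.resolventMatrix σ φ γ lam Wt)⁻¹

/-- The deterministic Gram feature matrix `Φ` of the visited states: the second moment matrix of
the feature `σ(wᵀ ŝ)`, where `w = φ(w̃)` is distributed as a row of the weight matrix. -/
def gram (σ φ : ℝ → ℝ) : Matrix D.visited D.visited ℝ :=
  Matrix.of fun j l =>
    ∫ w : Fin d → ℝ,
      σ (∑ a, φ (w a) * D.visitedStates a j) * σ (∑ a, φ (w a) * D.visitedStates a l)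
      ∂(Measure.pi fun _ : Fin d => gaussianReal 0 1)

/-- The scalar `(N / m) / (1 + δ)`. -/
def scaling (N : ℕ) (δ : ℝ) : ℝ := (N : ℝ) / (D.numVisited : ℝ) * (1 / (1 + δ))

/-- The matrix whose inverse is the deterministic resolvent. -/
def detResolventMatrix (σ φ : ℝ → ℝ) (γ lam : ℝ) (N : ℕ) (δ : ℝ) : Matrix (Fin n) (Fin n) ℝ :=
  D.scaling N δ • ((D.U - γ • D.V)ᵀ * D.gram σ φ * D.U) + lam • (1 : Matrix (Fin n) (Fin n) ℝ)

/-- The deterministic resolvent `Q̄_m(lam)` with correction factor `δ`. -/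
def detResolvent (σ φ : ℝ → ℝ) (γ lam : ℝ) (N : ℕ) (δ : ℝ) : Matrix (Fin n) (Fin n) ℝ :=
  (D.detResolventMatrix σ φ γ lam N δ)⁻¹

/-- `δ` is a nonnegative solution of the fixed-point equation of the correction factor. -/
def IsCorrectionFactor (σ φ : ℝ → ℝ) (γ lam : ℝ) (N : ℕ) (δ : ℝ) : Prop :=
  0 ≤ δ ∧
    δ = 1 / (D.numVisited : ℝ) *
      ((D.U - γ • D.V)ᵀ * D.gram σ φ * D.U * D.detResolvent σ φ γ lam N δ).trace

/-- The matrix `Ψ₁`. -/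
def Psi1 (σ φ : ℝ → ℝ) (N : ℕ) (δ : ℝ) : Matrix (Fin n) (Fin n) ℝ :=
  D.scaling N δ • (D.Uᵀ * D.gram σ φ * D.U)

/-- The matrix `Ψ₂`. -/
def Psi2 (σ φ : ℝ → ℝ) (γ : ℝ) (N : ℕ) (δ : ℝ) : Matrix (Fin n) (Fin n) ℝ :=
  D.scaling N δ • ((D.U - γ • D.V)ᵀ * D.gram σ φ * (D.U - γ • D.V))

/-- The denominator of the second-order correction factor. -/
def correctionDenom (σ φ : ℝ → ℝ) (γ lam : ℝ) (N : ℕ) (δ : ℝ) : ℝ :=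
  1 - 1 / (N : ℝ) * (D.Psi2 σ φ γ N δ * (D.detResolvent σ φ γ lam N δ)ᵀ * D.Psi1 σ φ N δ *
    D.detResolvent σ φ γ lam N δ).trace

/-- The second-order correction factor `Δ̂`. -/
def secondOrderCorrection (σ φ : ℝ → ℝ) (γ lam : ℝ) (N : ℕ) (δ : ℝ) : ℝ :=
  lam ^ 2 / n *
    ((1 / (N : ℝ) * (D.detResolvent σ φ γ lam N δ * D.Psi2 σ φ γ N δ *
        (D.detResolvent σ φ γ lam N δ)ᵀ).trace) / D.correctionDenom σ φ γ lam N δ) *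
    sqNormWith (D.Psi1 σ φ N δ) (D.detResolvent σ φ γ lam N δ *ᵥ D.rewards)

/-- The deterministic asymptotic empirical mean-squared Bellman error. -/
def detEmpiricalMSBE (σ φ : ℝ → ℝ) (γ lam : ℝ) (N : ℕ) (δ : ℝ) : ℝ :=
  lam ^ 2 / n * sqNorm (D.detResolvent σ φ γ lam N δ *ᵥ D.rewards)
    + D.secondOrderCorrection σ φ γ lam N δ

end Dataset

/-- The double asymptotic regime, along a sequence of problems: the number `m` of visited states
increases strictly to infinity, the ratios `N / m`, `d / m` and `m / |S|` are eventually bounded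
away from `0` and `∞` (so `N` and `d` tend to infinity too), the operator norms of the state
matrices are eventually bounded, and the reward functions are uniformly bounded. -/
structure DoubleAsymptoticRegime (N d n : ℕ → ℕ) (M : ∀ k, MRP (d k))
    (D : ∀ k, Dataset (M k) (n k)) : Prop where
  strictMono_numVisited : StrictMono fun k => (D k).numVisited
  ratios : ∃ c C : ℝ, 0 < c ∧ ∀ᶠ k in atTop,
    (N k : ℝ) / (D k).numVisited ∈ Set.Icc c C ∧
    (d k : ℝ) / (D k).numVisited ∈ Set.Icc c C ∧
    ((D k).numVisited : ℝ) / (M k).card ∈ Set.Icc c C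
  states_bounded : ∃ K : ℝ, ∀ᶠ k in atTop, opNorm (M k).state ≤ K
  rewards_bounded : ∃ K : ℝ, ∀ k j l, |(M k).reward j l| ≤ K

/-- Bounded eigenspectrum up to scale: the eigenvalues of the symmetric part of the empirical
transition model matrix lie in `[a ξmin, a ξmax]`, with constants `0 < ξmin < ξmax` common to the
whole sequence and a positive scale `a` that may change along it. -/
def BoundedEigenspectrum (γ : ℝ) {d n : ℕ → ℕ} {M : ∀ k, MRP (d k)}
    (D : ∀ k, Dataset (M k) (n k)) : Prop :=
  ∃ ξmin ξmax : ℝ, 0 < ξmin ∧ ξmin < ξmax ∧ ∃ a : ℕ → ℝ, (∀ k, 0 < a k) ∧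
    ∀ k, spectrum ℝ (symPart ((D k).transitionModel γ)) ⊆ Set.Icc (a k * ξmin) (a k * ξmax)

end

end RegLSTD

open RegLSTD

/-!
The states visited in the data carry the whole problem. With `Û`, `V̂` the normalised one-hot
matrices, `E = Û - γ V̂`, `A = Û Eᵀ` the transition model and `G = m⁻¹ Σᵀ Σ` the sample Gram
matrix of the visited states, the resolvent matrix is `Eᵀ G Û + λ`. If `t` solves `λ t + G A t = G
Û r`, then `λ Q r = r - Eᵀ t`. Coercivity of `A` bounds `t` by the data alone, whatever the
positive semidefinite matrix `G` is (`coercive_solution_bound`), and this gives the invertibility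
claims; the formula for the empirical error is algebra (`Dataset.empiricalMSBE_lstd`).

The scale of the eigenspectrum is not free. The trace of `A` lies in `[1 - γ, 1]`, so the scale is
of order `1 / m`; since `γ Û V̂ᵀ` has nonnegative entries, the quadratic form of `A` then controls
`A`, `Û` and `E` themselves: their norms are of order at most `m ^ (-1)`, `m ^ (-1/2)` and `m ^
(-1/4)` (`exists_structural_bounds`).

For the correction factor write `Φ = Bᵀ B` and push `B` through the resolvents: the equation
becomes one for the accretive matrix `P = B A Bᵀ`. Existence of a solution is the intermediate
value theorem. Uniqueness follows from the monotonicity of `s ↦ s tr (c P + s)⁻¹`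
(`mul_trace_inv_mono`), which holds without symmetry of `P`. In the same coordinates the
denominator of the second-order correction is `1 - c² ‖P X‖² / N` with `X = (c P + λ)⁻¹`, and the
fixed-point equation bounds it below by `1 / (1 + δ)` (`Dataset.inv_le_correctionDenom`).

For the limit, `G` is compared with its deterministic counterpart, a multiple of `Φ`. The
difference of the squared residuals is to first order a bilinear form of the difference of the two
matrices, at vectors that do not depend on the weights and whose norms multiply to `O(m ^
(-1/2))`; the remainder is quadratic, of the order of the squared Frobenius norm times `m ^
(-3/2)` (`residual_comparison`). Since the features are Lipschitz functions of Gaussian weights, a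
moment inequality of Maurey and Pisier (`integral_abs_sub_integral_pow_le`) bounds the fourth
central moments of the bilinear form and of the Frobenius norm, and, applied to the entries, the
mean of the latter. The scaled fourth moments are summable because `m` increases strictly, so the
convergence is almost sure whatever the joint law of the weight matrices of different problems.
Finally `δ = O(1 / m)` makes the passage from `N / m` to `(N / m) / (1 + δ)` harmless, and the
second-order correction is at most a multiple of the squared norm of `E`, hence tends to zero as
well (`Dataset.secondOrderCorrection_bounds`).
-/

namespace RegLSTD

noncomputable section

/-! ### Gaussian moment concentration -/

section GaussianMoments

lemma absolutelyContinuous_pi_gaussianReal (ι : Type*) [Fintype ι] :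
    (Measure.pi fun _ : ι => gaussianReal 0 1) ≪ (volume : Measure (ι → ℝ)) := by
  have h : (Measure.pi fun _ : ι => gaussianReal 0 1)
      = (volume : Measure (ι → ℝ)).withDensity
          fun x => ENNReal.ofReal (∏ i, gaussianPDFReal 0 1 (x i)) := by
    refine Measure.pi_eq fun s hs => ?_
    rw [withDensity_apply _ (MeasurableSet.univ_pi hs), volume_pi, Measure.restrict_pi_pi,
      ← ofReal_integral_eq_lintegral_ofReal
        (Integrable.fintype_prod fun i => (integrable_gaussianPDFReal 0 1).restrict)
        (ae_of_all _ fun x => Finset.prod_nonneg fun i _ => gaussianPDFReal_nonneg 0 1 _),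
      integral_fintype_prod_eq_prod,
      ENNReal.ofReal_prod_of_nonneg fun i _ =>
        integral_nonneg fun x => gaussianPDFReal_nonneg 0 1 x]
    exact Finset.prod_congr rfl fun i _ => (gaussianReal_apply_eq_integral 0 one_ne_zero _).symm
  rw [h]
  exact withDensity_absolutelyContinuous _ _

lemma absolutelyContinuous_stdGaussian (ι : Type*) [Fintype ι] :
    stdGaussian (EuclideanSpace ℝ ι) ≪ (volume : Measure (EuclideanSpace ℝ ι)) := by
  rw [← map_pi_eq_stdGaussian, ← (PiLp.volume_preserving_toLp ι).map_eq]
  exact (absolutelyContinuous_pi_gaussianReal ι).map (by fun_prop)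

lemma integrable_of_polynomial_growth {F : Type*} [NormedAddCommGroup F] [NormedSpace ℝ F]
    [FiniteDimensional ℝ F] [MeasurableSpace F] [BorelSpace F] {ν : Measure F} [IsGaussian ν]
    {h : F → ℝ} (hh : AEStronglyMeasurable h ν) {C : ℝ} {q : ℕ}
    (hb : ∀ x, |h x| ≤ C * (1 + ‖x‖) ^ q) : Integrable h ν := by
  have : CompleteSpace F := FiniteDimensional.complete ℝ F
  have : ProperSpace F := FiniteDimensional.proper ℝ F
  have h1 : MemLp (fun x : F => 1 + ‖x‖) q ν :=
    (memLp_const (1 : ℝ)).add (IsGaussian.memLp_id ν q (ENNReal.natCast_ne_top q)).norm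
  have h2 : Integrable (fun x : F => C * (1 + ‖x‖) ^ q) ν := by
    have h3 := h1.integrable_norm_pow'
    have h4 : ∀ x : F, ‖1 + ‖x‖‖ = 1 + ‖x‖ := fun x =>
      (Real.norm_eq_abs _).trans (abs_of_nonneg (by positivity))
    simp_rw [h4] at h3
    exact h3.const_mul C
  exact h2.mono' hh (ae_of_all _ hb)

lemma integral_abs_pow_stdGaussian {E : Type*} [NormedAddCommGroup E] [InnerProductSpace ℝ E]
    [FiniteDimensional ℝ E] [MeasurableSpace E] [BorelSpace E] (L : E →L[ℝ] ℝ) (p : ℕ) :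
    ∫ y, |L y| ^ p ∂(stdGaussian E) = ‖L‖ ^ p * ∫ t, |t| ^ p ∂(gaussianReal 0 1) := by
  have h1 : (stdGaussian E).map L = (gaussianReal 0 1).map (‖L‖ * ·) := by
    rw [IsGaussian.map_eq_gaussianReal L, variance_dual_stdGaussian,
      integral_strongDual_stdGaussian, gaussianReal_map_const_mul]
    congr 1
    · simp
    · ext; simp
  calc ∫ y, |L y| ^ p ∂(stdGaussian E)
      = ∫ t, |t| ^ p ∂((stdGaussian E).map L) := by
        rw [integral_map (by fun_prop) (by fun_prop)]
    _ = _ := by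
        rw [h1, integral_map (by fun_prop) (by fun_prop), ← integral_const_mul]
        simp_rw [abs_mul, abs_norm, mul_pow]

variable {ι : Type*} [Fintype ι] {f g : EuclideanSpace ℝ ι → ℝ} {C : ℝ}

/-- A function with `|f x - f y| ≤ (g x + g y) ‖x - y‖` for a continuous `g` is continuous; `g`
plays the role of a local modulus of Lipschitz continuity below. -/
lemma continuous_of_local_modulus (hg : Continuous g)
    (hf : ∀ x y, |f x - f y| ≤ (g x + g y) * ‖x - y‖) : Continuous f := by
  refine continuous_iff_continuousAt.2 fun x => ?_
  rw [ContinuousAt, tendsto_iff_norm_sub_tendsto_zero]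
  have h : Tendsto (fun y => (g y + g x) * ‖y - x‖) (𝓝 x) (𝓝 ((g x + g x) * ‖x - x‖)) :=
    Continuous.tendsto (by fun_prop) x
  rw [sub_self, norm_zero, mul_zero] at h
  exact squeeze_zero (fun y => norm_nonneg _) (fun y => hf y x) h

lemma ae_differentiableAt_of_local_modulus (hgC : ∀ x, g x ≤ C * (1 + ‖x‖))
    (hf : ∀ x y, |f x - f y| ≤ (g x + g y) * ‖x - y‖) :
    ∀ᵐ x ∂(stdGaussian (EuclideanSpace ℝ ι)), DifferentiableAt ℝ f x := by
  refine (absolutelyContinuous_stdGaussian ι).ae_le ?_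
  have h : ∀ n : ℕ, ∀ᵐ x : EuclideanSpace ℝ ι,
      x ∈ Metric.ball 0 n → DifferentiableWithinAt ℝ f (Metric.ball 0 n) x := by
    intro n
    refine LipschitzOnWith.ae_differentiableWithinAt_of_mem
      (C := Real.toNNReal (2 * (|C| * (1 + n)))) ?_
    refine LipschitzOnWith.of_dist_le_mul fun x hx y hy => ?_
    rw [Real.dist_eq, dist_eq_norm, Real.coe_toNNReal _ (by positivity)]
    refine (hf x y).trans (mul_le_mul_of_nonneg_right ?_ (norm_nonneg _))
    rw [mem_ball_zero_iff] at hx hy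
    have hb : ∀ z : EuclideanSpace ℝ ι, ‖z‖ < n → g z ≤ |C| * (1 + n) := fun z hz =>
      (hgC z).trans ((mul_le_mul_of_nonneg_right (le_abs_self C) (by positivity)).trans
        (mul_le_mul_of_nonneg_left (by linarith) (abs_nonneg C)))
    linarith [hb x hx, hb y hy]
  filter_upwards [ae_all_iff.2 h] with x hx
  obtain ⟨n, hn⟩ := exists_nat_gt ‖x‖
  have hmem : x ∈ Metric.ball (0 : EuclideanSpace ℝ ι) n := by simpa using hn
  exact (hx n hmem).differentiableAt (Metric.isOpen_ball.mem_nhds hmem)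

lemma norm_fderiv_le_of_local_modulus (hg : Continuous g) (hg0 : ∀ x, 0 ≤ g x)
    (hf : ∀ x y, |f x - f y| ≤ (g x + g y) * ‖x - y‖) (x : EuclideanSpace ℝ ι) :
    ‖fderiv ℝ f x‖ ≤ 2 * g x := by
  refine le_of_forall_pos_le_add fun ε hε => ?_
  refine norm_fderiv_le_of_lip' ℝ (by linarith [hg0 x]) ?_
  have : ∀ᶠ y in 𝓝 x, g y < g x + ε := hg.continuousAt.eventually_lt_const (by linarith)
  filter_upwards [this] with y hy
  exact (hf y x).trans (mul_le_mul_of_nonneg_right (by linarith) (norm_nonneg _))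

/-- The pair of independent standard Gaussian vectors is rotation invariant, and the arc from `x`
to `y` splits into `n + 1` rotations of equal angle: so the increment `f x - f y` is controlled by
the increment of `f` over one small rotation. -/
lemma integral_abs_sub_pow_le_rotation {p : ℕ}
    (hint : ∀ h : ℝ, Integrable (fun z : EuclideanSpace ℝ ι × EuclideanSpace ℝ ι =>
      |f z.1 - f (Real.cos h • z.1 + Real.sin h • z.2)| ^ (p + 1))
      ((stdGaussian _).prod (stdGaussian _))) (n : ℕ) :
    ∫ z, |f z.1 - f z.2| ^ (p + 1)
        ∂((stdGaussian (EuclideanSpace ℝ ι)).prod (stdGaussian (EuclideanSpace ℝ ι)))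
      ≤ (n + 1 : ℝ) ^ (p + 1) * ∫ z, |f z.1 - f (Real.cos (Real.pi / 2 / (n + 1)) • z.1
          + Real.sin (Real.pi / 2 / (n + 1)) • z.2)| ^ (p + 1)
        ∂((stdGaussian (EuclideanSpace ℝ ι)).prod (stdGaussian (EuclideanSpace ℝ ι))) := by
  set ν := (stdGaussian (EuclideanSpace ℝ ι)).prod (stdGaussian (EuclideanSpace ℝ ι)) with hν
  set h : ℝ := Real.pi / 2 / (n + 1) with hh
  set F : EuclideanSpace ℝ ι × EuclideanSpace ℝ ι → ℝ := fun z =>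
    |f z.1 - f (Real.cos h • z.1 + Real.sin h • z.2)| ^ (p + 1) with hF
  set T : ℕ → EuclideanSpace ℝ ι × EuclideanSpace ℝ ι → EuclideanSpace ℝ ι := fun k z =>
    Real.cos (k * h) • z.1 + Real.sin (k * h) • z.2 with hT
  have hrot : ∀ θ : ℝ, MeasurePreserving (ContinuousLinearMap.rotation θ) ν ν := fun θ =>
    ⟨by fun_prop,
      IsGaussian.map_rotation_eq_self (by simp) θ⟩
  have hFT : ∀ k : ℕ, ∀ z, F (ContinuousLinearMap.rotation (k * h) z)
      = |f (T k z) - f (T (k + 1) z)| ^ (p + 1) := by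
    intro k z
    simp only [hF, hT, ContinuousLinearMap.rotation_apply]
    congr 4
    push_cast
    rw [add_mul, one_mul, Real.cos_add, Real.sin_add]
    module
  have hFint : Integrable F ν := hint h
  have hkint : ∀ k : ℕ, Integrable (fun z => |f (T k z) - f (T (k + 1) z)| ^ (p + 1)) ν := by
    intro k
    have := (hrot (k * h)).integrable_comp_of_integrable hFint
    exact this.congr (ae_of_all _ fun z => hFT k z)
  have hkval : ∀ k : ℕ, ∫ z, |f (T k z) - f (T (k + 1) z)| ^ (p + 1) ∂ν = ∫ z, F z ∂ν := by
    intro k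
    have h1 : ∫ z, F z ∂(ν.map (ContinuousLinearMap.rotation (k * h)))
        = ∫ z, F (ContinuousLinearMap.rotation (k * h) z) ∂ν :=
      integral_map (hrot _).measurable.aemeasurable
        ((hrot _).map_eq.symm ▸ hFint.aestronglyMeasurable)
    rw [(hrot _).map_eq] at h1
    rw [h1]
    exact integral_congr_ae (ae_of_all _ fun z => (hFT k z).symm)
  have hpt : ∀ z : EuclideanSpace ℝ ι × EuclideanSpace ℝ ι, |f z.1 - f z.2| ^ (p + 1) ≤
      (n + 1 : ℝ) ^ p * ∑ k ∈ Finset.range (n + 1), |f (T k z) - f (T (k + 1) z)| ^ (p + 1) := by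
    intro z
    have h0 : T 0 z = z.1 := by simp [hT]
    have h1 : T (n + 1) z = z.2 := by
      have : ((n + 1 : ℕ) : ℝ) * h = Real.pi / 2 := by
        rw [hh]; push_cast; field_simp
      simp only [hT, this, Real.cos_pi_div_two, Real.sin_pi_div_two, zero_smul, one_smul, zero_add]
    have h2 : |f z.1 - f z.2| ≤ ∑ k ∈ Finset.range (n + 1), |f (T k z) - f (T (k + 1) z)| := by
      have : f z.1 - f z.2 = ∑ k ∈ Finset.range (n + 1), (f (T k z) - f (T (k + 1) z)) := by
        rw [Finset.sum_range_sub', h0, h1]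
      rw [this]
      exact Finset.abs_sum_le_sum_abs _ _
    refine (pow_le_pow_left₀ (abs_nonneg _) h2 _).trans ?_
    have := pow_sum_le_card_mul_sum_pow (s := Finset.range (n + 1))
      (f := fun k => |f (T k z) - f (T (k + 1) z)|) (fun k _ => abs_nonneg _) p
    simpa using this
  calc ∫ z, |f z.1 - f z.2| ^ (p + 1) ∂ν
      ≤ ∫ z, (n + 1 : ℝ) ^ p * ∑ k ∈ Finset.range (n + 1),
          |f (T k z) - f (T (k + 1) z)| ^ (p + 1) ∂ν := by
        refine integral_mono_of_nonneg (ae_of_all _ fun z => by positivity) ?_ (ae_of_all _ hpt)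
        exact (integrable_finsetSum _ fun k _ => hkint k).const_mul _
    _ = (n + 1 : ℝ) ^ (p + 1) * ∫ z, F z ∂ν := by
        rw [integral_const_mul, integral_finsetSum _ fun k _ => hkint k]
        simp_rw [hkval]
        rw [Finset.sum_const, Finset.card_range, nsmul_eq_mul]
        push_cast
        ring

/-- **Gaussian moment concentration**, in the form of Maurey and Pisier: if `g` is a local modulus
of Lipschitz continuity of `f`, the moments of `f x - f y` for independent standard Gaussian `x`
and `y` are bounded by those of `g`, with a constant free of the dimension. -/
theorem integral_abs_sub_pow_le (hg : Continuous g) (hg0 : ∀ x, 0 ≤ g x)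
    (hgC : ∀ x, g x ≤ C * (1 + ‖x‖)) (hf : ∀ x y, |f x - f y| ≤ (g x + g y) * ‖x - y‖) (p : ℕ) :
    ∫ z, |f z.1 - f z.2| ^ (p + 1)
        ∂((stdGaussian (EuclideanSpace ℝ ι)).prod (stdGaussian (EuclideanSpace ℝ ι)))
      ≤ Real.pi ^ (p + 1) * (∫ t, |t| ^ (p + 1) ∂(gaussianReal 0 1)) *
        ∫ x, g x ^ (p + 1) ∂(stdGaussian (EuclideanSpace ℝ ι)) := by
  set γ := stdGaussian (EuclideanSpace ℝ ι) with hγ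
  have hfc : Continuous f := continuous_of_local_modulus hg hf
  have hC : 0 ≤ C := by simpa using (hg0 0).trans (hgC 0)
  -- the displacement under a rotation of angle at most `2`
  have hdisp : ∀ h : ℝ, 0 ≤ h → h ≤ 2 → ∀ z : EuclideanSpace ℝ ι × EuclideanSpace ℝ ι,
      |f z.1 - f (Real.cos h • z.1 + Real.sin h • z.2)| ≤ h * (6 * C * (1 + ‖z‖) ^ 2) := by
    intro h h0 h2 z
    have hz1 : ‖z.1‖ ≤ ‖z‖ := norm_fst_le z
    have hz2 : ‖z.2‖ ≤ ‖z‖ := norm_snd_le z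
    have hsin : |Real.sin h| ≤ h := (Real.abs_sin_le_abs).trans (abs_of_nonneg h0).le
    have hcos : |1 - Real.cos h| ≤ h := by
      rw [abs_of_nonneg (by linarith [Real.cos_le_one h])]
      nlinarith [Real.one_sub_sq_div_two_le_cos (x := h)]
    have hw : ‖Real.cos h • z.1 + Real.sin h • z.2‖ ≤ 2 * ‖z‖ := by
      refine (norm_add_le _ _).trans ?_
      rw [norm_smul, norm_smul, Real.norm_eq_abs, Real.norm_eq_abs]
      nlinarith [Real.abs_cos_le_one h, Real.abs_sin_le_one h, norm_nonneg z.1, norm_nonneg z.2]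
    have hd : ‖z.1 - (Real.cos h • z.1 + Real.sin h • z.2)‖ ≤ h * (2 * ‖z‖) := by
      have : z.1 - (Real.cos h • z.1 + Real.sin h • z.2)
          = (1 - Real.cos h) • z.1 - Real.sin h • z.2 := by module
      rw [this]
      refine (norm_sub_le _ _).trans ?_
      rw [norm_smul, norm_smul, Real.norm_eq_abs, Real.norm_eq_abs]
      have e1 := mul_le_mul hcos hz1 (norm_nonneg _) h0
      have e2 := mul_le_mul hsin hz2 (norm_nonneg _) h0
      linarith
    have hgz : g z.1 + g (Real.cos h • z.1 + Real.sin h • z.2) ≤ 3 * C * (1 + ‖z‖) := by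
      have e1 := (hgC z.1).trans (mul_le_mul_of_nonneg_left (add_le_add_right hz1 1) hC)
      have e2 := (hgC _).trans (mul_le_mul_of_nonneg_left (add_le_add_right hw 1) hC)
      nlinarith [norm_nonneg z]
    refine (hf _ _).trans ((mul_le_mul hgz hd (norm_nonneg _) (by positivity)).trans ?_)
    nlinarith [mul_nonneg (mul_nonneg hC h0) (norm_nonneg z), mul_nonneg hC h0]
  have hint : ∀ h : ℝ, Integrable (fun z : EuclideanSpace ℝ ι × EuclideanSpace ℝ ι =>
      |f z.1 - f (Real.cos h • z.1 + Real.sin h • z.2)| ^ (p + 1)) (γ.prod γ) := by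
    intro h
    refine integrable_of_polynomial_growth (C := (9 * C) ^ (p + 1)) (q := 2 * (p + 1))
      (Continuous.aestronglyMeasurable (by fun_prop)) fun z => ?_
    rw [abs_of_nonneg (by positivity), pow_mul, ← mul_pow]
    refine pow_le_pow_left₀ (abs_nonneg _) ?_ _
    refine (hf _ _).trans ?_
    have hz1 : ‖z.1‖ ≤ ‖z‖ := norm_fst_le z
    have hz2 : ‖z.2‖ ≤ ‖z‖ := norm_snd_le z
    have hw : ‖Real.cos h • z.1 + Real.sin h • z.2‖ ≤ 2 * ‖z‖ := by
      refine (norm_add_le _ _).trans ?_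
      rw [norm_smul, norm_smul, Real.norm_eq_abs, Real.norm_eq_abs]
      nlinarith [Real.abs_cos_le_one h, Real.abs_sin_le_one h, norm_nonneg z.1, norm_nonneg z.2]
    have hd := (norm_sub_le z.1 (Real.cos h • z.1 + Real.sin h • z.2)).trans (add_le_add hz1 hw)
    have hgz : g z.1 + g (Real.cos h • z.1 + Real.sin h • z.2) ≤ 3 * C * (1 + ‖z‖) := by
      have e1 := (hgC z.1).trans (mul_le_mul_of_nonneg_left (add_le_add_right hz1 1) hC)
      have e2 := (hgC _).trans (mul_le_mul_of_nonneg_left (add_le_add_right hw 1) hC)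
      nlinarith [norm_nonneg z]
    refine (mul_le_mul hgz hd (norm_nonneg _) (by positivity)).trans ?_
    nlinarith [norm_nonneg z, mul_nonneg hC (norm_nonneg z)]
  set G : ℕ → EuclideanSpace ℝ ι × EuclideanSpace ℝ ι → ℝ := fun n z =>
    (n + 1 : ℝ) ^ (p + 1) * |f z.1 - f (Real.cos (Real.pi / 2 / (n + 1)) • z.1
      + Real.sin (Real.pi / 2 / (n + 1)) • z.2)| ^ (p + 1) with hG
  set L : EuclideanSpace ℝ ι × EuclideanSpace ℝ ι → ℝ := fun z =>
    |Real.pi / 2 * fderiv ℝ f z.1 z.2| ^ (p + 1) with hL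
  have hbound : ∀ n z, ‖G n z‖ ≤ (Real.pi / 2 * (6 * C)) ^ (p + 1) * (1 + ‖z‖) ^ (2 * (p + 1)) := by
    intro n z
    have hn : (0 : ℝ) < n + 1 := by positivity
    rw [Real.norm_eq_abs, abs_of_nonneg (by positivity), pow_mul, ← mul_pow]
    simp only [hG]
    rw [← mul_pow]
    refine pow_le_pow_left₀ (by positivity) ?_ _
    have h2 : Real.pi / 2 / (n + 1) ≤ 2 := by
      rw [div_le_iff₀ hn]
      nlinarith [Real.pi_le_four, (Nat.cast_nonneg n : (0 : ℝ) ≤ n)]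
    refine (mul_le_mul_of_nonneg_left (hdisp _ (by positivity) h2 z) hn.le).trans (le_of_eq ?_)
    field_simp
  have hdiff : ∀ᵐ z ∂(γ.prod γ), DifferentiableAt ℝ f z.1 :=
    Measure.quasiMeasurePreserving_fst.ae (ae_differentiableAt_of_local_modulus hgC hf)
  have hlim : ∀ᵐ z ∂(γ.prod γ), Tendsto (fun n => G n z) atTop (𝓝 (L z)) := by
    filter_upwards [hdiff] with z hz
    have hcurve : HasDerivAt (fun h : ℝ => Real.cos h • z.1 + Real.sin h • z.2) z.2 0 := by
      have e1 := (Real.hasDerivAt_cos 0).smul_const z.1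
      have e2 := (Real.hasDerivAt_sin 0).smul_const z.2
      have e3 := e1.add e2
      rw [Real.sin_zero, Real.cos_zero, neg_zero, zero_smul, one_smul, zero_add] at e3
      exact e3
    have hcomp : HasDerivAt (fun h : ℝ => f (Real.cos h • z.1 + Real.sin h • z.2))
        (fderiv ℝ f z.1 z.2) 0 := by
      have h0 : Real.cos 0 • z.1 + Real.sin 0 • z.2 = z.1 := by simp
      have hz' : HasFDerivAt f (fderiv ℝ f z.1) (Real.cos 0 • z.1 + Real.sin 0 • z.2) := by
        rw [h0]; exact hz.hasFDerivAt
      exact hz'.comp_hasDerivAt 0 hcurve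
    have hh : Tendsto (fun n : ℕ => Real.pi / 2 / ((n : ℝ) + 1)) atTop (𝓝[≠] 0) := by
      refine tendsto_nhdsWithin_iff.2 ⟨?_, Eventually.of_forall fun n => ?_⟩
      · exact tendsto_const_nhds.div_atTop
          (tendsto_atTop_add_const_right _ _ tendsto_natCast_atTop_atTop)
      · exact (div_pos (by positivity) (by positivity)).ne'
    have hs := ((hasDerivAt_iff_tendsto_slope_zero.1 hcomp).comp hh).const_mul (Real.pi / 2)
    refine ((hs.abs).pow (p + 1)).congr fun n => ?_
    have hn : (0 : ℝ) < n + 1 := by positivity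
    simp only [Function.comp, zero_add, smul_eq_mul, Real.cos_zero, Real.sin_zero, one_smul,
      zero_smul, add_zero, hG]
    rw [← mul_pow, ← mul_assoc, abs_mul, abs_sub_comm]
    congr 2
    rw [show Real.pi / 2 * (Real.pi / 2 / ((n : ℝ) + 1))⁻¹ = n + 1 by field_simp]
    exact abs_of_pos hn
  have hGm : ∀ n, AEStronglyMeasurable (G n) (γ.prod γ) := fun n =>
    ((hint _).const_mul _).aestronglyMeasurable
  have hbint : Integrable (fun z : EuclideanSpace ℝ ι × EuclideanSpace ℝ ι =>
      (Real.pi / 2 * (6 * C)) ^ (p + 1) * (1 + ‖z‖) ^ (2 * (p + 1))) (γ.prod γ) :=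
    integrable_of_polynomial_growth (C := (Real.pi / 2 * (6 * C)) ^ (p + 1)) (q := 2 * (p + 1))
      (Continuous.aestronglyMeasurable (by fun_prop)) fun z => by
        rw [abs_of_nonneg (by positivity)]
  have htend : Tendsto (fun n => ∫ z, G n z ∂(γ.prod γ)) atTop (𝓝 (∫ z, L z ∂(γ.prod γ))) :=
    tendsto_integral_of_dominated_convergence _ hGm hbint (fun n => ae_of_all _ (hbound n)) hlim
  have hLint : Integrable L (γ.prod γ) := by
    refine hbint.mono' (aestronglyMeasurable_of_tendsto_ae _ hGm hlim) ?_
    filter_upwards [hlim] with z hz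
    exact le_of_tendsto hz.norm (Eventually.of_forall fun n => hbound n z)
  -- let the number of rotations tend to infinity
  have hstep : ∫ z, |f z.1 - f z.2| ^ (p + 1) ∂(γ.prod γ) ≤ ∫ z, L z ∂(γ.prod γ) := by
    refine ge_of_tendsto' htend fun n => ?_
    rw [hG, integral_const_mul]
    exact integral_abs_sub_pow_le_rotation hint n
  -- given `x`, the derivative of `f` at `x` in the direction of `y` is a centred normal variable
  refine hstep.trans ?_
  rw [integral_prod _ hLint, ← integral_const_mul]
  have hgint : Integrable (fun x => g x ^ (p + 1)) γ :=
    integrable_of_polynomial_growth (C := C ^ (p + 1)) (q := p + 1)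
      (Continuous.aestronglyMeasurable (by fun_prop)) fun x => by
        rw [abs_of_nonneg (pow_nonneg (hg0 x) _), ← mul_pow]
        exact pow_le_pow_left₀ (hg0 x) (hgC x) _
  refine integral_mono_of_nonneg (ae_of_all _ fun x => integral_nonneg fun y => by positivity)
    (hgint.const_mul _) (ae_of_all _ fun x => ?_)
  have hm : 0 ≤ ∫ t, |t| ^ (p + 1) ∂(gaussianReal 0 1) := integral_nonneg fun t => by positivity
  simp only [hL, abs_mul, mul_pow]
  rw [integral_const_mul, integral_abs_pow_stdGaussian, abs_of_pos (by positivity)]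
  have hfd := pow_le_pow_left₀ (norm_nonneg _) (norm_fderiv_le_of_local_modulus hg hg0 hf x) (p + 1)
  calc (Real.pi / 2) ^ (p + 1) * (‖fderiv ℝ f x‖ ^ (p + 1) * ∫ t, |t| ^ (p + 1) ∂(gaussianReal 0 1))
      ≤ (Real.pi / 2) ^ (p + 1) * ((2 * g x) ^ (p + 1)
          * ∫ t, |t| ^ (p + 1) ∂(gaussianReal 0 1)) := by gcongr
    _ = _ := by rw [div_pow, mul_pow]; field_simp

/-- Moments about the mean, from the moments of the difference of two independent copies. -/
theorem integral_abs_sub_integral_pow_le (hg : Continuous g) (hg0 : ∀ x, 0 ≤ g x)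
    (hgC : ∀ x, g x ≤ C * (1 + ‖x‖)) (hf : ∀ x y, |f x - f y| ≤ (g x + g y) * ‖x - y‖) (p : ℕ) :
    ∫ x, |f x - ∫ y, f y ∂(stdGaussian (EuclideanSpace ℝ ι))| ^ (p + 1)
        ∂(stdGaussian (EuclideanSpace ℝ ι))
      ≤ Real.pi ^ (p + 1) * (∫ t, |t| ^ (p + 1) ∂(gaussianReal 0 1)) *
        ∫ x, g x ^ (p + 1) ∂(stdGaussian (EuclideanSpace ℝ ι)) := by
  set γ := stdGaussian (EuclideanSpace ℝ ι) with hγ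
  have hfc : Continuous f := continuous_of_local_modulus hg hf
  have hC : 0 ≤ C := by simpa using (hg0 0).trans (hgC 0)
  have hgrow : ∀ x y : EuclideanSpace ℝ ι, |f x - f y| ≤ C * (2 + ‖x‖ + ‖y‖) ^ 2 := by
    intro x y
    refine (hf x y).trans ?_
    have e1 : g x + g y ≤ C * (2 + ‖x‖ + ‖y‖) := by linarith [hgC x, hgC y]
    have e2 : ‖x - y‖ ≤ 2 + ‖x‖ + ‖y‖ := by linarith [norm_sub_le x y]
    refine (mul_le_mul e1 e2 (norm_nonneg _) (by positivity)).trans (le_of_eq (by ring))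
  have hint1 : ∀ x, ∀ q : ℕ, Integrable (fun y => |f x - f y| ^ q) γ := fun x q => by
    refine integrable_of_polynomial_growth (C := (C * (2 + ‖x‖) ^ 2) ^ q) (q := 2 * q)
      (Continuous.aestronglyMeasurable (by fun_prop)) fun y => ?_
    rw [abs_of_nonneg (by positivity), pow_mul, ← mul_pow, mul_assoc, ← mul_pow]
    refine pow_le_pow_left₀ (abs_nonneg _) ((hgrow x y).trans ?_) _
    refine mul_le_mul_of_nonneg_left (pow_le_pow_left₀ (by positivity) ?_ _) hC
    nlinarith [norm_nonneg x, norm_nonneg y, mul_nonneg (norm_nonneg x) (norm_nonneg y)]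
  have hfint : Integrable f γ := by
    have h1 : Integrable (fun y => f 0 - f y) γ := by
      refine Integrable.mono' (hint1 0 1) (Continuous.aestronglyMeasurable (by fun_prop))
        (ae_of_all _ fun y => ?_)
      simp
    refine ((integrable_const (f 0)).sub h1).congr (ae_of_all _ fun y => ?_)
    simp
  have hint2 : Integrable (fun z : EuclideanSpace ℝ ι × EuclideanSpace ℝ ι =>
      |f z.1 - f z.2| ^ (p + 1)) (γ.prod γ) := by
    refine integrable_of_polynomial_growth (C := (C * 2 ^ 2) ^ (p + 1)) (q := 2 * (p + 1))
      (Continuous.aestronglyMeasurable (by fun_prop)) fun z => ?_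
    rw [abs_of_nonneg (by positivity), pow_mul, ← mul_pow, mul_assoc, ← mul_pow]
    refine pow_le_pow_left₀ (abs_nonneg _) ((hgrow _ _).trans ?_) _
    refine mul_le_mul_of_nonneg_left (pow_le_pow_left₀ (by positivity) ?_ _) hC
    linarith [norm_fst_le z, norm_snd_le z]
  refine le_trans ?_ (integral_abs_sub_pow_le hg hg0 hgC hf p)
  rw [integral_prod _ hint2]
  refine integral_mono_of_nonneg (ae_of_all _ fun x => by positivity) hint2.integral_prod_left
    (ae_of_all _ fun x => ?_)
  have h1 : |f x - ∫ y, f y ∂γ| ≤ ∫ y, |f x - f y| ∂γ := by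
    have : f x - ∫ y, f y ∂γ = ∫ y, (f x - f y) ∂γ := by
      rw [integral_sub (integrable_const _) hfint]; simp
    rw [this]
    exact abs_integral_le_integral_abs
  refine (pow_le_pow_left₀ (abs_nonneg _) h1 _).trans ?_
  exact (convexOn_pow (p + 1)).map_integral_le (continuous_pow _).continuousOn isClosed_Ici
    (ae_of_all _ fun y => Set.mem_Ici.2 (abs_nonneg _)) (by simpa using hint1 x 1) (hint1 x (p + 1))

end GaussianMoments

/-! ### Euclidean and Frobenius norms -/

section Norms

variable {ι κ τ : Type*} [Fintype ι] [Fintype κ] [Fintype τ]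

/-- The Euclidean norm of a coordinate vector; the instance norm of `ι → ℝ` is the sup norm. -/
def vnorm (v : ι → ℝ) : ℝ := ‖WithLp.toLp 2 v‖

/-- The Frobenius norm of a matrix. -/
def frob (A : Matrix ι κ ℝ) : ℝ := vnorm fun p : ι × κ => A p.1 p.2

lemma vnorm_nonneg (v : ι → ℝ) : 0 ≤ vnorm v := norm_nonneg _

lemma vnorm_sq (v : ι → ℝ) : vnorm v ^ 2 = ∑ i, v i ^ 2 := by
  rw [vnorm, EuclideanSpace.real_norm_sq_eq]

lemma sqNorm_eq (v : ι → ℝ) : sqNorm v = vnorm v ^ 2 := by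
  rw [vnorm_sq, sqNorm, dotProduct]
  exact Finset.sum_congr rfl fun i _ => (sq _).symm

lemma dotProduct_self_eq (v : ι → ℝ) : v ⬝ᵥ v = vnorm v ^ 2 := sqNorm_eq v

lemma vnorm_add_le (u v : ι → ℝ) : vnorm (u + v) ≤ vnorm u + vnorm v := by
  simpa [vnorm] using norm_add_le (WithLp.toLp 2 u) (WithLp.toLp 2 v)

lemma vnorm_sub_le (u v : ι → ℝ) : vnorm (u - v) ≤ vnorm u + vnorm v := by
  simpa [vnorm] using norm_sub_le (WithLp.toLp 2 u) (WithLp.toLp 2 v)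

lemma vnorm_smul (c : ℝ) (v : ι → ℝ) : vnorm (c • v) = |c| * vnorm v := by
  simpa [vnorm] using norm_smul c (WithLp.toLp 2 v)

lemma abs_dotProduct_le (u v : ι → ℝ) : |u ⬝ᵥ v| ≤ vnorm u * vnorm v := by
  have := abs_real_inner_le_norm (WithLp.toLp 2 u) (WithLp.toLp 2 v)
  rwa [EuclideanSpace.inner_toLp_toLp, star_trivial, dotProduct_comm] at this

lemma vnorm_eq_zero {v : ι → ℝ} : vnorm v = 0 ↔ v = 0 := by
  simp [vnorm]

lemma vnorm_zero : vnorm (0 : ι → ℝ) = 0 := vnorm_eq_zero.2 rfl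

lemma frob_nonneg (A : Matrix ι κ ℝ) : 0 ≤ frob A := vnorm_nonneg _

lemma frob_sq (A : Matrix ι κ ℝ) : frob A ^ 2 = ∑ i, ∑ j, A i j ^ 2 := by
  rw [frob, vnorm_sq, Fintype.sum_prod_type]

lemma frob_sq_eq_sum_rows (A : Matrix ι κ ℝ) : frob A ^ 2 = ∑ i, vnorm (A i) ^ 2 := by
  simp_rw [frob_sq, vnorm_sq]

lemma frob_transpose (A : Matrix ι κ ℝ) : frob Aᵀ = frob A := by
  rw [← sq_eq_sq₀ (frob_nonneg _) (frob_nonneg _), frob_sq, frob_sq, Finset.sum_comm]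
  rfl

lemma frob_sq_eq_sum_cols (A : Matrix ι κ ℝ) : frob A ^ 2 = ∑ j, vnorm (Aᵀ j) ^ 2 := by
  rw [← frob_transpose, frob_sq_eq_sum_rows]

lemma frob_sq_eq_trace (A : Matrix ι κ ℝ) : frob A ^ 2 = (Aᵀ * A).trace := by
  rw [← frob_transpose, frob_sq]
  simp [trace, mul_apply, sq]

lemma frob_add_le (A B : Matrix ι κ ℝ) : frob (A + B) ≤ frob A + frob B :=
  vnorm_add_le (fun p : ι × κ => A p.1 p.2) fun p => B p.1 p.2

lemma frob_sub_le (A B : Matrix ι κ ℝ) : frob (A - B) ≤ frob A + frob B :=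
  vnorm_sub_le (fun p : ι × κ => A p.1 p.2) fun p => B p.1 p.2

lemma frob_smul (c : ℝ) (A : Matrix ι κ ℝ) : frob (c • A) = |c| * frob A :=
  vnorm_smul c fun p : ι × κ => A p.1 p.2

lemma frob_eq_zero {A : Matrix ι κ ℝ} : frob A = 0 ↔ A = 0 := by
  rw [frob, vnorm_eq_zero]
  exact ⟨fun h => by ext i j; exact congrFun h (i, j), fun h => by rw [h]; rfl⟩

lemma vnorm_mulVec_le (A : Matrix ι κ ℝ) (x : κ → ℝ) : vnorm (A *ᵥ x) ≤ frob A * vnorm x := by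
  refine (pow_le_pow_iff_left₀ (vnorm_nonneg _)
    (mul_nonneg (frob_nonneg _) (vnorm_nonneg _)) two_ne_zero).1 ?_
  rw [vnorm_sq, mul_pow, frob_sq_eq_sum_rows, Finset.sum_mul]
  refine Finset.sum_le_sum fun i _ => ?_
  rw [← mul_pow, ← sq_abs]
  exact pow_le_pow_left₀ (abs_nonneg _) (abs_dotProduct_le _ _) 2

/-- Multiplication from the left by an operator of norm at most `β`. -/
lemma frob_mul_le_of_bound {A : Matrix τ ι ℝ} {β : ℝ} (hβ : ∀ x, vnorm (A *ᵥ x) ≤ β * vnorm x)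
    (hβ0 : 0 ≤ β) (B : Matrix ι κ ℝ) : frob (A * B) ≤ β * frob B := by
  refine (pow_le_pow_iff_left₀ (frob_nonneg _)
    (mul_nonneg hβ0 (frob_nonneg _)) two_ne_zero).1 ?_
  rw [mul_pow, frob_sq_eq_sum_cols, frob_sq_eq_sum_cols, Finset.mul_sum]
  refine Finset.sum_le_sum fun j _ => ?_
  rw [← mul_pow]
  have : (A * B)ᵀ j = A *ᵥ Bᵀ j := by
    ext i; simp [mul_apply, mulVec, dotProduct]
  rw [this]
  exact pow_le_pow_left₀ (vnorm_nonneg _) (hβ _) 2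

lemma frob_mul_le (A : Matrix τ ι ℝ) (B : Matrix ι κ ℝ) : frob (A * B) ≤ frob A * frob B :=
  frob_mul_le_of_bound (vnorm_mulVec_le A) (frob_nonneg A) B

lemma abs_trace_mul_le (A : Matrix ι κ ℝ) (B : Matrix κ ι ℝ) :
    |(A * B).trace| ≤ frob A * frob B := by
  have : (A * B).trace = (fun p : ι × κ => A p.1 p.2) ⬝ᵥ fun p => Bᵀ p.1 p.2 := by
    simp [trace, mul_apply, dotProduct, Fintype.sum_prod_type]
  rw [this, ← frob_transpose B]
  exact abs_dotProduct_le _ _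

lemma dotProduct_mulVec_comm_transpose (A : Matrix ι κ ℝ) (x : ι → ℝ) (y : κ → ℝ) :
    x ⬝ᵥ A *ᵥ y = (Aᵀ *ᵥ x) ⬝ᵥ y := by
  rw [dotProduct_mulVec, mulVec_transpose]

lemma dotProduct_transpose_mulVec_self (A : Matrix ι ι ℝ) (x : ι → ℝ) :
    x ⬝ᵥ Aᵀ *ᵥ x = x ⬝ᵥ A *ᵥ x := by
  rw [dotProduct_mulVec_comm_transpose, transpose_transpose, dotProduct_comm]

/-- An operator and its transpose have the same bounds. -/
lemma vnorm_transpose_mulVec_le {A : Matrix ι κ ℝ} {β : ℝ} (hβ0 : 0 ≤ β)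
    (hβ : ∀ x, vnorm (A *ᵥ x) ≤ β * vnorm x) (y : ι → ℝ) :
    vnorm (Aᵀ *ᵥ y) ≤ β * vnorm y := by
  have h : vnorm (Aᵀ *ᵥ y) ^ 2 ≤ vnorm (Aᵀ *ᵥ y) * (β * vnorm y) := by
    rw [← dotProduct_self_eq, ← dotProduct_mulVec_comm_transpose]
    refine (le_abs_self _).trans ((abs_dotProduct_le _ _).trans ?_)
    nlinarith [hβ (Aᵀ *ᵥ y), vnorm_nonneg y]
  rcases (vnorm_nonneg (Aᵀ *ᵥ y)).eq_or_lt with h0 | h0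
  · rw [← h0]
    exact mul_nonneg hβ0 (vnorm_nonneg y)
  · nlinarith

end Norms

/-! ### Regularised equations with a coercive matrix -/

section Accretive

variable {ι κ : Type*} [Fintype ι] [Fintype κ]

lemma isUnit_of_mulVec_eq_zero [DecidableEq ι] {A : Matrix ι ι ℝ}
    (h : ∀ x, A *ᵥ x = 0 → x = 0) : IsUnit A := by
  rw [← mulVec_injective_iff_isUnit]
  intro x y hxy
  exact sub_eq_zero.1 (h _ (by rw [mulVec_sub]; exact sub_eq_zero.2 hxy))

lemma mul_inv_of_isUnit [DecidableEq ι] {A : Matrix ι ι ℝ} (h : IsUnit A) : A * A⁻¹ = 1 :=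
  mul_nonsing_inv A ((isUnit_iff_isUnit_det A).1 h)

lemma inv_mul_of_isUnit [DecidableEq ι] {A : Matrix ι ι ℝ} (h : IsUnit A) : A⁻¹ * A = 1 :=
  nonsing_inv_mul A ((isUnit_iff_isUnit_det A).1 h)

lemma add_smul_one_mulVec [DecidableEq ι] (A : Matrix ι ι ℝ) (lam : ℝ) (x : ι → ℝ) :
    (A + lam • (1 : Matrix ι ι ℝ)) *ᵥ x = A *ᵥ x + lam • x := by
  rw [add_mulVec, smul_mulVec, one_mulVec]

variable {A G : Matrix ι ι ℝ} {α β lam : ℝ}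

/-- The regularised equation `λ t + G A t = G b` with `G` positive semidefinite and `A` coercive:
its solution is bounded by the data, uniformly in `G` and `λ`. -/
lemma coercive_solution_bound (hG : ∀ x, 0 ≤ x ⬝ᵥ G *ᵥ x) (hlam : 0 < lam)
    (hA : ∀ x, α * vnorm x ^ 2 ≤ x ⬝ᵥ A *ᵥ x) {t b : ι → ℝ}
    (ht : lam • t + G *ᵥ (A *ᵥ t) = G *ᵥ b) : α * vnorm t ≤ vnorm b := by
  have h1 : lam • t = G *ᵥ (b - A *ᵥ t) := by rw [mulVec_sub, ← ht]; abel
  have h2 : 0 ≤ lam * (t ⬝ᵥ (b - A *ᵥ t)) := by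
    rw [← smul_eq_mul, ← smul_dotProduct, h1]
    have := hG (b - A *ᵥ t)
    rwa [dotProduct_comm] at this
  have h3 : 0 ≤ t ⬝ᵥ (b - A *ᵥ t) := nonneg_of_mul_nonneg_right h2 hlam
  rw [dotProduct_sub] at h3
  have h4 := (le_abs_self _).trans (abs_dotProduct_le t b)
  rcases (vnorm_nonneg t).eq_or_lt with h0 | h0
  · rw [← h0, mul_zero]; exact vnorm_nonneg b
  · nlinarith [hA t]

/-- The inverse of `λ + G A` is of size `1 / λ`, up to the condition number `β / α` of `A`, whatever
the size of `G`. -/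
lemma resolvent_bound_left (hG : ∀ x, 0 ≤ x ⬝ᵥ G *ᵥ x) (hlam : 0 < lam)
    (hα : 0 < α) (hA : ∀ x, α * vnorm x ^ 2 ≤ x ⬝ᵥ A *ᵥ x)
    (hβ : ∀ x, vnorm (A *ᵥ x) ≤ β * vnorm x) {e w : ι → ℝ}
    (he : lam • e + G *ᵥ (A *ᵥ e) = w) : lam * vnorm e ≤ (1 + β / α) * vnorm w := by
  have ht : lam • (G *ᵥ (A *ᵥ e)) + G *ᵥ (A *ᵥ (G *ᵥ (A *ᵥ e))) = G *ᵥ (A *ᵥ w) := by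
    rw [← he, mulVec_add, mulVec_add, mulVec_smul, mulVec_smul]
  have h1 := (coercive_solution_bound hG hlam hA ht).trans (hβ w)
  have h2 : lam • e = w - G *ᵥ (A *ᵥ e) := by rw [← he]; abel
  have h3 : lam * vnorm e ≤ vnorm w + vnorm (G *ᵥ (A *ᵥ e)) := by
    rw [← abs_of_pos hlam, ← vnorm_smul, h2]
    exact vnorm_sub_le _ _
  have h4 : vnorm (G *ᵥ (A *ᵥ e)) ≤ β / α * vnorm w := by
    rw [div_mul_eq_mul_div, le_div_iff₀ hα]; linarith
  linarith

lemma resolvent_bound_right (hG : ∀ x, 0 ≤ x ⬝ᵥ G *ᵥ x) (hlam : 0 < lam)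
    (hα : 0 < α) (hA : ∀ x, α * vnorm x ^ 2 ≤ x ⬝ᵥ A *ᵥ x) (hβ0 : 0 ≤ β)
    (hβ : ∀ x, vnorm (A *ᵥ x) ≤ β * vnorm x) {e w : ι → ℝ}
    (he : lam • e + A *ᵥ (G *ᵥ e) = w) : lam * vnorm e ≤ (1 + β / α) * vnorm w := by
  have ht : lam • (G *ᵥ e) + G *ᵥ (A *ᵥ (G *ᵥ e)) = G *ᵥ w := by
    rw [← he, mulVec_add, mulVec_smul]
  have h1 := coercive_solution_bound hG hlam hA ht
  have h2 : lam • e = w - A *ᵥ (G *ᵥ e) := by rw [← he]; abel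
  have h3 : lam * vnorm e ≤ vnorm w + vnorm (A *ᵥ (G *ᵥ e)) := by
    rw [← abs_of_pos hlam, ← vnorm_smul, h2]
    exact vnorm_sub_le _ _
  have h4 : vnorm (A *ᵥ (G *ᵥ e)) ≤ β / α * vnorm w := by
    refine (hβ _).trans ?_
    rw [div_mul_eq_mul_div, le_div_iff₀ hα, mul_assoc, mul_comm _ α]
    exact mul_le_mul_of_nonneg_left h1 hβ0
  linarith

lemma isUnit_mul_add_smul [DecidableEq ι] (hG : ∀ x, 0 ≤ x ⬝ᵥ G *ᵥ x) (hlam : 0 < lam)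
    (hα : 0 < α) (hA : ∀ x, α * vnorm x ^ 2 ≤ x ⬝ᵥ A *ᵥ x) :
    IsUnit (G * A + lam • (1 : Matrix ι ι ℝ)) := by
  refine isUnit_of_mulVec_eq_zero fun x hx => ?_
  rw [add_smul_one_mulVec, ← mulVec_mulVec] at hx
  have h1 : lam • x + G *ᵥ (A *ᵥ x) = G *ᵥ 0 := by rw [mulVec_zero, ← hx]; abel
  have h2 := coercive_solution_bound hG hlam hA h1
  rw [vnorm_zero] at h2
  exact vnorm_eq_zero.1 (le_antisymm (by nlinarith) (vnorm_nonneg x))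

variable {U E : Matrix ι κ ℝ}

/-- The regularised `κ × κ` matrix `Eᵀ G U + λ` is invertible if `U Eᵀ` is coercive. -/
lemma isUnit_conj_add_smul [DecidableEq κ] (hG : ∀ x, 0 ≤ x ⬝ᵥ G *ᵥ x) (hlam : 0 < lam)
    (hα : 0 < α) (hA : ∀ x, α * vnorm x ^ 2 ≤ x ⬝ᵥ (U * Eᵀ) *ᵥ x) :
    IsUnit (Eᵀ * G * U + lam • (1 : Matrix κ κ ℝ)) := by
  refine isUnit_of_mulVec_eq_zero fun z hz => ?_
  rw [add_smul_one_mulVec, ← mulVec_mulVec, ← mulVec_mulVec] at hz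
  have h0 : lam • z = -(Eᵀ *ᵥ (G *ᵥ (U *ᵥ z))) := by rw [eq_neg_iff_add_eq_zero, ← hz]; abel
  have h1 : lam • (G *ᵥ (U *ᵥ z)) + G *ᵥ ((U * Eᵀ) *ᵥ (G *ᵥ (U *ᵥ z))) = G *ᵥ 0 := by
    rw [← mulVec_mulVec, ← neg_neg (Eᵀ *ᵥ _), ← h0, mulVec_neg, mulVec_neg, mulVec_smul,
      mulVec_smul, mulVec_zero, add_neg_cancel]
  have h2 := coercive_solution_bound hG hlam hA h1
  rw [vnorm_zero] at h2
  have h3 : G *ᵥ (U *ᵥ z) = 0 :=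
    vnorm_eq_zero.1 (le_antisymm (by nlinarith [vnorm_nonneg (G *ᵥ (U *ᵥ z))]) (vnorm_nonneg _))
  rw [h3, mulVec_zero, neg_zero] at h0
  exact (smul_eq_zero.1 h0).resolve_left hlam.ne'

/-- The resolvent acts through the solution `t` of the regularised equation on `ι`. -/
lemma exists_solution_resolvent [DecidableEq κ]
    (hM : IsUnit (Eᵀ * G * U + lam • (1 : Matrix κ κ ℝ))) (r : κ → ℝ) :
    ∃ t, lam • t + G *ᵥ ((U * Eᵀ) *ᵥ t) = G *ᵥ (U *ᵥ r) ∧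
      lam • ((Eᵀ * G * U + lam • (1 : Matrix κ κ ℝ))⁻¹ *ᵥ r) = r - Eᵀ *ᵥ t := by
  set z := (Eᵀ * G * U + lam • (1 : Matrix κ κ ℝ))⁻¹ *ᵥ r with hz
  have h1 : (Eᵀ * G * U + lam • (1 : Matrix κ κ ℝ)) *ᵥ z = r := by
    rw [hz, mulVec_mulVec, mul_inv_of_isUnit hM, one_mulVec]
  rw [add_smul_one_mulVec, ← mulVec_mulVec, ← mulVec_mulVec] at h1
  have h2 : lam • z = r - Eᵀ *ᵥ (G *ᵥ (U *ᵥ z)) := by rw [← h1]; abel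
  refine ⟨G *ᵥ (U *ᵥ z), ?_, h2⟩
  have h3 : Eᵀ *ᵥ (G *ᵥ (U *ᵥ z)) = r - lam • z := by rw [h2]; abel
  rw [← mulVec_mulVec, h3, mulVec_sub, mulVec_sub, mulVec_smul, mulVec_smul]
  abel

/-- Comparison of the solutions of two regularised equations. To first order their difference,
tested against `f`, is `f' ⬝ (G - G') c` with `f'` and `c` depending on `G'` only; the remainder is
quadratic in `G - G'`. -/
lemma solution_comparison {G' : Matrix ι ι ℝ} (hG : ∀ x, 0 ≤ x ⬝ᵥ G *ᵥ x)
    (hGs' : G'ᵀ = G') (hlam : 0 < lam) (hα : 0 < α)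
    (hA : ∀ x, α * vnorm x ^ 2 ≤ x ⬝ᵥ A *ᵥ x) (hβ0 : 0 ≤ β)
    (hβ : ∀ x, vnorm (A *ᵥ x) ≤ β * vnorm x) {t t' b c f f' : ι → ℝ}
    (ht : lam • t + G *ᵥ (A *ᵥ t) = G *ᵥ b) (ht' : lam • t' + G' *ᵥ (A *ᵥ t') = G' *ᵥ b)
    (hc : lam • c = b - A *ᵥ t') (hf' : lam • f' + Aᵀ *ᵥ (G' *ᵥ f') = f) :
    vnorm (t - t') ≤ (1 + β / α) * (frob (G - G') * vnorm c) ∧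
      |f ⬝ᵥ (t - t')| ≤ lam * |f' ⬝ᵥ (G - G') *ᵥ c|
        + β * frob (G - G') * vnorm f' * vnorm (t - t') := by
  have he : lam • (t - t') + G *ᵥ (A *ᵥ (t - t')) = lam • ((G - G') *ᵥ c) := by
    rw [← mulVec_smul, hc, smul_sub, sub_mulVec]
    simp only [mulVec_sub]
    rw [← ht, ← ht']
    abel
  have h1 : vnorm (t - t') ≤ (1 + β / α) * (frob (G - G') * vnorm c) := by
    have := resolvent_bound_left hG hlam hα hA hβ he
    rw [vnorm_smul, abs_of_pos hlam] at this
    have h2 : vnorm (t - t') ≤ (1 + β / α) * vnorm ((G - G') *ᵥ c) := by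
      refine le_of_mul_le_mul_left ?_ hlam
      linarith
    refine h2.trans (mul_le_mul_of_nonneg_left (vnorm_mulVec_le _ _) ?_)
    positivity
  refine ⟨h1, ?_⟩
  have he' : lam • (t - t') + G' *ᵥ (A *ᵥ (t - t'))
      = lam • ((G - G') *ᵥ c) - (G - G') *ᵥ (A *ᵥ (t - t')) := by
    rw [← he, sub_mulVec]; abel
  have h2 : f ⬝ᵥ (t - t') = lam * (f' ⬝ᵥ (G - G') *ᵥ c)
      - f' ⬝ᵥ ((G - G') *ᵥ (A *ᵥ (t - t'))) := by
    have h3 : f ⬝ᵥ (t - t') = f' ⬝ᵥ (lam • (t - t') + G' *ᵥ (A *ᵥ (t - t'))) := by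
      rw [← hf', add_dotProduct, dotProduct_add, smul_dotProduct, dotProduct_smul,
        ← dotProduct_mulVec_comm_transpose, dotProduct_mulVec_comm_transpose G', hGs']
    rw [h3, he', dotProduct_sub, dotProduct_smul, smul_eq_mul]
  rw [h2]
  refine (abs_sub _ _).trans (add_le_add ?_ ?_)
  · rw [abs_mul, abs_of_pos hlam]
  · refine (abs_dotProduct_le _ _).trans ?_
    have h3 := (vnorm_mulVec_le (G - G') (A *ᵥ (t - t'))).trans
      (mul_le_mul_of_nonneg_left (hβ _) (frob_nonneg _))
    calc vnorm f' * vnorm ((G - G') *ᵥ (A *ᵥ (t - t')))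
        ≤ vnorm f' * (frob (G - G') * (β * vnorm (t - t'))) :=
          mul_le_mul_of_nonneg_left h3 (vnorm_nonneg _)
      _ = _ := by ring

end Accretive

/-! ### Traces of the resolvent of an accretive matrix -/

section FixedPoint

variable {ι : Type*} [Fintype ι] {P : Matrix ι ι ℝ} {c s : ℝ}

lemma isUnit_accretive_add [DecidableEq ι] (hP : ∀ x, 0 ≤ x ⬝ᵥ P *ᵥ x) (hc : 0 ≤ c) (hs : 0 < s) :
    IsUnit (c • P + s • (1 : Matrix ι ι ℝ)) := by
  refine isUnit_of_mulVec_eq_zero fun x hx => ?_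
  have h1 : x ⬝ᵥ (c • P + s • (1 : Matrix ι ι ℝ)) *ᵥ x = 0 := by rw [hx, dotProduct_zero]
  rw [add_smul_one_mulVec, smul_mulVec, dotProduct_add, dotProduct_smul, dotProduct_smul,
    dotProduct_self_eq, smul_eq_mul, smul_eq_mul] at h1
  have h2 := mul_nonneg hc (hP x)
  have h3 : vnorm x ^ 2 = 0 := by nlinarith [sq_nonneg (vnorm x)]
  exact vnorm_eq_zero.1 (pow_eq_zero_iff two_ne_zero |>.1 h3)

lemma vnorm_inv_mulVec_le [DecidableEq ι] (hP : ∀ x, 0 ≤ x ⬝ᵥ P *ᵥ x) (hc : 0 ≤ c) (hs : 0 < s)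
    (v : ι → ℝ) :
    vnorm ((c • P + s • (1 : Matrix ι ι ℝ))⁻¹ *ᵥ v) ≤ 1 / s * vnorm v := by
  set x := (c • P + s • (1 : Matrix ι ι ℝ))⁻¹ *ᵥ v with hx
  have h0 : (c • P + s • (1 : Matrix ι ι ℝ)) *ᵥ x = v := by
    rw [hx, mulVec_mulVec, mul_inv_of_isUnit (isUnit_accretive_add hP hc hs), one_mulVec]
  have h1 : x ⬝ᵥ v = c * (x ⬝ᵥ P *ᵥ x) + s * vnorm x ^ 2 := by
    rw [← h0, add_smul_one_mulVec, smul_mulVec, dotProduct_add, dotProduct_smul, dotProduct_smul,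
      dotProduct_self_eq, smul_eq_mul, smul_eq_mul]
  have h2 := mul_nonneg hc (hP x)
  have h3 := (le_abs_self _).trans (abs_dotProduct_le x v)
  rw [one_div, inv_mul_eq_div, le_div_iff₀ hs]
  rcases (vnorm_nonneg x).eq_or_lt with h | h
  · rw [← h, zero_mul]; exact vnorm_nonneg v
  · nlinarith

lemma trace_conj_nonneg (hP : ∀ x, 0 ≤ x ⬝ᵥ P *ᵥ x) {κ : Type*} [Fintype κ] (X : Matrix ι κ ℝ) :
    0 ≤ (Xᵀ * P * X).trace := by
  rw [trace]
  refine Finset.sum_nonneg fun i _ => ?_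
  have : (Xᵀ * P * X).diag i = Xᵀ i ⬝ᵥ P *ᵥ Xᵀ i := by
    rw [diag_apply, Matrix.mul_assoc, mul_apply]
    rfl
  rw [this]
  exact hP _

/-- Both terms on the right are nonnegative if `P` is accretive, i.e. has a nonnegative quadratic
form; no symmetry of `P` is needed. -/
lemma trace_mul_inv_eq [DecidableEq ι] (hP : ∀ x, 0 ≤ x ⬝ᵥ P *ᵥ x) (hc : 0 ≤ c) (hs : 0 < s) :
    (P * (c • P + s • (1 : Matrix ι ι ℝ))⁻¹).trace
      = c * frob (P * (c • P + s • (1 : Matrix ι ι ℝ))⁻¹) ^ 2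
        + s * (((c • P + s • (1 : Matrix ι ι ℝ))⁻¹)ᵀ * P *
          (c • P + s • (1 : Matrix ι ι ℝ))⁻¹).trace := by
  set X := (c • P + s • (1 : Matrix ι ι ℝ))⁻¹ with hX
  have h1 : Xᵀ * (c • Pᵀ + s • (1 : Matrix ι ι ℝ)) = 1 := by
    have := mul_inv_of_isUnit (isUnit_accretive_add hP hc hs)
    rw [← hX] at this
    have h2 := congrArg transpose this
    simpa [transpose_mul, transpose_add, transpose_smul] using h2
  have h2 : P * X = c • ((P * X)ᵀ * (P * X)) + s • (Xᵀ * P * X) := by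
    calc P * X = Xᵀ * (c • Pᵀ + s • (1 : Matrix ι ι ℝ)) * (P * X) := by rw [h1, Matrix.one_mul]
      _ = _ := by
        rw [transpose_mul]
        simp only [Matrix.mul_add, Matrix.add_mul, Matrix.mul_smul, Matrix.smul_mul,
          Matrix.mul_one, Matrix.mul_assoc]
  conv_lhs => rw [h2]
  rw [trace_add, trace_smul, trace_smul, frob_sq_eq_trace, smul_eq_mul, smul_eq_mul]

lemma mul_trace_inv_add [DecidableEq ι] (hP : ∀ x, 0 ≤ x ⬝ᵥ P *ᵥ x) (hc : 0 ≤ c) (hs : 0 < s) :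
    c * (P * (c • P + s • (1 : Matrix ι ι ℝ))⁻¹).trace
      + s * ((c • P + s • (1 : Matrix ι ι ℝ))⁻¹).trace = Fintype.card ι := by
  have h := congrArg trace (mul_inv_of_isUnit (isUnit_accretive_add hP hc hs))
  rw [Matrix.add_mul, trace_add, smul_mul, smul_mul, Matrix.one_mul, trace_smul, trace_smul,
    trace_one, smul_eq_mul, smul_eq_mul] at h
  exact h

lemma mul_frob_inv_sq_le [DecidableEq ι] (hP : ∀ x, 0 ≤ x ⬝ᵥ P *ᵥ x) (hc : 0 ≤ c) (hs : 0 < s) :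
    s * frob ((c • P + s • (1 : Matrix ι ι ℝ))⁻¹) ^ 2
      ≤ ((c • P + s • (1 : Matrix ι ι ℝ))⁻¹).trace := by
  set X := (c • P + s • (1 : Matrix ι ι ℝ))⁻¹ with hX
  have h1 : Xᵀ = c • (Xᵀ * P * X) + s • (Xᵀ * X) := by
    calc Xᵀ = Xᵀ * ((c • P + s • (1 : Matrix ι ι ℝ)) * X) := by
          rw [mul_inv_of_isUnit (isUnit_accretive_add hP hc hs), Matrix.mul_one]
      _ = _ := by
        simp only [Matrix.mul_add, Matrix.add_mul, Matrix.mul_smul, Matrix.smul_mul,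
          Matrix.one_mul, Matrix.mul_assoc]
  have h2 := congrArg trace h1
  rw [trace_transpose, trace_add, trace_smul, trace_smul, ← frob_sq_eq_trace, smul_eq_mul,
    smul_eq_mul] at h2
  have := mul_nonneg hc (trace_conj_nonneg hP X)
  linarith

/-- `s ↦ s tr (c P + s)⁻¹` is nondecreasing. With `a ^ 2` and `b ^ 2` its values at `s ≤ s'`, the
resolvent identity and Cauchy-Schwarz give `(a - b) (s' a + s b) ≤ 0`, which excludes `b < a`. -/
lemma mul_trace_inv_mono [DecidableEq ι] (hP : ∀ x, 0 ≤ x ⬝ᵥ P *ᵥ x) (hc : 0 ≤ c) (hs : 0 < s)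
    {s' : ℝ} (hss : s ≤ s') :
    s * ((c • P + s • (1 : Matrix ι ι ℝ))⁻¹).trace
      ≤ s' * ((c • P + s' • (1 : Matrix ι ι ℝ))⁻¹).trace := by
  have hs' : 0 < s' := hs.trans_le hss
  set X := (c • P + s • (1 : Matrix ι ι ℝ))⁻¹ with hX
  set Y := (c • P + s' • (1 : Matrix ι ι ℝ))⁻¹ with hY
  have hXu := inv_mul_of_isUnit (isUnit_accretive_add hP hc hs)
  have hYu := mul_inv_of_isUnit (isUnit_accretive_add hP hc hs')
  rw [← hX] at hXu
  rw [← hY] at hYu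
  have hres : X - Y = (s' - s) • (X * Y) := by
    calc X - Y = X * ((c • P + s' • (1 : Matrix ι ι ℝ)) * Y)
          - X * (c • P + s • (1 : Matrix ι ι ℝ)) * Y := by
            rw [hYu, hXu, Matrix.mul_one, Matrix.one_mul]
      _ = (s' - s) • (X * Y) := by
        rw [Matrix.mul_assoc, ← Matrix.mul_sub, ← Matrix.sub_mul]
        have : c • P + s' • (1 : Matrix ι ι ℝ) - (c • P + s • (1 : Matrix ι ι ℝ))
            = (s' - s) • (1 : Matrix ι ι ℝ) := by rw [sub_smul]; abel
        rw [this, smul_mul, Matrix.one_mul, Matrix.mul_smul]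
  have htr : X.trace - Y.trace = (s' - s) * (X * Y).trace := by
    rw [← trace_sub, hres, trace_smul, smul_eq_mul]
  have h1 : s * frob X ^ 2 ≤ X.trace := mul_frob_inv_sq_le hP hc hs
  have h2 : s' * frob Y ^ 2 ≤ Y.trace := mul_frob_inv_sq_le hP hc hs'
  have h3 : (X * Y).trace ≤ frob X * frob Y := (le_abs_self _).trans (abs_trace_mul_le X Y)
  by_contra hcon
  push Not at hcon
  have hx := frob_nonneg X
  have hy := frob_nonneg Y
  have hYt : 0 ≤ Y.trace := (by positivity : 0 ≤ s' * frob Y ^ 2).trans h2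
  -- `a` and `b` are the square roots of the two values
  set a := Real.sqrt (s * X.trace) with ha
  set b := Real.sqrt (s' * Y.trace) with hb
  have hXt : 0 ≤ X.trace := (by positivity : 0 ≤ s * frob X ^ 2).trans h1
  have ha2 : a ^ 2 = s * X.trace := Real.sq_sqrt (by positivity)
  have hb2 : b ^ 2 = s' * Y.trace := Real.sq_sqrt (by positivity)
  have ha0 : 0 ≤ a := Real.sqrt_nonneg _
  have hb0 : 0 ≤ b := Real.sqrt_nonneg _
  have hab : b < a := by
    refine (pow_lt_pow_iff_left₀ hb0 ha0 two_ne_zero).1 ?_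
    rw [ha2, hb2]; exact hcon
  have hsx : s * frob X ≤ a := by
    refine (pow_le_pow_iff_left₀ (by positivity) ha0 two_ne_zero).1 ?_
    rw [ha2]; nlinarith
  have hsy : s' * frob Y ≤ b := by
    refine (pow_le_pow_iff_left₀ (by positivity) hb0 two_ne_zero).1 ?_
    rw [hb2]; nlinarith
  have h4 : s * s' * (X * Y).trace ≤ a * b := by
    have := mul_le_mul hsx hsy (by positivity) ha0
    nlinarith [mul_pos hs hs']
  have h5 : s' * a ^ 2 - s * b ^ 2 = (s' - s) * (s * s' * (X * Y).trace) := by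
    rw [ha2, hb2]; linear_combination s * s' * htr
  have h6 : s' * a ^ 2 - s * b ^ 2 ≤ (s' - s) * (a * b) := by
    rw [h5]; exact mul_le_mul_of_nonneg_left h4 (by linarith)
  -- `s' a² - s b² - (s' - s) a b = (a - b) (s' a + s b)`
  nlinarith [mul_pos (sub_pos.2 hab) (by nlinarith : 0 < s' * a + s * b)]

end FixedPoint

/-! ### The fixed-point equation -/

section CorrectionFactor

variable {ι : Type*} [Fintype ι] [DecidableEq ι] {P : Matrix ι ι ℝ} {c lam m : ℝ}

lemma trace_mul_inv_nonneg (hP : ∀ x, 0 ≤ x ⬝ᵥ P *ᵥ x) {s : ℝ} (hc : 0 ≤ c) (hs : 0 < s) :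
    0 ≤ (P * (c • P + s • (1 : Matrix ι ι ℝ))⁻¹).trace := by
  rw [trace_mul_inv_eq hP hc hs]
  have := trace_conj_nonneg hP (c • P + s • (1 : Matrix ι ι ℝ))⁻¹
  positivity

lemma trace_mul_inv_le (hP : ∀ x, 0 ≤ x ⬝ᵥ P *ᵥ x) {s : ℝ} (hc : 0 ≤ c) (hs : 0 < s) :
    (P * (c • P + s • (1 : Matrix ι ι ℝ))⁻¹).trace
      ≤ frob P * (1 / s * frob (1 : Matrix ι ι ℝ)) := by
  refine (le_abs_self _).trans ((abs_trace_mul_le _ _).trans ?_)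
  refine mul_le_mul_of_nonneg_left ?_ (frob_nonneg P)
  have := frob_mul_le_of_bound (vnorm_inv_mulVec_le hP hc hs) (by positivity) (1 : Matrix ι ι ℝ)
  rwa [Matrix.mul_one] at this

/-- Pulling the factor `1 / (1 + δ)` out of the resolvent. -/
lemma trace_mul_inv_scale (hP : ∀ x, 0 ≤ x ⬝ᵥ P *ᵥ x) (hc : 0 ≤ c) (hlam : 0 < lam) {δ : ℝ}
    (hδ : 0 ≤ δ) :
    (P * ((c * (1 / (1 + δ))) • P + lam • (1 : Matrix ι ι ℝ))⁻¹).trace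
      = (1 + δ) * (P * (c • P + (lam * (1 + δ)) • (1 : Matrix ι ι ℝ))⁻¹).trace := by
  have hδ1 : 1 + δ ≠ 0 := by positivity
  have h : ((c * (1 / (1 + δ))) • P + lam • (1 : Matrix ι ι ℝ))⁻¹
      = (1 + δ) • (c • P + (lam * (1 + δ)) • (1 : Matrix ι ι ℝ))⁻¹ := by
    refine inv_eq_right_inv ?_
    have e : (c * (1 / (1 + δ))) • P + lam • (1 : Matrix ι ι ℝ)
        = (1 / (1 + δ)) • (c • P + (lam * (1 + δ)) • (1 : Matrix ι ι ℝ)) := by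
      rw [smul_add, smul_smul, smul_smul]
      congr 2 <;> field_simp
    rw [e, smul_mul, Matrix.mul_smul,
      mul_inv_of_isUnit (isUnit_accretive_add hP hc (by positivity)), smul_smul,
      one_div_mul_cancel hδ1, one_smul]
  rw [h, Matrix.mul_smul, trace_smul, smul_eq_mul]

lemma continuousOn_trace_mul_inv (hP : ∀ x, 0 ≤ x ⬝ᵥ P *ᵥ x) (hc : 0 ≤ c) (hlam : 0 < lam) :
    ContinuousOn (fun δ : ℝ => (P * ((c * (1 / (1 + δ))) • P + lam • (1 : Matrix ι ι ℝ))⁻¹).trace)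
      (Set.Ici 0) := by
  have hA : ContinuousOn (fun δ : ℝ => (c * (1 / (1 + δ))) • P + lam • (1 : Matrix ι ι ℝ))
      (Set.Ici 0) := by
    refine ContinuousOn.fun_add (ContinuousOn.fun_smul ?_ continuousOn_const) continuousOn_const
    refine continuousOn_const.mul (continuousOn_const.div (by fun_prop) fun δ hδ => ?_)
    have : (0 : ℝ) ≤ δ := hδ
    positivity
  have hdet : ContinuousOn (fun δ : ℝ =>
      ((c * (1 / (1 + δ))) • P + lam • (1 : Matrix ι ι ℝ)).det) (Set.Ici 0) :=
    (Continuous.matrix_det continuous_id).comp_continuousOn hA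
  have hadj : ContinuousOn (fun δ : ℝ =>
      ((c * (1 / (1 + δ))) • P + lam • (1 : Matrix ι ι ℝ)).adjugate) (Set.Ici 0) :=
    (Continuous.matrix_adjugate continuous_id).comp_continuousOn hA
  have hinv : ContinuousOn (fun δ : ℝ =>
      ((c * (1 / (1 + δ))) • P + lam • (1 : Matrix ι ι ℝ))⁻¹) (Set.Ici 0) := by
    simp_rw [inv_def, Ring.inverse_eq_inv']
    refine (hdet.inv₀ fun δ hδ => ?_).smul hadj
    have h0 : (0 : ℝ) ≤ δ := hδ
    exact ((isUnit_iff_isUnit_det _).1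
      (isUnit_accretive_add hP (c := c * (1 / (1 + δ))) (by positivity) hlam)).ne_zero
  have hmul : Continuous fun B : Matrix ι ι ℝ => (P * B).trace :=
    Continuous.matrix_trace (continuous_const.matrix_mul continuous_id)
  exact hmul.comp_continuousOn hinv

/-- Solutions are zeros of a continuous function which is nonnegative at `0` and negative for
large `δ`; in the form `m c δ / (1 + δ) = |ι| - s tr (c P + s)⁻¹` with `s = λ (1 + δ)` the left side
is strictly increasing and the right side nonincreasing. -/
theorem existsUnique_fixedPoint (hP : ∀ x, 0 ≤ x ⬝ᵥ P *ᵥ x) (hc : 0 < c) (hlam : 0 < lam)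
    (hm : 0 < m) :
    ∃! δ : ℝ, 0 ≤ δ ∧
      δ = 1 / m * (P * ((c * (1 / (1 + δ))) • P + lam • (1 : Matrix ι ι ℝ))⁻¹).trace := by
  set F : ℝ → ℝ := fun δ =>
    1 / m * (P * ((c * (1 / (1 + δ))) • P + lam • (1 : Matrix ι ι ℝ))⁻¹).trace with hF
  have huniq : ∀ δ₁ δ₂ : ℝ, 0 ≤ δ₁ → δ₁ = F δ₁ → δ₂ = F δ₂ → ¬ δ₁ < δ₂ := by
    intro δ₁ δ₂ h0 h1 h2 hlt
    have key : ∀ δ : ℝ, 0 ≤ δ → δ = F δ → m * c * (δ / (1 + δ)) = Fintype.card ι -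
        lam * (1 + δ) * ((c • P + (lam * (1 + δ)) • (1 : Matrix ι ι ℝ))⁻¹).trace := by
      intro δ hδ h
      have e := mul_trace_inv_add hP hc.le (s := lam * (1 + δ)) (by positivity)
      simp only [hF] at h
      rw [trace_mul_inv_scale hP hc.le hlam hδ] at h
      have e2 : δ / (1 + δ)
          = 1 / m * (P * (c • P + (lam * (1 + δ)) • (1 : Matrix ι ι ℝ))⁻¹).trace := by
        rw [div_eq_iff (by positivity)]
        linarith
      rw [e2, ← e]
      field_simp
      ring
    have k1 := key δ₁ h0 h1
    have k2 := key δ₂ (h0.trans hlt.le) h2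
    have hmono := mul_trace_inv_mono hP hc.le (s := lam * (1 + δ₁)) (s' := lam * (1 + δ₂))
      (by positivity) (by nlinarith)
    have hlt' : δ₁ / (1 + δ₁) < δ₂ / (1 + δ₂) := by
      rw [div_lt_div_iff₀ (by positivity) (by linarith)]
      nlinarith
    nlinarith [mul_pos hm hc]
  obtain ⟨M, hM0, hM⟩ : ∃ M : ℝ, 0 ≤ M ∧ ∀ δ, 0 ≤ δ → F δ ≤ M := by
    refine ⟨1 / m * (frob P * (1 / lam * frob (1 : Matrix ι ι ℝ))), ?_, fun δ hδ => ?_⟩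
    · have := frob_nonneg P
      have := frob_nonneg (1 : Matrix ι ι ℝ)
      positivity
    · exact mul_le_mul_of_nonneg_left (trace_mul_inv_le hP (by positivity) hlam) (by positivity)
  have hcont : ContinuousOn (fun δ => F δ - δ) (Set.Icc 0 M) :=
    ((continuousOn_const.mul (continuousOn_trace_mul_inv hP hc.le hlam)).sub
      continuousOn_id).mono Set.Icc_subset_Ici_self
  have h0 : 0 ≤ F 0 - 0 := by
    rw [sub_zero]
    exact mul_nonneg (by positivity) (trace_mul_inv_nonneg hP (by positivity) hlam)
  have h1 : F M - M ≤ 0 := by linarith [hM M hM0]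
  obtain ⟨δ, hδ, hδ'⟩ := intermediate_value_Icc' hM0 hcont ⟨h1, h0⟩
  have hfix : δ = F δ := (sub_eq_zero.1 hδ').symm
  refine ⟨δ, ⟨hδ.1, hfix⟩, fun δ' h' => ?_⟩
  rcases lt_trichotomy δ' δ with h | h | h
  · exact absurd h (huniq _ _ h'.1 h'.2 hfix)
  · exact h
  · exact absurd h (huniq _ _ hδ.1 hfix h'.2)

end CorrectionFactor

/-! ### Push-through identities -/

section PushThrough

lemma conj_nonneg {ι : Type*} [Fintype ι] {A : Matrix ι ι ℝ} (hA : ∀ x, 0 ≤ x ⬝ᵥ A *ᵥ x)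
    (B : Matrix ι ι ℝ) (x : ι → ℝ) : 0 ≤ x ⬝ᵥ (B * A * Bᵀ) *ᵥ x := by
  rw [Matrix.mul_assoc, ← mulVec_mulVec, dotProduct_mulVec_comm_transpose, ← mulVec_mulVec]
  exact hA _

variable {ι κ : Type*} [Fintype ι] [Fintype κ] [DecidableEq ι] [DecidableEq κ]
  {U E : Matrix ι κ ℝ} {B : Matrix ι ι ℝ} {c lam : ℝ}

/-- Push-through identity for the two resolvents of `Eᵀ Bᵀ B U` and `B U Eᵀ Bᵀ`. -/
lemma mul_inv_push (hc : 0 ≤ c) (hlam : 0 < lam) (hA : ∀ x, 0 ≤ x ⬝ᵥ (U * Eᵀ) *ᵥ x)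
    (hM : IsUnit (c • (Eᵀ * (Bᵀ * B) * U) + lam • (1 : Matrix κ κ ℝ))) :
    B * U * (c • (Eᵀ * (Bᵀ * B) * U) + lam • (1 : Matrix κ κ ℝ))⁻¹
      = (c • (B * (U * Eᵀ) * Bᵀ) + lam • (1 : Matrix ι ι ℝ))⁻¹ * (B * U) := by
  have hX := inv_mul_of_isUnit (isUnit_accretive_add (conj_nonneg hA B) hc hlam)
  have hQ := mul_inv_of_isUnit hM
  have hcomm : (c • (B * (U * Eᵀ) * Bᵀ) + lam • (1 : Matrix ι ι ℝ)) * (B * U)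
      = B * U * (c • (Eᵀ * (Bᵀ * B) * U) + lam • (1 : Matrix κ κ ℝ)) := by
    simp only [Matrix.mul_add, Matrix.add_mul, Matrix.mul_smul, Matrix.smul_mul,
      Matrix.one_mul, Matrix.mul_one, Matrix.mul_assoc]
  calc _ = (c • (B * (U * Eᵀ) * Bᵀ) + lam • (1 : Matrix ι ι ℝ))⁻¹
        * ((c • (B * (U * Eᵀ) * Bᵀ) + lam • (1 : Matrix ι ι ℝ)) * (B * U))
        * (c • (Eᵀ * (Bᵀ * B) * U) + lam • (1 : Matrix κ κ ℝ))⁻¹ := by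
          rw [← Matrix.mul_assoc _ _ (B * U), hX, Matrix.one_mul]
    _ = _ := by
          rw [hcomm, Matrix.mul_assoc, Matrix.mul_assoc (B * U), hQ, Matrix.mul_one]

lemma inv_mul_push (hc : 0 ≤ c) (hlam : 0 < lam) (hA : ∀ x, 0 ≤ x ⬝ᵥ (U * Eᵀ) *ᵥ x)
    (hM : IsUnit (c • (Eᵀ * (Bᵀ * B) * U) + lam • (1 : Matrix κ κ ℝ))) :
    (c • (Eᵀ * (Bᵀ * B) * U) + lam • (1 : Matrix κ κ ℝ))⁻¹ * (Eᵀ * Bᵀ)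
      = Eᵀ * Bᵀ * (c • (B * (U * Eᵀ) * Bᵀ) + lam • (1 : Matrix ι ι ℝ))⁻¹ := by
  have hX := mul_inv_of_isUnit (isUnit_accretive_add (conj_nonneg hA B) hc hlam)
  have hQ := inv_mul_of_isUnit hM
  have hcomm : (c • (Eᵀ * (Bᵀ * B) * U) + lam • (1 : Matrix κ κ ℝ)) * (Eᵀ * Bᵀ)
      = Eᵀ * Bᵀ * (c • (B * (U * Eᵀ) * Bᵀ) + lam • (1 : Matrix ι ι ℝ)) := by
    simp only [Matrix.mul_add, Matrix.add_mul, Matrix.mul_smul, Matrix.smul_mul,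
      Matrix.one_mul, Matrix.mul_one, Matrix.mul_assoc]
  calc _ = (c • (Eᵀ * (Bᵀ * B) * U) + lam • (1 : Matrix κ κ ℝ))⁻¹
        * ((Eᵀ * Bᵀ) * (c • (B * (U * Eᵀ) * Bᵀ) + lam • (1 : Matrix ι ι ℝ)))
        * (c • (B * (U * Eᵀ) * Bᵀ) + lam • (1 : Matrix ι ι ℝ))⁻¹ := by
          rw [Matrix.mul_assoc _ (Eᵀ * Bᵀ * _), Matrix.mul_assoc (Eᵀ * Bᵀ), hX, Matrix.mul_one]
    _ = _ := by
          rw [← hcomm, ← Matrix.mul_assoc _ _ (Eᵀ * Bᵀ), hQ, Matrix.one_mul]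

lemma trace_push (hc : 0 ≤ c) (hlam : 0 < lam) (hA : ∀ x, 0 ≤ x ⬝ᵥ (U * Eᵀ) *ᵥ x)
    (hM : IsUnit (c • (Eᵀ * (Bᵀ * B) * U) + lam • (1 : Matrix κ κ ℝ))) :
    (Eᵀ * (Bᵀ * B) * U * (c • (Eᵀ * (Bᵀ * B) * U) + lam • (1 : Matrix κ κ ℝ))⁻¹).trace
      = (B * (U * Eᵀ) * Bᵀ * (c • (B * (U * Eᵀ) * Bᵀ) + lam • (1 : Matrix ι ι ℝ))⁻¹).trace := by
  have h := mul_inv_push (B := B) hc hlam hA hM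
  calc _ = (Eᵀ * Bᵀ *
        (B * U * (c • (Eᵀ * (Bᵀ * B) * U) + lam • (1 : Matrix κ κ ℝ))⁻¹)).trace := by
          simp only [Matrix.mul_assoc]
    _ = _ := by
          rw [h, trace_mul_comm, Matrix.mul_assoc, trace_mul_comm]
          simp only [Matrix.mul_assoc]

/-- The trace in the denominator of the second-order correction is a squared Frobenius norm. -/
lemma trace_second_order (hc : 0 ≤ c) (hlam : 0 < lam) (hA : ∀ x, 0 ≤ x ⬝ᵥ (U * Eᵀ) *ᵥ x)
    (hM : IsUnit (c • (Eᵀ * (Bᵀ * B) * U) + lam • (1 : Matrix κ κ ℝ))) :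
    ((c • (Eᵀ * (Bᵀ * B) * E)) * ((c • (Eᵀ * (Bᵀ * B) * U) + lam • (1 : Matrix κ κ ℝ))⁻¹)ᵀ *
      (c • (Uᵀ * (Bᵀ * B) * U)) * (c • (Eᵀ * (Bᵀ * B) * U) + lam • (1 : Matrix κ κ ℝ))⁻¹).trace
      = c ^ 2 * frob (B * (U * Eᵀ) * Bᵀ *
          (c • (B * (U * Eᵀ) * Bᵀ) + lam • (1 : Matrix ι ι ℝ))⁻¹) ^ 2 := by
  set Q := (c • (Eᵀ * (Bᵀ * B) * U) + lam • (1 : Matrix κ κ ℝ))⁻¹ with hQ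
  set X := (c • (B * (U * Eᵀ) * Bᵀ) + lam • (1 : Matrix ι ι ℝ))⁻¹ with hX
  have h : B * (U * Eᵀ) * Bᵀ * X = B * U * Q * (Eᵀ * Bᵀ) := by
    rw [Matrix.mul_assoc (B * U) Q, hQ, inv_mul_push hc hlam hA hM]
    simp only [Matrix.mul_assoc, hX]
  rw [h, frob_sq_eq_trace]
  have h2 : (c • (Eᵀ * (Bᵀ * B) * E)) * Qᵀ * (c • (Uᵀ * (Bᵀ * B) * U)) * Q
      = c ^ 2 • ((Eᵀ * Bᵀ) * ((B * U * Q * (Eᵀ * Bᵀ))ᵀ * (B * U * Q))) := by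
    simp only [transpose_mul, transpose_transpose, Matrix.smul_mul, Matrix.mul_smul, smul_smul,
      Matrix.mul_assoc, sq]
  rw [h2, trace_smul, smul_eq_mul, trace_mul_comm]
  simp only [Matrix.mul_assoc]

end PushThrough

/-! ### Consequences of the bounded eigenspectrum -/

section Spectrum

variable {ι : Type*} [Fintype ι]

lemma le_quadForm_of_spectrum [DecidableEq ι] {H : Matrix ι ι ℝ} (hH : H.IsHermitian) {l : ℝ}
    (h : ∀ t ∈ spectrum ℝ H, l ≤ t) (x : ι → ℝ) : l * vnorm x ^ 2 ≤ x ⬝ᵥ H *ᵥ x := by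
  have hS : (H - l • (1 : Matrix ι ι ℝ)).IsHermitian := by
    have : (l • (1 : Matrix ι ι ℝ)).IsHermitian := by
      rw [IsHermitian, conjTranspose_smul, conjTranspose_one, star_trivial]
    exact hH.sub this
  have hP : (H - l • (1 : Matrix ι ι ℝ)).PosSemidef := by
    refine hS.posSemidef_iff_eigenvalues_nonneg.2 fun i => ?_
    have h1 := hS.eigenvalues_mem_spectrum_real i
    have h2 : hS.eigenvalues i + l ∈ spectrum ℝ H := by
      have := (spectrum.add_mem_add_iff (R := ℝ) (a := H - l • (1 : Matrix ι ι ℝ))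
        (r := hS.eigenvalues i) (s := l)).2 h1
      rwa [Algebra.algebraMap_eq_smul_one, add_sub_cancel] at this
    have := h _ h2
    simpa using this
  have h3 := hP.dotProduct_mulVec_nonneg x
  rw [star_trivial, sub_mulVec, dotProduct_sub, smul_mulVec, one_mulVec, dotProduct_smul,
    dotProduct_self_eq, smul_eq_mul] at h3
  linarith

lemma quadForm_le_of_spectrum [DecidableEq ι] {H : Matrix ι ι ℝ} (hH : H.IsHermitian) {u : ℝ}
    (h : ∀ t ∈ spectrum ℝ H, t ≤ u) (x : ι → ℝ) : x ⬝ᵥ H *ᵥ x ≤ u * vnorm x ^ 2 := by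
  have h1 : ∀ t ∈ spectrum ℝ (-H), -u ≤ t := by
    intro t ht
    rw [← spectrum.neg_eq] at ht
    have := h (-t) ht
    linarith
  have := le_quadForm_of_spectrum hH.neg h1 x
  rw [neg_mulVec, dotProduct_neg] at this
  linarith

lemma symPart_isHermitian {ι : Type*} (A : Matrix ι ι ℝ) : (symPart A).IsHermitian := by
  rw [IsHermitian, conjTranspose_eq_transpose_of_trivial, symPart, transpose_smul, transpose_add,
    transpose_transpose, add_comm]

lemma quadForm_symPart (A : Matrix ι ι ℝ) (x : ι → ℝ) :
    x ⬝ᵥ symPart A *ᵥ x = x ⬝ᵥ A *ᵥ x := by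
  rw [symPart, smul_mulVec, add_mulVec, dotProduct_smul, dotProduct_add,
    dotProduct_transpose_mulVec_self, smul_eq_mul]
  ring

end Spectrum

namespace Dataset

variable {d n : ℕ} {M : MRP d} (D : Dataset M n)

/-- The current state of a transition, as a visited state. -/
def srcV (i : Fin n) : D.visited :=
  ⟨D.src i, Finset.mem_union_left _ (Finset.mem_image_of_mem _ (Finset.mem_univ i))⟩

/-- The next state of a transition, as a visited state. -/
def dstV (i : Fin n) : D.visited :=
  ⟨D.dst i, Finset.mem_union_right _ (Finset.mem_image_of_mem _ (Finset.mem_univ i))⟩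

lemma numVisited_pos (hn : 0 < n) : 0 < D.numVisited :=
  Finset.card_pos.2 ⟨_, (D.srcV ⟨0, hn⟩).2⟩

lemma U_transpose_mulVec (x : D.visited → ℝ) (i : Fin n) :
    (D.Uᵀ *ᵥ x) i = 1 / Real.sqrt n * x (D.srcV i) := by
  have h : ∀ j : D.visited, D.Uᵀ i j * x j
      = if D.srcV i = j then 1 / Real.sqrt n * x j else 0 := by
    intro j
    have : D.srcV i = j ↔ D.src i = (j : Fin M.card) := Subtype.ext_iff
    simp only [transpose_apply, U, of_apply, this, ite_mul, zero_mul]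
  simp only [mulVec, dotProduct, h]
  simp

lemma V_transpose_mulVec (x : D.visited → ℝ) (i : Fin n) :
    (D.Vᵀ *ᵥ x) i = 1 / Real.sqrt n * x (D.dstV i) := by
  have h : ∀ j : D.visited, D.Vᵀ i j * x j
      = if D.dstV i = j then 1 / Real.sqrt n * x j else 0 := by
    intro j
    have : D.dstV i = j ↔ D.dst i = (j : Fin M.card) := Subtype.ext_iff
    simp only [transpose_apply, V, of_apply, this, ite_mul, zero_mul]
  simp only [mulVec, dotProduct, h]
  simp

lemma inv_sqrt_mul_self : 1 / Real.sqrt n * (1 / Real.sqrt n) = 1 / (n : ℝ) := by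
  rw [div_mul_div_comm, one_mul, Real.mul_self_sqrt (Nat.cast_nonneg n)]

lemma vnorm_U_transpose_sq (x : D.visited → ℝ) :
    vnorm (D.Uᵀ *ᵥ x) ^ 2 = 1 / (n : ℝ) * ∑ i, x (D.srcV i) ^ 2 := by
  rw [vnorm_sq, Finset.mul_sum]
  refine Finset.sum_congr rfl fun i _ => ?_
  rw [D.U_transpose_mulVec, mul_pow, sq (1 / Real.sqrt n), inv_sqrt_mul_self]

lemma vnorm_V_transpose_sq (x : D.visited → ℝ) :
    vnorm (D.Vᵀ *ᵥ x) ^ 2 = 1 / (n : ℝ) * ∑ i, x (D.dstV i) ^ 2 := by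
  rw [vnorm_sq, Finset.mul_sum]
  refine Finset.sum_congr rfl fun i _ => ?_
  rw [D.V_transpose_mulVec, mul_pow, sq (1 / Real.sqrt n), inv_sqrt_mul_self]

/-- The bilinear form of the transition model is an empirical average over the transitions. -/
lemma transitionModel_bilin (γ : ℝ) (x y : D.visited → ℝ) :
    x ⬝ᵥ D.transitionModel γ *ᵥ y
      = 1 / (n : ℝ) * ∑ i, x (D.srcV i) * (y (D.srcV i) - γ * y (D.dstV i)) := by
  rw [transitionModel, ← mulVec_mulVec, dotProduct_mulVec_comm_transpose, transpose_sub,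
    transpose_smul, sub_mulVec, smul_mulVec, dotProduct, Finset.mul_sum]
  refine Finset.sum_congr rfl fun i _ => ?_
  rw [Pi.sub_apply, Pi.smul_apply, D.U_transpose_mulVec, D.U_transpose_mulVec,
    D.V_transpose_mulVec, smul_eq_mul, ← inv_sqrt_mul_self]
  ring

variable {γ u : ℝ}

/-- The relative frequency of a current state is bounded by the diagonal of the transition
model, since a self-transition only contributes a factor `1 - γ`. -/
lemma frequency_le (hγ : 0 ≤ γ)
    (hu : ∀ x, x ⬝ᵥ D.transitionModel γ *ᵥ x ≤ u * vnorm x ^ 2) (j : D.visited) :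
    (1 - γ) * (1 / (n : ℝ) * ∑ i, if D.srcV i = j then (1 : ℝ) else 0) ≤ u := by
  have h := hu (Pi.single j 1)
  have h1 : vnorm (Pi.single j 1 : D.visited → ℝ) ^ 2 = 1 := by
    rw [vnorm_sq]; simp [Pi.single_apply]
  rw [h1, mul_one, transitionModel_bilin] at h
  refine le_trans ?_ h
  rw [mul_left_comm, Finset.mul_sum]
  refine mul_le_mul_of_nonneg_left (Finset.sum_le_sum fun i _ => ?_) (by positivity)
  by_cases hs : D.srcV i = j <;> by_cases hd : D.dstV i = j <;>
    simp [hs, hd, hγ]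

lemma vnorm_U_transpose_sq_le (hγ : 0 ≤ γ) (hγ1 : γ < 1)
    (hu : ∀ x, x ⬝ᵥ D.transitionModel γ *ᵥ x ≤ u * vnorm x ^ 2) (x : D.visited → ℝ) :
    vnorm (D.Uᵀ *ᵥ x) ^ 2 ≤ u / (1 - γ) * vnorm x ^ 2 := by
  rw [vnorm_U_transpose_sq, vnorm_sq]
  have h1 : ∑ i, x (D.srcV i) ^ 2
      = ∑ j, (∑ i, if D.srcV i = j then (1 : ℝ) else 0) * x j ^ 2 := by
    simp_rw [Finset.sum_mul]
    rw [Finset.sum_comm]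
    simp
  rw [h1, Finset.mul_sum, Finset.mul_sum]
  refine Finset.sum_le_sum fun j _ => ?_
  rw [← mul_assoc]
  refine mul_le_mul_of_nonneg_right ?_ (sq_nonneg _)
  rw [le_div_iff₀ (by linarith), mul_comm]
  exact D.frequency_le hγ hu j

/-- The average of the diagonal of the transition model lies in `[1 - γ, 1]`, which forces the
scale of its spectrum to be of order `1 / m`. -/
lemma sum_diag_bounds (hn : 0 < n) (hγ : 0 ≤ γ) :
    1 - γ ≤ ∑ j, Pi.single j 1 ⬝ᵥ D.transitionModel γ *ᵥ Pi.single j 1 ∧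
      ∑ j, Pi.single j 1 ⬝ᵥ D.transitionModel γ *ᵥ Pi.single j 1 ≤ 1 := by
  have hn' : (0 : ℝ) < n := by exact_mod_cast hn
  have h : ∑ j, Pi.single j 1 ⬝ᵥ D.transitionModel γ *ᵥ Pi.single j 1
      = 1 / (n : ℝ) * ∑ i, (1 - γ * if D.srcV i = D.dstV i then 1 else 0) := by
    simp_rw [transitionModel_bilin]
    rw [← Finset.mul_sum, Finset.sum_comm]
    congr 1
    refine Finset.sum_congr rfl fun i _ => ?_
    simp [Pi.single_apply]
    by_cases hs : D.srcV i = D.dstV i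
    · simp [hs]
    · simp [hs, Ne.symm hs]
  have hc : ∑ _i : Fin n, (1 : ℝ) = n := by simp
  have hc' : ∑ _i : Fin n, (1 - γ) = n * (1 - γ) := by rw [Finset.sum_const]; simp
  rw [h]
  constructor
  · rw [one_div, inv_mul_eq_div, le_div_iff₀ hn', mul_comm, ← hc']
    refine Finset.sum_le_sum fun i _ => ?_
    split_ifs <;> simp [hγ]
  · rw [one_div, inv_mul_eq_div, div_le_iff₀ hn', one_mul, ← hc]
    refine Finset.sum_le_sum fun i _ => ?_
    split_ifs <;> simp [hγ]

/-- Coercivity of the transition model bounds the empirical transition matrix `γ Û V̂ᵀ` itself: its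
entries are nonnegative, so it suffices to test it on `w = |x| + |y|`. -/
lemma abs_cross_le (hγ : 0 ≤ γ) (hγ1 : γ < 1) (hl : ∀ x, 0 ≤ x ⬝ᵥ D.transitionModel γ *ᵥ x)
    (hu : ∀ x, x ⬝ᵥ D.transitionModel γ *ᵥ x ≤ u * vnorm x ^ 2) (x y : D.visited → ℝ) :
    |γ * (1 / (n : ℝ) * ∑ i, y (D.srcV i) * x (D.dstV i))|
      ≤ 4 * (u / (1 - γ)) * (vnorm x * vnorm y) := by
  have hab : ∀ v : D.visited → ℝ, vnorm (fun j => |v j|) = vnorm v := fun v => by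
    rw [← sq_eq_sq₀ (vnorm_nonneg _) (vnorm_nonneg _), vnorm_sq, vnorm_sq]
    simp
  have key : ∀ v : D.visited → ℝ, |γ * (1 / (n : ℝ) * ∑ i, v (D.srcV i) * x (D.dstV i))|
      ≤ u / (1 - γ) * (vnorm v + vnorm x) ^ 2 := by
    intro v
    set w : D.visited → ℝ := (fun j => |v j|) + fun j => |x j| with hw
    have hn' : (0 : ℝ) ≤ 1 / (n : ℝ) := by positivity
    have hwn : vnorm w ≤ vnorm v + vnorm x := by
      refine (vnorm_add_le _ _).trans ?_
      rw [hab, hab]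
    have h1 : γ * (1 / (n : ℝ) * ∑ i, w (D.srcV i) * w (D.dstV i)) ≤ vnorm (D.Uᵀ *ᵥ w) ^ 2 := by
      have := hl w
      rw [transitionModel_bilin] at this
      rw [vnorm_U_transpose_sq]
      have h2 : ∑ i, w (D.srcV i) * (w (D.srcV i) - γ * w (D.dstV i))
          = ∑ i, w (D.srcV i) ^ 2 - γ * ∑ i, w (D.srcV i) * w (D.dstV i) := by
        rw [Finset.mul_sum, ← Finset.sum_sub_distrib]
        exact Finset.sum_congr rfl fun i _ => by ring
      rw [h2] at this
      nlinarith
    have h3 : |γ * (1 / (n : ℝ) * ∑ i, v (D.srcV i) * x (D.dstV i))|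
        ≤ γ * (1 / (n : ℝ) * ∑ i, w (D.srcV i) * w (D.dstV i)) := by
      rw [abs_mul, abs_mul, abs_of_nonneg hγ, abs_of_nonneg hn']
      refine mul_le_mul_of_nonneg_left (mul_le_mul_of_nonneg_left ?_ hn') hγ
      refine (Finset.abs_sum_le_sum_abs _ _).trans (Finset.sum_le_sum fun i _ => ?_)
      rw [abs_mul]
      refine mul_le_mul ?_ ?_ (abs_nonneg _)
        (add_nonneg (abs_nonneg _) (abs_nonneg _))
      · simp [hw]
      · simp [hw]
    have hu0 : 0 ≤ u / (1 - γ) * vnorm w ^ 2 :=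
      (sq_nonneg _).trans (D.vnorm_U_transpose_sq_le hγ hγ1 hu w)
    have h4 := D.vnorm_U_transpose_sq_le hγ hγ1 hu w
    rcases (vnorm_nonneg w).eq_or_lt with hw0 | hw0
    · rw [← hw0] at h4
      have hvx : vnorm v = 0 ∧ vnorm x = 0 := by
        have hz := vnorm_eq_zero.1 hw0.symm
        have : ∀ j, v j = 0 ∧ x j = 0 := fun j => by
          have h5 := congrFun hz j
          simp only [hw, Pi.add_apply, Pi.zero_apply] at h5
          constructor <;> refine abs_eq_zero.1 ?_ <;> linarith [abs_nonneg (v j), abs_nonneg (x j)]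
        exact ⟨vnorm_eq_zero.2 (funext fun j => (this j).1),
          vnorm_eq_zero.2 (funext fun j => (this j).2)⟩
      rw [hvx.1, hvx.2]
      linarith
    · have hu1 : 0 ≤ u / (1 - γ) := nonneg_of_mul_nonneg_left hu0 (by positivity)
      have := mul_le_mul_of_nonneg_left (pow_le_pow_left₀ hw0.le hwn 2) hu1
      linarith
  -- optimise over the scaling of `y`
  rcases (vnorm_nonneg y).eq_or_lt with hy | hy
  · have : y = 0 := vnorm_eq_zero.1 hy.symm
    simp [this, vnorm_zero]
  rcases (vnorm_nonneg x).eq_or_lt with hx | hx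
  · have : x = 0 := vnorm_eq_zero.1 hx.symm
    simp [this, vnorm_zero]
  have h1 := key ((vnorm x / vnorm y) • y)
  rw [vnorm_smul, abs_of_pos (div_pos hx hy), div_mul_cancel₀ _ hy.ne'] at h1
  have h2 : γ * (1 / (n : ℝ) * ∑ i, ((vnorm x / vnorm y) • y) (D.srcV i) * x (D.dstV i))
      = vnorm x / vnorm y * (γ * (1 / (n : ℝ) * ∑ i, y (D.srcV i) * x (D.dstV i))) := by
    simp only [Pi.smul_apply, smul_eq_mul, mul_assoc]
    rw [← Finset.mul_sum]
    ring
  rw [h2, abs_mul, abs_of_pos (div_pos hx hy), div_mul_eq_mul_div, div_le_iff₀ hy] at h1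
  refine le_of_mul_le_mul_left (h1.trans (le_of_eq ?_)) hx
  ring

lemma vnorm_transitionModel_le (hγ : 0 ≤ γ) (hγ1 : γ < 1)
    (hl : ∀ x, 0 ≤ x ⬝ᵥ D.transitionModel γ *ᵥ x) (hu0 : 0 ≤ u)
    (hu : ∀ x, x ⬝ᵥ D.transitionModel γ *ᵥ x ≤ u * vnorm x ^ 2) (x : D.visited → ℝ) :
    vnorm (D.transitionModel γ *ᵥ x) ≤ 5 * (u / (1 - γ)) * vnorm x := by
  set y := D.transitionModel γ *ᵥ x with hy
  have hk : 0 ≤ u / (1 - γ) := div_nonneg hu0 (by linarith)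
  have h1 : vnorm y ^ 2 ≤ 5 * (u / (1 - γ)) * (vnorm x * vnorm y) := by
    rw [← dotProduct_self_eq]
    nth_rewrite 2 [hy]
    have h2 : y ⬝ᵥ D.transitionModel γ *ᵥ x = (D.Uᵀ *ᵥ y) ⬝ᵥ (D.Uᵀ *ᵥ x)
        - γ * (1 / (n : ℝ) * ∑ i, y (D.srcV i) * x (D.dstV i)) := by
      rw [transitionModel_bilin, dotProduct]
      simp_rw [D.U_transpose_mulVec]
      have h5 : ∀ i, 1 / Real.sqrt n * y (D.srcV i) * (1 / Real.sqrt n * x (D.srcV i))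
          = 1 / (n : ℝ) * (y (D.srcV i) * x (D.srcV i)) := fun i => by
        rw [← inv_sqrt_mul_self]; ring
      simp_rw [h5]
      rw [← Finset.mul_sum, mul_left_comm, ← mul_sub, Finset.mul_sum _ _ γ,
        ← Finset.sum_sub_distrib]
      congr 1
      exact Finset.sum_congr rfl fun i _ => by ring
    have h3 : (D.Uᵀ *ᵥ y) ⬝ᵥ (D.Uᵀ *ᵥ x) ≤ u / (1 - γ) * (vnorm x * vnorm y) := by
      refine (le_abs_self _).trans ((abs_dotProduct_le _ _).trans ?_)
      refine (abs_le_of_sq_le_sq' ?_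
        (mul_nonneg hk (mul_nonneg (vnorm_nonneg x) (vnorm_nonneg y)))).2
      have e1 := D.vnorm_U_transpose_sq_le hγ hγ1 hu x
      have e2 := D.vnorm_U_transpose_sq_le hγ hγ1 hu y
      calc (vnorm (D.Uᵀ *ᵥ y) * vnorm (D.Uᵀ *ᵥ x)) ^ 2
          = vnorm (D.Uᵀ *ᵥ y) ^ 2 * vnorm (D.Uᵀ *ᵥ x) ^ 2 := by ring
        _ ≤ (u / (1 - γ) * vnorm y ^ 2) * (u / (1 - γ) * vnorm x ^ 2) :=
            mul_le_mul e2 e1 (sq_nonneg _) (by positivity)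
        _ = _ := by ring
    have h4 := (abs_le.1 (D.abs_cross_le hγ hγ1 hl hu x y)).1
    rw [h2]
    linarith
  rcases (vnorm_nonneg y).eq_or_lt with h0 | h0
  · rw [← h0]; exact mul_nonneg (by positivity) (vnorm_nonneg x)
  · nlinarith

/-- Testing the bound for `γ Û V̂ᵀ` on the vector of ones and on the squares of `x` controls `V̂`,
at the price of a factor `√m`, the norm of the vector of ones. -/
lemma vnorm_V_transpose_sq_le (hγ : 0 ≤ γ) (hγ1 : γ < 1)
    (hl : ∀ x, 0 ≤ x ⬝ᵥ D.transitionModel γ *ᵥ x) (hu0 : 0 ≤ u)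
    (hu : ∀ x, x ⬝ᵥ D.transitionModel γ *ᵥ x ≤ u * vnorm x ^ 2) (x : D.visited → ℝ) :
    γ * vnorm (D.Vᵀ *ᵥ x) ^ 2
      ≤ 4 * (u / (1 - γ)) * (Real.sqrt D.numVisited * vnorm x ^ 2) := by
  have h1 := (le_abs_self _).trans (D.abs_cross_le hγ hγ1 hl hu (fun j => x j ^ 2) fun _ => 1)
  simp only [one_mul] at h1
  rw [vnorm_V_transpose_sq]
  refine h1.trans (mul_le_mul_of_nonneg_left ?_
    (mul_nonneg (by norm_num) (div_nonneg hu0 (by linarith))))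
  have h2 : vnorm (fun _ : D.visited => (1 : ℝ)) = Real.sqrt D.numVisited := by
    rw [eq_comm, Real.sqrt_eq_iff_eq_sq (Nat.cast_nonneg _) (vnorm_nonneg _), vnorm_sq]
    simp [numVisited]
  have h3 : vnorm (fun j => x j ^ 2) ≤ vnorm x ^ 2 := by
    refine (pow_le_pow_iff_left₀ (vnorm_nonneg _) (sq_nonneg _) two_ne_zero).1 ?_
    rw [vnorm_sq, vnorm_sq x]
    exact Finset.sum_sq_le_sq_sum_of_nonneg fun j _ => sq_nonneg _
  rw [h2, mul_comm]
  exact mul_le_mul_of_nonneg_left h3 (Real.sqrt_nonneg _)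

lemma vnorm_sub_transpose_sq_le (hn : 0 < n) (hγ : 0 ≤ γ) (hγ1 : γ < 1)
    (hl : ∀ x, 0 ≤ x ⬝ᵥ D.transitionModel γ *ᵥ x) (hu0 : 0 ≤ u)
    (hu : ∀ x, x ⬝ᵥ D.transitionModel γ *ᵥ x ≤ u * vnorm x ^ 2) (x : D.visited → ℝ) :
    vnorm ((D.U - γ • D.V)ᵀ *ᵥ x) ^ 2
      ≤ 10 * (u / (1 - γ)) * (Real.sqrt D.numVisited * vnorm x ^ 2) := by
  have h1 := D.vnorm_U_transpose_sq_le hγ hγ1 hu x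
  have h2 := D.vnorm_V_transpose_sq_le hγ hγ1 hl hu0 hu x
  have h3 : vnorm ((D.U - γ • D.V)ᵀ *ᵥ x) ≤ vnorm (D.Uᵀ *ᵥ x) + γ * vnorm (D.Vᵀ *ᵥ x) := by
    rw [transpose_sub, transpose_smul, sub_mulVec, smul_mulVec]
    refine (vnorm_sub_le _ _).trans (le_of_eq ?_)
    rw [vnorm_smul, abs_of_nonneg hγ]
  have h4 : 1 ≤ Real.sqrt D.numVisited := by
    rw [Real.one_le_sqrt]
    exact_mod_cast D.numVisited_pos hn
  have hk : 0 ≤ u / (1 - γ) := div_nonneg hu0 (by linarith)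
  have h5 := pow_le_pow_left₀ (vnorm_nonneg _) h3 2
  have h6 : u / (1 - γ) * vnorm x ^ 2
      ≤ u / (1 - γ) * (Real.sqrt D.numVisited * vnorm x ^ 2) :=
    mul_le_mul_of_nonneg_left (le_mul_of_one_le_left (sq_nonneg _) h4) hk
  have h7 : γ ^ 2 * vnorm (D.Vᵀ *ᵥ x) ^ 2 ≤ γ * vnorm (D.Vᵀ *ᵥ x) ^ 2 :=
    mul_le_mul_of_nonneg_right (by nlinarith) (sq_nonneg _)
  nlinarith [sq_nonneg (vnorm (D.Uᵀ *ᵥ x) - γ * vnorm (D.Vᵀ *ᵥ x))]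

end Dataset

/-- What the bounded eigenspectrum says about the sizes of the empirical matrices: the transition
model is of exact order `1 / m`, and `Û`, `Û - γ V̂` are at most of order `m ^ (-1/2)`,
`m ^ (-1/4)`. -/
lemma exists_structural_bounds {γ : ℝ} (hγ : 0 ≤ γ) (hγ1 : γ < 1) {d n : ℕ → ℕ}
    (hn : ∀ k, 0 < n k) {M : ∀ k, MRP (d k)} {D : ∀ k, Dataset (M k) (n k)}
    (hspec : BoundedEigenspectrum γ D) :
    ∃ K : ℝ, 1 ≤ K ∧ ∀ k, ∃ α : ℝ, 0 < α ∧ 1 / (K * (D k).numVisited) ≤ α ∧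
      (∀ x, α * vnorm x ^ 2 ≤ x ⬝ᵥ (D k).transitionModel γ *ᵥ x) ∧
      (∀ x, vnorm ((D k).transitionModel γ *ᵥ x) ≤ K / (D k).numVisited * vnorm x) ∧
      (∀ x, vnorm ((D k).Uᵀ *ᵥ x) ^ 2 ≤ K / (D k).numVisited * vnorm x ^ 2) ∧
      (∀ x, vnorm (((D k).U - γ • (D k).V)ᵀ *ᵥ x) ^ 2
        ≤ K / Real.sqrt (D k).numVisited * vnorm x ^ 2) := by
  obtain ⟨ξl, ξu, hξl, hξ, a, ha, hs⟩ := hspec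
  have h1γ : 0 < 1 - γ := by linarith
  have hξu : 0 < ξu := hξl.trans hξ
  set K₀ : ℝ := ξu / ((1 - γ) * ξl) with hK₀
  have hK₀1 : 1 ≤ K₀ := by
    rw [hK₀, le_div_iff₀ (by positivity)]
    nlinarith
  refine ⟨10 * K₀, by linarith, fun k => ⟨a k * ξl, mul_pos (ha k) hξl, ?_⟩⟩
  have hm : (0 : ℝ) < (D k).numVisited := by exact_mod_cast (D k).numVisited_pos (hn k)
  have hak := ha k
  have hl : ∀ x, a k * ξl * vnorm x ^ 2 ≤ x ⬝ᵥ (D k).transitionModel γ *ᵥ x := fun x => by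
    rw [← quadForm_symPart]
    exact le_quadForm_of_spectrum (symPart_isHermitian _) (fun t ht => (hs k ht).1) x
  have hu : ∀ x, x ⬝ᵥ (D k).transitionModel γ *ᵥ x ≤ a k * ξu * vnorm x ^ 2 := fun x => by
    rw [← quadForm_symPart]
    exact quadForm_le_of_spectrum (symPart_isHermitian _) (fun t ht => (hs k ht).2) x
  have hl0 : ∀ x, 0 ≤ x ⬝ᵥ (D k).transitionModel γ *ᵥ x := fun x =>
    (by positivity : 0 ≤ a k * ξl * vnorm x ^ 2).trans (hl x)
  have hone : ∀ j : (D k).visited, vnorm (Pi.single j 1 : (D k).visited → ℝ) ^ 2 = 1 := fun j => by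
    rw [vnorm_sq]; simp [Pi.single_apply]
  have htr := (D k).sum_diag_bounds (hn k) hγ
  have hlow : (D k).numVisited * (a k * ξl) ≤ 1 := by
    refine le_trans (le_of_eq ?_) ((Finset.sum_le_sum fun j _ => hl (Pi.single j 1)).trans htr.2)
    simp [hone, Dataset.numVisited]
  have hupp : 1 - γ ≤ (D k).numVisited * (a k * ξu) := by
    refine (htr.1.trans (Finset.sum_le_sum fun j _ => hu (Pi.single j 1))).trans (le_of_eq ?_)
    simp [hone, Dataset.numVisited]
  have hk : a k * ξu / (1 - γ) ≤ K₀ / (D k).numVisited := by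
    rw [hK₀, div_div, div_le_div_iff₀ h1γ (by positivity)]
    have := mul_le_mul_of_nonneg_left hlow (mul_pos hξu h1γ).le
    nlinarith
  have hu0 : 0 ≤ a k * ξu := by positivity
  refine ⟨?_, hl, fun x => ?_, fun x => ?_, fun x => ?_⟩
  · rw [div_le_iff₀ (by positivity)]
    have e : a k * ξl * (10 * K₀ * (D k).numVisited)
        = 10 * ((D k).numVisited * (a k * ξu)) / (1 - γ) := by
      rw [hK₀]; field_simp
    rw [e, le_div_iff₀ h1γ]
    linarith
  · refine ((D k).vnorm_transitionModel_le hγ hγ1 hl0 hu0 hu x).trans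
      (mul_le_mul_of_nonneg_right ?_ (vnorm_nonneg x))
    rw [mul_div_assoc 10]
    have : 0 ≤ K₀ / (D k).numVisited := by positivity
    linarith
  · refine ((D k).vnorm_U_transpose_sq_le hγ hγ1 hu x).trans
      (mul_le_mul_of_nonneg_right ?_ (sq_nonneg _))
    rw [mul_div_assoc 10]
    have : 0 ≤ K₀ / (D k).numVisited := by positivity
    linarith
  · refine ((D k).vnorm_sub_transpose_sq_le (hn k) hγ hγ1 hl0 hu0 hu x).trans ?_
    rw [← mul_assoc]
    refine mul_le_mul_of_nonneg_right ?_ (sq_nonneg _)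
    have h1 : 10 * (a k * ξu / (1 - γ)) * Real.sqrt (D k).numVisited
        ≤ 10 * (K₀ / (D k).numVisited) * Real.sqrt (D k).numVisited :=
      mul_le_mul_of_nonneg_right (by linarith) (Real.sqrt_nonneg _)
    refine h1.trans (le_of_eq ?_)
    have hsq : Real.sqrt (D k).numVisited ≠ 0 := (Real.sqrt_pos.2 hm).ne'
    have h2 : ((D k).numVisited : ℝ) = Real.sqrt (D k).numVisited * Real.sqrt (D k).numVisited :=
      (Real.mul_self_sqrt hm.le).symm
    rw [mul_assoc, mul_div_assoc]
    congr 1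
    rw [div_mul_eq_mul_div, div_eq_div_iff hm.ne' hsq, mul_assoc, ← h2]

/-! ### Random features and Gram matrices -/

section Features

variable {N d : ℕ} {ι : Type*} [Fintype ι] {σ φ : ℝ → ℝ} {S : Matrix (Fin d) ι ℝ} {a b s : ℝ}

/-- A vector of Gaussian entries, read as a weight matrix. -/
def weights (w : EuclideanSpace ℝ (Fin N × Fin d)) : Matrix (Fin N) (Fin d) ℝ :=
  Matrix.of fun i j => w (i, j)

/-- The sample Gram matrix `m⁻¹ Σᵀ Σ` of the random features of the columns of `S`. -/
def sampleGram (σ φ : ℝ → ℝ) (S : Matrix (Fin d) ι ℝ) (m : ℝ) (W : Matrix (Fin N) (Fin d) ℝ) :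
    Matrix ι ι ℝ :=
  (1 / m) • ((features σ φ W S)ᵀ * features σ φ W S)

/-- The second moment matrix of a single random feature of the columns of `S`. -/
def meanGram (σ φ : ℝ → ℝ) (S : Matrix (Fin d) ι ℝ) : Matrix ι ι ℝ :=
  Matrix.of fun j l =>
    ∫ w : Fin d → ℝ, σ (∑ a, φ (w a) * S a j) * σ (∑ a, φ (w a) * S a l)
      ∂(Measure.pi fun _ : Fin d => gaussianReal 0 1)

lemma frob_weights (w : EuclideanSpace ℝ (Fin N × Fin d)) : frob (weights w) = ‖w‖ := rfl

lemma weights_sub (w w' : EuclideanSpace ℝ (Fin N × Fin d)) :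
    weights (w - w') = weights w - weights w' := rfl

lemma frob_le_of_entry {κ τ : Type*} [Fintype κ] [Fintype τ] {A B : Matrix κ τ ℝ} {c : ℝ}
    (hc : 0 ≤ c) (h : ∀ i j, |A i j| ≤ c * |B i j|) : frob A ≤ c * frob B := by
  refine (pow_le_pow_iff_left₀ (frob_nonneg _) (mul_nonneg hc (frob_nonneg _)) two_ne_zero).1 ?_
  rw [mul_pow, frob_sq, frob_sq, Finset.mul_sum]
  refine Finset.sum_le_sum fun i _ => ?_
  rw [Finset.mul_sum]
  refine Finset.sum_le_sum fun j _ => ?_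
  rw [← sq_abs, ← sq_abs (B i j), ← mul_pow]
  exact pow_le_pow_left₀ (abs_nonneg _) (h i j) 2

lemma frob_mul_le_of_transpose_bound (hs : 0 ≤ s) (hS : ∀ x, vnorm (Sᵀ *ᵥ x) ≤ s * vnorm x)
    (A : Matrix (Fin N) (Fin d) ℝ) : frob (A * S) ≤ s * frob A := by
  rw [← frob_transpose, transpose_mul, ← frob_transpose A]
  exact frob_mul_le_of_bound hS hs _

/-- The feature map is Lipschitz in the weights for the Frobenius norms, with a constant that
depends on the states only through the operator norm of their matrix. -/
lemma frob_features_sub_le (ha : 0 ≤ a) (hσ : ∀ x y, |σ x - σ y| ≤ a * |x - y|) (hb : 0 ≤ b)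
    (hφ : ∀ x y, |φ x - φ y| ≤ b * |x - y|) (hs : 0 ≤ s)
    (hS : ∀ x, vnorm (Sᵀ *ᵥ x) ≤ s * vnorm x) (W W' : Matrix (Fin N) (Fin d) ℝ) :
    frob (features σ φ W S - features σ φ W' S) ≤ a * s * b * frob (W - W') := by
  have h1 : frob (features σ φ W S - features σ φ W' S)
      ≤ a * frob ((W.map φ - W'.map φ) * S) := by
    refine frob_le_of_entry ha fun i j => ?_
    rw [Matrix.sub_mul]
    exact hσ _ _
  have h2 : frob (W.map φ - W'.map φ) ≤ b * frob (W - W') :=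
    frob_le_of_entry hb fun i j => hφ _ _
  have h3 := frob_mul_le_of_transpose_bound hs hS (W.map φ - W'.map φ)
  calc _ ≤ a * frob ((W.map φ - W'.map φ) * S) := h1
    _ ≤ a * (s * (b * frob (W - W'))) := by gcongr; exact h3.trans (by gcongr)
    _ = _ := by ring

lemma frob_const (κ τ : Type*) [Fintype κ] [Fintype τ] (c : ℝ) :
    frob (Matrix.of fun (_ : κ) (_ : τ) => c)
      = |c| * Real.sqrt (Fintype.card κ * Fintype.card τ) := by
  rw [← sq_eq_sq₀ (frob_nonneg _) (by positivity), frob_sq, mul_pow, Real.sq_sqrt (by positivity),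
    sq_abs]
  simp
  ring

lemma frob_features_le (ha : 0 ≤ a) (hσ : ∀ x y, |σ x - σ y| ≤ a * |x - y|) (hb : 0 ≤ b)
    (hφ : ∀ x y, |φ x - φ y| ≤ b * |x - y|) (hs : 0 ≤ s)
    (hS : ∀ x, vnorm (Sᵀ *ᵥ x) ≤ s * vnorm x) (W : Matrix (Fin N) (Fin d) ℝ) :
    frob (features σ φ W S) ≤ |σ 0| * Real.sqrt (N * Fintype.card ι)
      + a * s * |φ 0| * Real.sqrt (N * d) + a * s * b * frob W := by
  have h1 : frob (W.map φ) ≤ |φ 0| * Real.sqrt (N * d) + b * frob W := by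
    have e : W.map φ = (Matrix.of fun _ _ => φ 0) + (W.map φ - Matrix.of fun _ _ => φ 0) := by abel
    rw [e]
    refine (frob_add_le _ _).trans (add_le_add ?_ ?_)
    · rw [frob_const, Fintype.card_fin, Fintype.card_fin]
    · refine frob_le_of_entry hb fun i j => ?_
      simpa using hφ (W i j) 0
  have h2 : frob (features σ φ W S) ≤ |σ 0| * Real.sqrt (N * Fintype.card ι)
      + a * frob (W.map φ * S) := by
    have e : features σ φ W S = (Matrix.of fun _ _ => σ 0)
        + (features σ φ W S - Matrix.of fun _ _ => σ 0) := by abel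
    rw [e]
    refine (frob_add_le _ _).trans (add_le_add ?_ ?_)
    · rw [frob_const, Fintype.card_fin]
    · refine frob_le_of_entry ha fun i j => ?_
      have h := hσ ((W.map φ * S) i j) 0
      rwa [sub_zero] at h
  have h3 := frob_mul_le_of_transpose_bound hs hS (W.map φ)
  have h4 : a * frob (W.map φ * S) ≤ a * (s * (|φ 0| * Real.sqrt (N * d) + b * frob W)) := by
    gcongr
    exact h3.trans (by gcongr)
  linarith

lemma sampleGram_bilin (m : ℝ) (W : Matrix (Fin N) (Fin d) ℝ) (u v : ι → ℝ) :
    u ⬝ᵥ sampleGram σ φ S m W *ᵥ v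
      = 1 / m * ((features σ φ W S *ᵥ u) ⬝ᵥ (features σ φ W S *ᵥ v)) := by
  rw [sampleGram, smul_mulVec, dotProduct_smul, smul_eq_mul, ← mulVec_mulVec,
    dotProduct_mulVec_comm_transpose, transpose_transpose]

lemma sampleGram_nonneg {m : ℝ} (hm : 0 ≤ m) (W : Matrix (Fin N) (Fin d) ℝ) (x : ι → ℝ) :
    0 ≤ x ⬝ᵥ sampleGram σ φ S m W *ᵥ x := by
  rw [sampleGram_bilin, dotProduct_self_eq]
  positivity

/-- Local modulus of continuity of the bilinear forms of the sample Gram matrix. -/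
lemma abs_sampleGram_bilin_sub_le {L m : ℝ} (hL : ∀ W W' : Matrix (Fin N) (Fin d) ℝ,
      frob (features σ φ W S - features σ φ W' S) ≤ L * frob (W - W')) (hm : 0 < m)
    (W W' : Matrix (Fin N) (Fin d) ℝ) (u v : ι → ℝ) :
    |u ⬝ᵥ sampleGram σ φ S m W *ᵥ v - u ⬝ᵥ sampleGram σ φ S m W' *ᵥ v|
      ≤ (L / m * (vnorm (features σ φ W S *ᵥ u) * vnorm v
          + vnorm u * vnorm (features σ φ W S *ᵥ v))
        + L / m * (vnorm (features σ φ W' S *ᵥ u) * vnorm v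
          + vnorm u * vnorm (features σ φ W' S *ᵥ v))) * frob (W - W') := by
  set F := features σ φ W S
  set F' := features σ φ W' S
  have e : u ⬝ᵥ sampleGram σ φ S m W *ᵥ v - u ⬝ᵥ sampleGram σ φ S m W' *ᵥ v
      = 1 / m * ((F *ᵥ u) ⬝ᵥ ((F - F') *ᵥ v) + ((F - F') *ᵥ u) ⬝ᵥ (F' *ᵥ v)) := by
    rw [sampleGram_bilin, sampleGram_bilin, sub_mulVec, sub_mulVec, dotProduct_sub, sub_dotProduct]
    ring
  have hD := hL W W'
  have hLD : 0 ≤ L * frob (W - W') := (frob_nonneg _).trans hD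
  have h1 : |(F *ᵥ u) ⬝ᵥ ((F - F') *ᵥ v)|
      ≤ vnorm (F *ᵥ u) * (L * frob (W - W') * vnorm v) := by
    refine (abs_dotProduct_le _ _).trans (mul_le_mul_of_nonneg_left ?_ (vnorm_nonneg _))
    exact (vnorm_mulVec_le _ _).trans (mul_le_mul_of_nonneg_right hD (vnorm_nonneg _))
  have h2 : |((F - F') *ᵥ u) ⬝ᵥ (F' *ᵥ v)|
      ≤ L * frob (W - W') * vnorm u * vnorm (F' *ᵥ v) := by
    refine (abs_dotProduct_le _ _).trans (mul_le_mul_of_nonneg_right ?_ (vnorm_nonneg _))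
    exact (vnorm_mulVec_le _ _).trans (mul_le_mul_of_nonneg_right hD (vnorm_nonneg _))
  rw [e, abs_mul, abs_of_pos (by positivity : 0 < 1 / m)]
  have h3 := mul_le_mul_of_nonneg_left ((abs_add_le _ _).trans (add_le_add h1 h2))
    (by positivity : 0 ≤ 1 / m)
  refine h3.trans ?_
  have h4 : 0 ≤ L * frob (W - W') / m * (vnorm u * vnorm (F *ᵥ v)) :=
    mul_nonneg (div_nonneg hLD hm.le) (mul_nonneg (vnorm_nonneg _) (vnorm_nonneg _))
  have h5 : 0 ≤ L * frob (W - W') / m * (vnorm (F' *ᵥ u) * vnorm v) :=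
    mul_nonneg (div_nonneg hLD hm.le) (mul_nonneg (vnorm_nonneg _) (vnorm_nonneg _))
  have e2 : (L / m * (vnorm (F *ᵥ u) * vnorm v + vnorm u * vnorm (F *ᵥ v))
        + L / m * (vnorm (F' *ᵥ u) * vnorm v + vnorm u * vnorm (F' *ᵥ v))) * frob (W - W')
      = 1 / m * (vnorm (F *ᵥ u) * (L * frob (W - W') * vnorm v)
          + L * frob (W - W') * vnorm u * vnorm (F' *ᵥ v))
        + (L * frob (W - W') / m * (vnorm u * vnorm (F *ᵥ v))
          + L * frob (W - W') / m * (vnorm (F' *ᵥ u) * vnorm v)) := by ring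
  rw [e2]
  linarith

/-- Local modulus of continuity of the Frobenius distance to a fixed matrix. -/
lemma abs_frob_sampleGram_sub_le {L m : ℝ} (hL : ∀ W W' : Matrix (Fin N) (Fin d) ℝ,
      frob (features σ φ W S - features σ φ W' S) ≤ L * frob (W - W')) (hm : 0 < m)
    (W W' : Matrix (Fin N) (Fin d) ℝ) (A : Matrix ι ι ℝ) :
    |frob (sampleGram σ φ S m W - A) - frob (sampleGram σ φ S m W' - A)|
      ≤ (L / m * frob (features σ φ W S) + L / m * frob (features σ φ W' S))
        * frob (W - W') := by
  set F := features σ φ W S with hF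
  set F' := features σ φ W' S with hF'
  have h1 : ∀ X Y : Matrix ι ι ℝ, |frob X - frob Y| ≤ frob (X - Y) := by
    intro X Y
    rw [abs_le]
    have e1 := frob_add_le (X - Y) Y
    have e2 := frob_sub_le X (X - Y)
    rw [sub_add_cancel] at e1
    rw [sub_sub_cancel] at e2
    constructor <;> linarith
  refine (h1 _ _).trans ?_
  have e : sampleGram σ φ S m W - A - (sampleGram σ φ S m W' - A)
      = (1 / m) • (Fᵀ * (F - F') + (F - F')ᵀ * F') := by
    rw [sub_sub_sub_cancel_right, sampleGram, sampleGram, ← smul_sub, Matrix.mul_sub, transpose_sub,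
      Matrix.sub_mul]
    congr 1
    abel
  have hD := hL W W'
  rw [e, frob_smul, abs_of_pos (by positivity : 0 < 1 / m)]
  have h2 : frob (Fᵀ * (F - F') + (F - F')ᵀ * F') ≤ (frob F + frob F') * (L * frob (W - W')) := by
    refine (frob_add_le _ _).trans ?_
    have e1 := frob_mul_le Fᵀ (F - F')
    have e2 := frob_mul_le (F - F')ᵀ F'
    rw [frob_transpose] at e1 e2
    nlinarith [frob_nonneg F, frob_nonneg F']
  refine (mul_le_mul_of_nonneg_left h2 (by positivity)).trans (le_of_eq ?_)
  ring

end Features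

/-! ### Moments of the random features -/

/-- The absolute moments of the standard normal law. -/
def absMoment (p : ℕ) : ℝ := ∫ t, |t| ^ p ∂(gaussianReal 0 1)

lemma absMoment_nonneg (p : ℕ) : 0 ≤ absMoment p := integral_nonneg fun t => by positivity

section Moments

lemma sq_integral_le {X : Type*} [MeasurableSpace X] {ν : Measure X} [IsProbabilityMeasure ν]
    {f : X → ℝ} (hf : Integrable f ν) (hf2 : Integrable (fun x => f x ^ 2) ν) :
    (∫ x, f x ∂ν) ^ 2 ≤ ∫ x, f x ^ 2 ∂ν := by
  set I := ∫ x, f x ∂ν with hI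
  have h : 0 ≤ ∫ x, (f x - I) ^ 2 ∂ν := integral_nonneg fun x => sq_nonneg _
  have e : ∀ x, (f x - I) ^ 2 = f x ^ 2 - 2 * I * f x + I ^ 2 := fun x => by ring
  simp_rw [e] at h
  rw [integral_add (f := fun x => f x ^ 2 - 2 * I * f x) (hf2.sub (hf.const_mul _))
    (integrable_const _), integral_sub hf2 (hf.const_mul _), integral_const_mul, ← hI] at h
  simp only [integral_const, probReal_univ, smul_eq_mul, one_mul] at h
  linarith

lemma integral_norm_pow_four_le (ι : Type*) [Fintype ι] :
    ∫ w, ‖w‖ ^ 4 ∂(stdGaussian (EuclideanSpace ℝ ι))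
      ≤ (Fintype.card ι : ℝ) ^ 2 * absMoment 4 := by
  have hint : ∀ i : ι, Integrable (fun w : EuclideanSpace ℝ ι => |w i| ^ 4)
      (stdGaussian (EuclideanSpace ℝ ι)) := fun i => by
    refine integrable_of_polynomial_growth (C := 1) (q := 4)
      (Continuous.aestronglyMeasurable (by fun_prop)) fun w => ?_
    rw [abs_of_nonneg (by positivity), one_mul]
    refine pow_le_pow_left₀ (abs_nonneg _) ?_ 4
    have := PiLp.norm_apply_le w i
    rw [Real.norm_eq_abs] at this
    linarith
  have hpt : ∀ w : EuclideanSpace ℝ ι, ‖w‖ ^ 4 ≤ (Fintype.card ι : ℝ) * ∑ i, |w i| ^ 4 := by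
    intro w
    have h := pow_sum_le_card_mul_sum_pow (s := Finset.univ) (f := fun i => w i ^ 2)
      (fun i _ => sq_nonneg _) 1
    have e : ‖w‖ ^ 4 = (∑ i, w i ^ 2) ^ 2 := by rw [← EuclideanSpace.real_norm_sq_eq]; ring
    have e2 : ∀ i, |w i| ^ 4 = (w i ^ 2) ^ 2 := fun i => by rw [← sq_abs (w i)]; ring
    simp_rw [e, e2]
    simpa using h
  have hcoord : ∀ i : ι, ∫ w, |w i| ^ 4 ∂(stdGaussian (EuclideanSpace ℝ ι)) ≤ absMoment 4 := by
    intro i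
    have h : ∫ w, |w i| ^ 4 ∂(stdGaussian (EuclideanSpace ℝ ι))
        = ‖(EuclideanSpace.proj i : EuclideanSpace ℝ ι →L[ℝ] ℝ)‖ ^ 4 * absMoment 4 :=
      integral_abs_pow_stdGaussian (EuclideanSpace.proj i : EuclideanSpace ℝ ι →L[ℝ] ℝ) 4
    rw [h]
    have hn : ‖(EuclideanSpace.proj i : EuclideanSpace ℝ ι →L[ℝ] ℝ)‖ ≤ 1 :=
      ContinuousLinearMap.opNorm_le_bound _ zero_le_one fun w => by
        rw [one_mul]; exact PiLp.norm_apply_le w i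
    exact mul_le_of_le_one_left (absMoment_nonneg 4) (pow_le_one₀ (norm_nonneg _) hn)
  calc ∫ w, ‖w‖ ^ 4 ∂(stdGaussian (EuclideanSpace ℝ ι))
      ≤ ∫ w, (Fintype.card ι : ℝ) * ∑ i, |w i| ^ 4 ∂(stdGaussian (EuclideanSpace ℝ ι)) :=
        integral_mono_of_nonneg (ae_of_all _ fun w => by positivity)
          ((integrable_finsetSum _ fun i _ => hint i).const_mul _) (ae_of_all _ hpt)
    _ = (Fintype.card ι : ℝ) * ∑ i, ∫ w, |w i| ^ 4 ∂(stdGaussian (EuclideanSpace ℝ ι)) := by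
        rw [integral_const_mul, integral_finsetSum _ fun i _ => hint i]
    _ ≤ (Fintype.card ι : ℝ) * ∑ _i : ι, absMoment 4 := by
        gcongr with i
        exact hcoord i
    _ = _ := by simp; ring

/-- The row of a Gaussian weight matrix has independent standard normal entries. -/
lemma map_row_stdGaussian {N d : ℕ} (i : Fin N) :
    (stdGaussian (EuclideanSpace ℝ (Fin N × Fin d))).map (fun w j => w (i, j))
      = Measure.pi fun _ : Fin d => gaussianReal 0 1 := by
  rw [← map_pi_eq_stdGaussian, Measure.map_map (by fun_prop) (by fun_prop)]
  have h1 : iIndepFun (fun (p : Fin N × Fin d) (x : Fin N × Fin d → ℝ) => x p)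
      (Measure.pi fun _ => gaussianReal 0 1) :=
    iIndepFun_pi (X := fun _ => id) fun _ => aemeasurable_id
  have h2 := h1.precomp (Prod.mk_right_injective i)
  have h3 := (iIndepFun_iff_map_fun_eq_pi_map
    (f := fun (j : Fin d) (x : Fin N × Fin d → ℝ) => x (i, j)) fun j =>
      (measurable_pi_apply _).aemeasurable).1 h2
  refine (Eq.trans ?_ h3).trans ?_
  · rfl
  · congr 1
    funext j
    exact (measurePreserving_eval (fun _ : Fin N × Fin d => gaussianReal 0 1) (i, j)).map_eq

variable {N d : ℕ} {ι : Type*} [Fintype ι] {σ φ : ℝ → ℝ} {S : Matrix (Fin d) ι ℝ}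

lemma continuous_vnorm {X : Type*} [TopologicalSpace X] {f : X → ι → ℝ} (hf : Continuous f) :
    Continuous fun x => vnorm (f x) :=
  ((PiLp.continuous_toLp 2 (fun _ : ι => ℝ)).comp hf).norm

lemma continuous_frob {X κ : Type*} [Fintype κ] [TopologicalSpace X] {f : X → Matrix ι κ ℝ}
    (hf : Continuous f) : Continuous fun x => frob (f x) :=
  continuous_vnorm (continuous_pi fun p => hf.matrix_elem p.1 p.2)

lemma continuous_features {ι : Type*} {S : Matrix (Fin d) ι ℝ} (hσ : Continuous σ)
    (hφ : Continuous φ) :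
    Continuous fun w : EuclideanSpace ℝ (Fin N × Fin d) => features σ φ (weights w) S := by
  refine continuous_matrix fun i j => hσ.comp ?_
  have h : Continuous fun w : EuclideanSpace ℝ (Fin N × Fin d) => ∑ a, φ (w (i, a)) * S a j :=
    continuous_finsetSum _ fun a _ =>
      (hφ.comp (by fun_prop : Continuous fun w : EuclideanSpace ℝ (Fin N × Fin d) => w (i, a))).mul
        continuous_const
  exact h

/-- The data of the concentration estimates: the feature map is continuous, `L`-Lipschitz, and the
fourth moment of its Frobenius norm is at most `T ^ 2`. -/
structure FeatureBounds (N d : ℕ) {ι : Type*} [Fintype ι] (σ φ : ℝ → ℝ) (S : Matrix (Fin d) ι ℝ)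
    (L T : ℝ) : Prop where
  continuous_left : Continuous σ
  continuous_right : Continuous φ
  nonneg : 0 ≤ L
  nonneg' : 0 ≤ T
  lipschitz : ∀ W W' : Matrix (Fin N) (Fin d) ℝ,
    frob (features σ φ W S - features σ φ W' S) ≤ L * frob (W - W')
  moment : ∫ w, frob (features σ φ (weights w) S) ^ 4
    ∂(stdGaussian (EuclideanSpace ℝ (Fin N × Fin d))) ≤ T ^ 2

namespace FeatureBounds

variable {L T : ℝ}

lemma continuous (h : FeatureBounds N d σ φ S L T) :
    Continuous fun w : EuclideanSpace ℝ (Fin N × Fin d) => features σ φ (weights w) S :=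
  continuous_features h.continuous_left h.continuous_right

lemma frob_le (h : FeatureBounds N d σ φ S L T) (w : EuclideanSpace ℝ (Fin N × Fin d)) :
    frob (features σ φ (weights w) S)
      ≤ (frob (features σ φ (weights (0 : EuclideanSpace ℝ (Fin N × Fin d))) S) + L)
        * (1 + ‖w‖) := by
  set F := features σ φ (weights w) S
  set F₀ := features σ φ (weights (0 : EuclideanSpace ℝ (Fin N × Fin d))) S
  have h1 : frob F ≤ frob F₀ + frob (F - F₀) := by
    have e := frob_add_le F₀ (F - F₀)
    rwa [add_sub_cancel] at e
  have h2 : frob (F - F₀) ≤ L * ‖w‖ := by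
    have e := h.lipschitz (weights w) (weights 0)
    rwa [← weights_sub, sub_zero, frob_weights] at e
  nlinarith [frob_nonneg F₀, norm_nonneg w, h.nonneg,
    mul_nonneg (frob_nonneg F₀) (norm_nonneg w)]

lemma integrable_of_frob_le (h : FeatureBounds N d σ φ S L T)
    {f : EuclideanSpace ℝ (Fin N × Fin d) → ℝ} (hf : Continuous f) (c : ℝ) (q : ℕ)
    (hb : ∀ w, |f w| ≤ c * frob (features σ φ (weights w) S) ^ q) :
    Integrable f (stdGaussian (EuclideanSpace ℝ (Fin N × Fin d))) := by
  refine integrable_of_polynomial_growth (q := q) (C := |c| *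
    (frob (features σ φ (weights (0 : EuclideanSpace ℝ (Fin N × Fin d))) S) + L) ^ q)
    hf.aestronglyMeasurable fun w => (hb w).trans ?_
  rw [mul_assoc, ← mul_pow]
  exact mul_le_mul (le_abs_self c) (pow_le_pow_left₀ (frob_nonneg _) (h.frob_le w) q)
    (pow_nonneg (frob_nonneg _) q) (abs_nonneg c)

lemma integrable_frob_pow (h : FeatureBounds N d σ φ S L T) (q : ℕ) :
    Integrable (fun w => frob (features σ φ (weights w) S) ^ q)
      (stdGaussian (EuclideanSpace ℝ (Fin N × Fin d))) :=
  h.integrable_of_frob_le ((continuous_frob h.continuous).pow q) 1 q fun w => by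
    rw [one_mul, abs_of_nonneg (pow_nonneg (frob_nonneg _) q)]

lemma abs_entry_le_frob {κ τ : Type*} [Fintype κ] [Fintype τ] (A : Matrix κ τ ℝ) (i : κ) (j : τ) :
    |A i j| ≤ frob A := by
  refine abs_le_of_sq_le_sq' ?_ (frob_nonneg A) |> abs_le.2
  rw [frob_sq]
  exact (Finset.single_le_sum (f := fun j => A i j ^ 2) (fun _ _ => sq_nonneg _)
    (Finset.mem_univ j)).trans (Finset.single_le_sum (f := fun i => ∑ j, A i j ^ 2)
      (fun _ _ => Finset.sum_nonneg fun _ _ => sq_nonneg _) (Finset.mem_univ i))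

lemma integrable_entry_mul (h : FeatureBounds N d σ φ S L T) (i i' : Fin N) (j l : ι) :
    Integrable (fun w => features σ φ (weights w) S i j * features σ φ (weights w) S i' l)
      (stdGaussian (EuclideanSpace ℝ (Fin N × Fin d))) := by
  refine h.integrable_of_frob_le
    ((h.continuous.matrix_elem i j).mul (h.continuous.matrix_elem i' l)) 1 2 fun w => ?_
  rw [abs_mul, one_mul, sq]
  exact mul_le_mul (abs_entry_le_frob _ _ _) (abs_entry_le_frob _ _ _) (abs_nonneg _)
    (frob_nonneg _)

/-- Each row of the random features contributes the same second moments. -/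
lemma integral_entry_mul (h : FeatureBounds N d σ φ S L T) (i : Fin N) (j l : ι) :
    ∫ w, features σ φ (weights w) S i j * features σ φ (weights w) S i l
      ∂(stdGaussian (EuclideanSpace ℝ (Fin N × Fin d))) = meanGram σ φ S j l := by
  have hc : Continuous fun w : Fin d → ℝ =>
      σ (∑ a, φ (w a) * S a j) * σ (∑ a, φ (w a) * S a l) := by
    have h1 := h.continuous_left
    have h2 := h.continuous_right
    fun_prop
  change _ = ∫ w : Fin d → ℝ, σ (∑ a, φ (w a) * S a j) * σ (∑ a, φ (w a) * S a l)
      ∂(Measure.pi fun _ : Fin d => gaussianReal 0 1)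
  rw [← map_row_stdGaussian i, integral_map (by fun_prop) hc.aestronglyMeasurable]
  rfl

/-- The sample Gram matrix is an unbiased estimate of `N / m` times the second moment matrix. -/
lemma integral_sampleGram_bilin (h : FeatureBounds N d σ φ S L T) (m : ℝ) (u v : ι → ℝ) :
    ∫ w, u ⬝ᵥ sampleGram σ φ S m (weights w) *ᵥ v
      ∂(stdGaussian (EuclideanSpace ℝ (Fin N × Fin d)))
      = N / m * (u ⬝ᵥ meanGram σ φ S *ᵥ v) := by
  have e : ∀ w : EuclideanSpace ℝ (Fin N × Fin d), u ⬝ᵥ sampleGram σ φ S m (weights w) *ᵥ v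
      = ∑ j, ∑ l, ∑ i, (u j * v l / m)
        * (features σ φ (weights w) S i j * features σ φ (weights w) S i l) := by
    intro w
    simp only [dotProduct, mulVec, sampleGram, Matrix.smul_apply, Matrix.mul_apply,
      transpose_apply, smul_eq_mul, Finset.mul_sum, Finset.sum_mul]
    refine Finset.sum_congr rfl fun j _ => Finset.sum_congr rfl fun l _ =>
      Finset.sum_congr rfl fun i _ => ?_
    ring
  have hint := fun j l i => (h.integrable_entry_mul i i j l).const_mul (u j * v l / m)
  simp_rw [e]
  rw [integral_finsetSum _ fun j _ => integrable_finsetSum _ fun l _ =>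
    integrable_finsetSum _ fun i _ => hint j l i]
  simp only [dotProduct, mulVec, Finset.mul_sum]
  refine Finset.sum_congr rfl fun j _ => ?_
  rw [integral_finsetSum _ fun l _ => integrable_finsetSum _ fun i _ => hint j l i]
  refine Finset.sum_congr rfl fun l _ => ?_
  rw [integral_finsetSum _ fun i _ => hint j l i]
  simp_rw [integral_const_mul, h.integral_entry_mul]
  rw [Finset.sum_const, Finset.card_univ, Fintype.card_fin, nsmul_eq_mul]
  ring

lemma continuous_sampleGram (h : FeatureBounds N d σ φ S L T) (m : ℝ) :
    Continuous fun w : EuclideanSpace ℝ (Fin N × Fin d) => sampleGram σ φ S m (weights w) :=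
  Continuous.const_smul (g := fun w : EuclideanSpace ℝ (Fin N × Fin d) =>
    (features σ φ (weights w) S)ᵀ * features σ φ (weights w) S)
    (h.continuous.matrix_transpose.matrix_mul h.continuous) (1 / m)

lemma integral_frob_sq_le (h : FeatureBounds N d σ φ S L T) :
    ∫ w, frob (features σ φ (weights w) S) ^ 2
      ∂(stdGaussian (EuclideanSpace ℝ (Fin N × Fin d))) ≤ T := by
  refine abs_le_of_sq_le_sq' ?_ h.nonneg' |>.2
  refine (sq_integral_le (h.integrable_frob_pow 2) ?_).trans ?_
  · simpa only [← pow_mul] using h.integrable_frob_pow 4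
  · simpa only [← pow_mul] using h.moment

end FeatureBounds

end Moments

/-! ### Concentration of the sample Gram matrix -/

section Concentration

variable {N d : ℕ} {ι : Type*} [Fintype ι] {σ φ : ℝ → ℝ} {S : Matrix (Fin d) ι ℝ} {L T m : ℝ}

lemma meanGram_transpose {ι : Type*} {S : Matrix (Fin d) ι ℝ} :
    (meanGram σ φ S)ᵀ = meanGram σ φ S := by
  ext j l
  simp only [transpose_apply, meanGram, of_apply]
  refine integral_congr_ae (ae_of_all _ fun w => ?_)
  exact mul_comm _ _

namespace FeatureBounds

lemma meanGram_nonneg (h : FeatureBounds N d σ φ S L T) (hN : 0 < N) (u : ι → ℝ) :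
    0 ≤ u ⬝ᵥ meanGram σ φ S *ᵥ u := by
  have h1 := h.integral_sampleGram_bilin 1 u u
  have h2 : 0 ≤ (N : ℝ) / 1 * (u ⬝ᵥ meanGram σ φ S *ᵥ u) := by
    rw [← h1]
    exact integral_nonneg fun w => sampleGram_nonneg zero_le_one _ _
  rw [div_one] at h2
  exact nonneg_of_mul_nonneg_right h2 (by exact_mod_cast hN)

lemma trace_meanGram_le (h : FeatureBounds N d σ φ S L T) (hN : 0 < N) :
    (meanGram σ φ S).trace ≤ T / N := by
  have hN' : (0 : ℝ) < N := by exact_mod_cast hN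
  rw [le_div_iff₀ hN', mul_comm]
  refine le_trans (le_of_eq ?_) h.integral_frob_sq_le
  simp_rw [frob_sq]
  rw [integral_finsetSum _ fun i _ => integrable_finsetSum _ fun j _ => by
    simpa only [sq] using h.integrable_entry_mul i i j j]
  have e : ∀ i : Fin N, ∫ w, ∑ j, features σ φ (weights w) S i j ^ 2
      ∂(stdGaussian (EuclideanSpace ℝ (Fin N × Fin d))) = (meanGram σ φ S).trace := by
    intro i
    rw [integral_finsetSum _ fun j _ => by
      simpa only [sq] using h.integrable_entry_mul i i j j]
    simp_rw [sq, h.integral_entry_mul]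
    rfl
  simp_rw [e]
  rw [Finset.sum_const, Finset.card_univ, Fintype.card_fin, nsmul_eq_mul]

lemma exists_frob_sampleGram_sub_le (h : FeatureBounds N d σ φ S L T) (m : ℝ)
    (A : Matrix ι ι ℝ) :
    ∃ C : ℝ, ∀ w : EuclideanSpace ℝ (Fin N × Fin d),
      frob (sampleGram σ φ S m (weights w) - A) ≤ C * (1 + ‖w‖) ^ 2 := by
  refine ⟨|1 / m| * (frob (features σ φ
    (weights (0 : EuclideanSpace ℝ (Fin N × Fin d))) S) + L) ^ 2 + frob A, fun w => ?_⟩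
  have e1 : frob (sampleGram σ φ S m (weights w))
      ≤ |1 / m| * frob (features σ φ (weights w) S) ^ 2 := by
    rw [sampleGram, frob_smul]
    refine mul_le_mul_of_nonneg_left ((frob_mul_le _ _).trans ?_) (abs_nonneg _)
    rw [frob_transpose, sq]
  have e2 := pow_le_pow_left₀ (frob_nonneg _) (h.frob_le w) 2
  rw [mul_pow] at e2
  have e3 := mul_le_mul_of_nonneg_left e2 (abs_nonneg (1 / m))
  have e4 : 1 ≤ (1 + ‖w‖) ^ 2 := one_le_pow₀ (by linarith [norm_nonneg w])
  have e5 := mul_le_mul_of_nonneg_left e4 (frob_nonneg A)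
  have e6 := frob_sub_le (sampleGram σ φ S m (weights w)) A
  rw [add_mul, mul_assoc]
  linarith

lemma integrable_pow_of_abs_le_frob (h : FeatureBounds N d σ φ S L T) {A : Matrix ι ι ℝ} {c : ℝ}
    {f : EuclideanSpace ℝ (Fin N × Fin d) → ℝ} (hf : Continuous f)
    (hb : ∀ w, |f w| ≤ c * frob (sampleGram σ φ S m (weights w) - A)) (q : ℕ) :
    Integrable (fun w => f w ^ q) (stdGaussian (EuclideanSpace ℝ (Fin N × Fin d))) := by
  obtain ⟨C, hC⟩ := h.exists_frob_sampleGram_sub_le m A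
  refine integrable_of_polynomial_growth (C := (|c| * C) ^ q) (q := 2 * q)
    (hf.pow q).aestronglyMeasurable fun w => ?_
  rw [abs_pow, pow_mul, ← mul_pow]
  refine pow_le_pow_left₀ (abs_nonneg _) ((hb w).trans ?_) q
  rw [mul_assoc]
  exact mul_le_mul (le_abs_self c) (hC w) (frob_nonneg _) (abs_nonneg c)

/-- A bilinear form of the sample Gram matrix varies at the rate of the norms of the features along
the two vectors, so the moments of these norms bound its central moments. -/
lemma integral_abs_bilin_pow_le (h : FeatureBounds N d σ φ S L T) (hm : 0 < m) (u v : ι → ℝ)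
    (p : ℕ) :
    ∫ w, |u ⬝ᵥ (sampleGram σ φ S m (weights w) - (N / m) • meanGram σ φ S) *ᵥ v| ^ (p + 1)
        ∂(stdGaussian (EuclideanSpace ℝ (Fin N × Fin d)))
      ≤ Real.pi ^ (p + 1) * absMoment (p + 1) *
        ∫ w, (L / m * (vnorm (features σ φ (weights w) S *ᵥ u) * vnorm v
          + vnorm u * vnorm (features σ φ (weights w) S *ᵥ v))) ^ (p + 1)
          ∂(stdGaussian (EuclideanSpace ℝ (Fin N × Fin d))) := by
  have hF := h.continuous
  have hFu : ∀ u : ι → ℝ, Continuous fun w : EuclideanSpace ℝ (Fin N × Fin d) =>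
      vnorm (features σ φ (weights w) S *ᵥ u) := fun u =>
    continuous_vnorm (hF.matrix_mulVec continuous_const)
  have hLm : 0 ≤ L / m := div_nonneg h.nonneg hm.le
  have key := integral_abs_sub_integral_pow_le
    (f := fun w : EuclideanSpace ℝ (Fin N × Fin d) => u ⬝ᵥ sampleGram σ φ S m (weights w) *ᵥ v)
    (g := fun w => L / m * (vnorm (features σ φ (weights w) S *ᵥ u) * vnorm v
          + vnorm u * vnorm (features σ φ (weights w) S *ᵥ v)))
    (C := L / m * (2 * (vnorm u * vnorm v)) *
      (frob (features σ φ (weights (0 : EuclideanSpace ℝ (Fin N × Fin d))) S) + L))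
    (continuous_const.mul (((hFu u).mul continuous_const).add (continuous_const.mul (hFu v))))
    (fun w => mul_nonneg hLm (add_nonneg (mul_nonneg (vnorm_nonneg _) (vnorm_nonneg _))
      (mul_nonneg (vnorm_nonneg _) (vnorm_nonneg _))))
    (fun w => ?_) (fun w w' => ?_) p
  · rw [h.integral_sampleGram_bilin] at key
    simp_rw [sub_mulVec, dotProduct_sub, smul_mulVec, dotProduct_smul, smul_eq_mul]
    exact key
  · have e := h.frob_le w
    have e1 := vnorm_mulVec_le (features σ φ (weights w) S) u
    have e2 := vnorm_mulVec_le (features σ φ (weights w) S) v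
    rw [mul_assoc, mul_assoc]
    refine mul_le_mul_of_nonneg_left ?_ hLm
    have e3 := mul_le_mul_of_nonneg_right e1 (vnorm_nonneg v)
    have e4 := mul_le_mul_of_nonneg_left e2 (vnorm_nonneg u)
    have e5 := mul_le_mul_of_nonneg_left e (mul_nonneg (vnorm_nonneg u) (vnorm_nonneg v))
    linarith
  · have e := abs_sampleGram_bilin_sub_le (m := m) h.lipschitz hm (weights w) (weights w') u v
    rwa [← weights_sub, frob_weights] at e

lemma integral_bilin_pow_four_le (h : FeatureBounds N d σ φ S L T) (hm : 0 < m) (u v : ι → ℝ) :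
    ∫ w, |u ⬝ᵥ (sampleGram σ φ S m (weights w) - (N / m) • meanGram σ φ S) *ᵥ v| ^ 4
        ∂(stdGaussian (EuclideanSpace ℝ (Fin N × Fin d)))
      ≤ Real.pi ^ 4 * absMoment 4 * ((2 * (L / m) * (vnorm u * vnorm v)) ^ 4 * T ^ 2) := by
  refine (h.integral_abs_bilin_pow_le hm u v 3).trans ?_
  have hLm : 0 ≤ L / m := div_nonneg h.nonneg hm.le
  refine mul_le_mul_of_nonneg_left ?_ (mul_nonneg (by positivity) (absMoment_nonneg 4))
  refine le_trans (integral_mono_of_nonneg (ae_of_all _ fun w => ?_)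
    ((h.integrable_frob_pow 4).const_mul ((2 * (L / m) * (vnorm u * vnorm v)) ^ 4))
    (ae_of_all _ fun w => ?_)) ?_
  · exact pow_nonneg (mul_nonneg hLm (add_nonneg (mul_nonneg (vnorm_nonneg _) (vnorm_nonneg _))
      (mul_nonneg (vnorm_nonneg _) (vnorm_nonneg _)))) 4
  · change _ ≤ (2 * (L / m) * (vnorm u * vnorm v)) ^ 4 * frob (features σ φ (weights w) S) ^ 4
    rw [← mul_pow]
    refine pow_le_pow_left₀ (mul_nonneg hLm (add_nonneg
      (mul_nonneg (vnorm_nonneg _) (vnorm_nonneg _))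
      (mul_nonneg (vnorm_nonneg _) (vnorm_nonneg _)))) ?_ 4
    have e3 := mul_le_mul_of_nonneg_right (vnorm_mulVec_le (features σ φ (weights w) S) u)
      (vnorm_nonneg v)
    have e4 := mul_le_mul_of_nonneg_left (vnorm_mulVec_le (features σ φ (weights w) S) v)
      (vnorm_nonneg u)
    have e5 := mul_le_mul_of_nonneg_left (add_le_add e3 e4) hLm
    refine e5.trans (le_of_eq ?_)
    ring
  · rw [integral_const_mul]
    exact mul_le_mul_of_nonneg_left h.moment (by positivity)

/-- The mean square deviation is summed over the entries: the columns of the features share the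
total second moment `T`, which saves a factor `m` over a bound of each entry by `T`. -/
lemma integral_frob_sub_sq_le [DecidableEq ι] (h : FeatureBounds N d σ φ S L T) (hm : 0 < m) :
    ∫ w, frob (sampleGram σ φ S m (weights w) - (N / m) • meanGram σ φ S) ^ 2
        ∂(stdGaussian (EuclideanSpace ℝ (Fin N × Fin d)))
      ≤ Real.pi ^ 2 * absMoment 2 * (4 * (L / m) ^ 2 * Fintype.card ι * T) := by
  set ν := stdGaussian (EuclideanSpace ℝ (Fin N × Fin d)) with hν
  have hF := h.continuous
  have hone : ∀ j : ι, vnorm (Pi.single j (1 : ℝ) : ι → ℝ) = 1 := fun j => by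
    rw [← sq_eq_sq₀ (vnorm_nonneg _) zero_le_one, vnorm_sq]
    simp [Pi.single_apply, ite_pow]
  have hcol : ∀ (j : ι) (W : Matrix (Fin N) (Fin d) ℝ),
      vnorm (features σ φ W S *ᵥ Pi.single j 1) ^ 2 = ∑ i, features σ φ W S i j ^ 2 := fun j W => by
    rw [mulVec_single_one, vnorm_sq]
    rfl
  have hci : ∀ j : ι, Integrable (fun w : EuclideanSpace ℝ (Fin N × Fin d) =>
      ∑ i, features σ φ (weights w) S i j ^ 2) ν := fun j =>
    integrable_finsetSum _ fun i _ => by simpa only [sq] using h.integrable_entry_mul i i j j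
  -- the entry in row `j` and column `l` is the bilinear form at two basis vectors
  have hentry : ∀ j l : ι,
      ∫ w, (sampleGram σ φ S m (weights w) - (N / m) • meanGram σ φ S) j l ^ 2 ∂ν
        ≤ Real.pi ^ 2 * absMoment 2 * (2 * (L / m) ^ 2
          * ((∫ w, ∑ i, features σ φ (weights w) S i j ^ 2 ∂ν)
            + ∫ w, ∑ i, features σ φ (weights w) S i l ^ 2 ∂ν)) := by
    intro j l
    have e : ∀ w : EuclideanSpace ℝ (Fin N × Fin d),
        (sampleGram σ φ S m (weights w) - (N / m) • meanGram σ φ S) j l ^ 2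
        = |(Pi.single j (1 : ℝ) : ι → ℝ) ⬝ᵥ
          (sampleGram σ φ S m (weights w) - (N / m) • meanGram σ φ S) *ᵥ Pi.single l 1| ^ 2 := by
      intro w
      rw [sq_abs, mulVec_single_one, single_one_dotProduct]
      rfl
    simp_rw [e]
    refine (h.integral_abs_bilin_pow_le hm _ _ 1).trans ?_
    refine mul_le_mul_of_nonneg_left ?_ (mul_nonneg (by positivity) (absMoment_nonneg 2))
    rw [← integral_add (hci j) (hci l), ← integral_const_mul]
    refine integral_mono_of_nonneg (ae_of_all _ fun w => sq_nonneg _)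
      (((hci j).add (hci l)).const_mul _) (ae_of_all _ fun w => ?_)
    change _ ≤ 2 * (L / m) ^ 2 * (_ + _)
    simp only [hone, mul_one, one_mul]
    rw [← hcol, ← hcol, mul_pow]
    have := add_sq_le (a := vnorm (features σ φ (weights w) S *ᵥ Pi.single j 1))
      (b := vnorm (features σ φ (weights w) S *ᵥ Pi.single l 1))
    nlinarith [mul_le_mul_of_nonneg_left this (sq_nonneg (L / m))]
  have hRi : ∀ j l : ι, Integrable (fun w : EuclideanSpace ℝ (Fin N × Fin d) =>
      (sampleGram σ φ S m (weights w) - (N / m) • meanGram σ φ S) j l ^ 2) ν := by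
    intro j l
    have hc : Continuous fun w : EuclideanSpace ℝ (Fin N × Fin d) =>
        (sampleGram σ φ S m (weights w) - (N / m) • meanGram σ φ S) j l :=
      ((h.continuous_sampleGram m).matrix_elem j l).sub continuous_const
    exact h.integrable_pow_of_abs_le_frob (m := m) (A := (N / m) • meanGram σ φ S) (c := 1) hc
      (fun w => (abs_entry_le_frob _ j l).trans_eq (one_mul _).symm) 2
  simp_rw [frob_sq]
  rw [integral_finsetSum _ fun j _ => integrable_finsetSum _ fun l _ => hRi j l]
  simp_rw [integral_finsetSum _ fun l _ => hRi _ l]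
  refine (Finset.sum_le_sum fun j _ => Finset.sum_le_sum fun l _ => hentry j l).trans ?_
  have hT : ∑ j, ∫ w, ∑ i, features σ φ (weights w) S i j ^ 2 ∂ν ≤ T := by
    rw [← integral_finsetSum _ fun j _ => hci j]
    refine le_trans (le_of_eq ?_) h.integral_frob_sq_le
    refine integral_congr_ae (ae_of_all _ fun w => ?_)
    change _ = frob (features σ φ (weights w) S) ^ 2
    rw [frob_sq]
    exact Finset.sum_comm
  simp_rw [← Finset.mul_sum, Finset.sum_add_distrib, Finset.sum_const, Finset.card_univ,
    nsmul_eq_mul, ← Finset.mul_sum]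
  refine mul_le_mul_of_nonneg_left ?_ (mul_nonneg (by positivity) (absMoment_nonneg 2))
  have hc : 0 ≤ 4 * (L / m) ^ 2 * (Fintype.card ι : ℝ) := by positivity
  nlinarith [mul_le_mul_of_nonneg_left hT hc]

/-- The Frobenius distance to a fixed matrix concentrates around its mean. -/
lemma integral_frob_dev_pow_four_le (h : FeatureBounds N d σ φ S L T) (hm : 0 < m)
    (A : Matrix ι ι ℝ) :
    ∫ w, |frob (sampleGram σ φ S m (weights w) - A)
        - ∫ w', frob (sampleGram σ φ S m (weights w') - A)
          ∂(stdGaussian (EuclideanSpace ℝ (Fin N × Fin d)))| ^ 4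
        ∂(stdGaussian (EuclideanSpace ℝ (Fin N × Fin d)))
      ≤ Real.pi ^ 4 * absMoment 4 * ((L / m) ^ 4 * T ^ 2) := by
  have hLm : 0 ≤ L / m := div_nonneg h.nonneg hm.le
  have key := integral_abs_sub_integral_pow_le
    (f := fun w : EuclideanSpace ℝ (Fin N × Fin d) => frob (sampleGram σ φ S m (weights w) - A))
    (g := fun w => L / m * frob (features σ φ (weights w) S))
    (C := L / m *
      (frob (features σ φ (weights (0 : EuclideanSpace ℝ (Fin N × Fin d))) S) + L))
    (continuous_const.mul (continuous_frob h.continuous))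
    (fun w => mul_nonneg hLm (frob_nonneg _)) (fun w => ?_) (fun w w' => ?_) 3
  · refine key.trans
      (mul_le_mul_of_nonneg_left ?_ (mul_nonneg (by positivity) (absMoment_nonneg 4)))
    simp_rw [mul_pow]
    rw [integral_const_mul]
    exact mul_le_mul_of_nonneg_left h.moment (by positivity)
  · rw [mul_assoc]
    exact mul_le_mul_of_nonneg_left (h.frob_le w) hLm
  · have e := abs_frob_sampleGram_sub_le (m := m) h.lipschitz hm (weights w) (weights w') A
    rwa [← weights_sub, frob_weights] at e

end FeatureBounds

end Concentration

/-! ### Almost sure convergence of the Gram fluctuation -/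

section AlmostSure

variable {Ω : Type*} [MeasurableSpace Ω] {μ : Measure Ω}

/-- Summable fourth moments force almost sure convergence to zero. -/
lemma ae_tendsto_zero_of_moment_le {Z : ℕ → Ω → ℝ} {C : ℝ}
    (hZ : ∀ᶠ k in atTop, Integrable (fun ω => Z k ω ^ 4) μ ∧ ∫ ω, Z k ω ^ 4 ∂μ ≤ C / (k : ℝ) ^ 2) :
    ∀ᵐ ω ∂μ, Tendsto (fun k => Z k ω) atTop (𝓝 0) := by
  obtain ⟨k₀, hk₀⟩ := eventually_atTop.1 hZ
  have hint : ∀ k, ∫⁻ ω, ENNReal.ofReal (Z (k + k₀) ω ^ 4) ∂μ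
      ≤ ENNReal.ofReal (C / ((k + k₀ : ℕ) : ℝ) ^ 2) := fun k => by
    obtain ⟨h1, h2⟩ := hk₀ (k + k₀) (by omega)
    rw [← ofReal_integral_eq_lintegral_ofReal h1 (ae_of_all _ fun ω => by positivity)]
    exact ENNReal.ofReal_le_ofReal h2
  have hsum : Summable fun k : ℕ => C / ((k + k₀ : ℕ) : ℝ) ^ 2 := by
    have h1 : Summable fun k : ℕ => C / (k : ℝ) ^ 2 :=
      ((Real.summable_one_div_nat_pow (p := 2)).2 one_lt_two).mul_left C |>.congr fun k => by ring
    exact (summable_nat_add_iff k₀).2 h1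
  have hfin : ∫⁻ ω, ∑' k, ENNReal.ofReal (Z (k + k₀) ω ^ 4) ∂μ ≠ ⊤ := by
    rw [lintegral_tsum fun k => (hk₀ (k + k₀) (by omega)).1.aemeasurable.ennreal_ofReal]
    exact ne_top_of_le_ne_top hsum.tsum_ofReal_ne_top (ENNReal.tsum_le_tsum hint)
  have hmeas : AEMeasurable (fun ω => ∑' k, ENNReal.ofReal (Z (k + k₀) ω ^ 4)) μ :=
    AEMeasurable.tsum fun k => (hk₀ (k + k₀) (by omega)).1.aemeasurable.ennreal_ofReal
  filter_upwards [ae_lt_top' hmeas hfin] with ω hω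
  have h1 := ENNReal.tendsto_atTop_zero_of_tsum_ne_top hω.ne
  have h2 : Tendsto (fun k => Z (k + k₀) ω ^ 4) atTop (𝓝 0) := by
    have h3 := (ENNReal.tendsto_toReal ENNReal.zero_ne_top).comp h1
    refine (h3.congr fun k => ?_)
    simp only [Function.comp_apply]
    exact ENNReal.toReal_ofReal (by positivity)
  have h4 : Tendsto (fun k => Z k ω ^ 4) atTop (𝓝 0) := (tendsto_add_atTop_iff_nat k₀).1 h2
  rw [tendsto_zero_iff_abs_tendsto_zero]
  have h5 := (h4.sqrt).sqrt
  simp only [Real.sqrt_zero] at h5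
  refine h5.congr fun k => ?_
  have e : Z k ω ^ 4 = ((Z k ω) ^ 2) ^ 2 := by ring
  rw [e, Real.sqrt_sq (sq_nonneg _), Real.sqrt_sq_eq_abs]
  rfl

/-- A matrix with independent standard normal entries is a standard Gaussian vector. -/
lemma map_entries_eq_stdGaussian [IsProbabilityMeasure μ] {N d : ℕ}
    {W : Ω → Matrix (Fin N) (Fin d) ℝ}
    (hlaw : ∀ i j, HasLaw (fun ω => W ω i j) (gaussianReal 0 1) μ)
    (hindep : iIndepFun (fun (p : Fin N × Fin d) ω => W ω p.1 p.2) μ) :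
    AEMeasurable (fun ω => (WithLp.toLp 2 fun p => W ω p.1 p.2 :
      EuclideanSpace ℝ (Fin N × Fin d))) μ ∧
    μ.map (fun ω => (WithLp.toLp 2 fun p => W ω p.1 p.2 : EuclideanSpace ℝ (Fin N × Fin d)))
      = stdGaussian (EuclideanSpace ℝ (Fin N × Fin d)) := by
  have hm : AEMeasurable (fun ω => fun p : Fin N × Fin d => W ω p.1 p.2) μ :=
    aemeasurable_pi_lambda _ fun p => (hlaw p.1 p.2).aemeasurable
  have hL : Measurable (WithLp.toLp 2 : (Fin N × Fin d → ℝ) → EuclideanSpace ℝ (Fin N × Fin d)) :=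
    by fun_prop
  refine ⟨hL.comp_aemeasurable hm, ?_⟩
  have h1 := (iIndepFun_iff_map_fun_eq_pi_map
    (f := fun (p : Fin N × Fin d) ω => W ω p.1 p.2) fun p => (hlaw p.1 p.2).aemeasurable).1 hindep
  have h2 : (fun p : Fin N × Fin d => μ.map fun ω => W ω p.1 p.2)
      = fun _ => gaussianReal 0 1 := funext fun p => (hlaw p.1 p.2).map_eq
  rw [h2] at h1
  rw [← map_pi_eq_stdGaussian, ← h1, AEMeasurable.map_map_of_aemeasurable hL.aemeasurable hm]
  rfl

/-- Transfer of a fourth moment bound from the Gaussian model to the probability space. -/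
lemma integral_pow_four_of_map [IsProbabilityMeasure μ] {N d : ℕ}
    {W : Ω → Matrix (Fin N) (Fin d) ℝ}
    (hlaw : ∀ i j, HasLaw (fun ω => W ω i j) (gaussianReal 0 1) μ)
    (hindep : iIndepFun (fun (p : Fin N × Fin d) ω => W ω p.1 p.2) μ)
    {f : Matrix (Fin N) (Fin d) ℝ → ℝ} {B : ℝ}
    (hf : Continuous fun w : EuclideanSpace ℝ (Fin N × Fin d) => f (weights w))
    (hi : Integrable (fun w => f (weights w) ^ 4)
      (stdGaussian (EuclideanSpace ℝ (Fin N × Fin d))))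
    (hB : ∫ w, f (weights w) ^ 4 ∂(stdGaussian (EuclideanSpace ℝ (Fin N × Fin d))) ≤ B) :
    Integrable (fun ω => f (W ω) ^ 4) μ ∧ ∫ ω, f (W ω) ^ 4 ∂μ ≤ B := by
  obtain ⟨hm, hmap⟩ := map_entries_eq_stdGaussian hlaw hindep
  rw [← hmap] at hi hB
  refine ⟨(integrable_map_measure (hf.pow 4).aestronglyMeasurable hm).1 hi, ?_⟩
  exact (integral_map hm (hf.pow 4).aestronglyMeasurable).symm.trans_le hB

end AlmostSure

section FeatureBounds

variable {N d : ℕ} {ι : Type*} [Fintype ι] {σ φ : ℝ → ℝ} {S : Matrix (Fin d) ι ℝ} {a b s : ℝ}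

/-- When all dimensions are at most `C m`, the constants of the concentration estimates can be
chosen as a fixed Lipschitz constant and a multiple of `m ^ 2`. -/
lemma exists_featureBounds (σ φ : ℝ → ℝ) (ha : 0 ≤ a) (hσ : ∀ x y, |σ x - σ y| ≤ a * |x - y|)
    (hb : 0 ≤ b) (hφ : ∀ x y, |φ x - φ y| ≤ b * |x - y|) (hs : 0 ≤ s) {C : ℝ} (hC : 0 ≤ C) :
    ∃ K : ℝ, 0 ≤ K ∧ ∀ {N d : ℕ} {ι : Type*} [Fintype ι] (S : Matrix (Fin d) ι ℝ) (m : ℝ),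
      (∀ x, vnorm (Sᵀ *ᵥ x) ≤ s * vnorm x) → 0 ≤ m → N ≤ C * m → d ≤ C * m →
      Fintype.card ι ≤ C * m → FeatureBounds N d σ φ S (a * s * b) (K * m ^ 2) := by
  have hcont : ∀ {f : ℝ → ℝ} {c : ℝ}, 0 ≤ c → (∀ x y, |f x - f y| ≤ c * |x - y|) →
      Continuous f := fun {f c} hc hf =>
    (LipschitzWith.of_dist_le_mul (K := ⟨c, hc⟩) fun x y => hf x y).continuous
  set A := (|σ 0| + a * s * |φ 0|) * C with hA
  have hA0 : 0 ≤ A := by positivity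
  have hL : 0 ≤ a * s * b := by positivity
  set B := 8 * (A ^ 4 + (a * s * b) ^ 4 * (C ^ 4 * absMoment 4)) with hB
  have hB0 : 0 ≤ B := by have := absMoment_nonneg 4; positivity
  refine ⟨1 + B, by linarith, fun {N d ι} _ S m hS hm hN hd hι => ?_⟩
  have hCm : 0 ≤ C * m := by positivity
  have hF : ∀ w : EuclideanSpace ℝ (Fin N × Fin d),
      frob (features σ φ (weights w) S) ^ 4 ≤ 8 * ((A * m) ^ 4 + (a * s * b) ^ 4 * ‖w‖ ^ 4) := by
    intro w
    have h1 := frob_features_le (S := S) ha hσ hb hφ hs hS (weights w)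
    have h2 : Real.sqrt (N * Fintype.card ι) ≤ C * m :=
      Real.sqrt_le_iff.2 ⟨hCm, by rw [sq]; gcongr⟩
    have h3 : Real.sqrt (N * d) ≤ C * m := Real.sqrt_le_iff.2 ⟨hCm, by rw [sq]; gcongr⟩
    have h4 : frob (features σ φ (weights w) S) ≤ A * m + a * s * b * ‖w‖ := by
      rw [frob_weights] at h1
      refine h1.trans ?_
      have e1 := mul_le_mul_of_nonneg_left h2 (abs_nonneg (σ 0))
      have e2 := mul_le_mul_of_nonneg_left h3 (by positivity : 0 ≤ a * s * |φ 0|)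
      rw [hA]
      linarith
    refine (pow_le_pow_left₀ (frob_nonneg _) h4 4).trans ?_
    rw [← mul_pow]
    generalize A * m = x
    generalize a * s * b * ‖w‖ = y
    have e1 := add_sq_le (a := x) (b := y)
    have e2 := add_sq_le (a := x ^ 2) (b := y ^ 2)
    have e3 := pow_le_pow_left₀ (sq_nonneg (x + y)) e1 2
    nlinarith
  refine ⟨hcont ha hσ, hcont hb hφ, hL, by positivity,
    fun W W' => frob_features_sub_le ha hσ hb hφ hs hS W W', ?_⟩
  have hint : Integrable (fun w : EuclideanSpace ℝ (Fin N × Fin d) => ‖w‖ ^ 4)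
      (stdGaussian (EuclideanSpace ℝ (Fin N × Fin d))) := by
    refine integrable_of_polynomial_growth (C := 1) (q := 4)
      (Continuous.aestronglyMeasurable (by fun_prop)) fun w => ?_
    rw [abs_of_nonneg (by positivity), one_mul]
    exact pow_le_pow_left₀ (norm_nonneg _) (by linarith) 4
  have h1 : ∫ w, frob (features σ φ (weights w) S) ^ 4
      ∂(stdGaussian (EuclideanSpace ℝ (Fin N × Fin d))) ≤ B * m ^ 4 := by
    refine (integral_mono_of_nonneg (ae_of_all _ fun w => pow_nonneg (frob_nonneg _) 4)
      (((integrable_const _).add (hint.const_mul _)).const_mul 8) (ae_of_all _ hF)).trans ?_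
    rw [integral_const_mul, integral_add' (integrable_const _) (hint.const_mul _),
      integral_const_mul]
    simp only [integral_const, probReal_univ, smul_eq_mul, one_mul]
    have h2 := integral_norm_pow_four_le (Fin N × Fin d)
    rw [Fintype.card_prod, Fintype.card_fin, Fintype.card_fin, Nat.cast_mul] at h2
    have h3 : ((N : ℝ) * d) ^ 2 ≤ (C * m * (C * m)) ^ 2 := by gcongr
    have h4 := h2.trans (mul_le_mul_of_nonneg_right h3 (absMoment_nonneg 4))
    have h5 := mul_le_mul_of_nonneg_left h4 (pow_nonneg hL 4)
    rw [hB]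
    refine le_trans (mul_le_mul_of_nonneg_left (add_le_add_right h5 _) (by norm_num)) (le_of_eq ?_)
    ring
  refine h1.trans ?_
  rw [mul_pow, ← pow_mul]
  exact mul_le_mul_of_nonneg_right (by nlinarith) (by positivity)

end FeatureBounds

section GramConcentration

variable {Ω : Type*} [MeasurableSpace Ω] {μ : Measure Ω} [IsProbabilityMeasure μ]
  {σ φ : ℝ → ℝ} {N d : ℕ → ℕ} {ι : ℕ → Type*} [∀ k, Fintype (ι k)]
  {S : ∀ k, Matrix (Fin (d k)) (ι k) ℝ} {Wt : ∀ k, Ω → Matrix (Fin (N k)) (Fin (d k)) ℝ}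
  {L K : ℝ} {m : ℕ → ℝ}

/-- The fluctuation of the sample Gram matrix around its mean. -/
def gramError (σ φ : ℝ → ℝ) {N d : ℕ} {ι : Type*} [Fintype ι] (S : Matrix (Fin d) ι ℝ) (m : ℝ)
    (W : Matrix (Fin N) (Fin d) ℝ) : Matrix ι ι ℝ :=
  sampleGram σ φ S m W - (N / m) • meanGram σ φ S

/-- Bilinear forms of the Gram fluctuation at deterministic vectors, the product of whose norms is
of order `m ^ (-1/2)`, vanish almost surely. -/
lemma ae_tendsto_bilin_gramError
    (hlaw : ∀ k i j, HasLaw (fun ω => Wt k ω i j) (gaussianReal 0 1) μ)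
    (hindep : ∀ k, iIndepFun (fun (p : Fin (N k) × Fin (d k)) ω => Wt k ω p.1 p.2) μ)
    (hF : ∀ᶠ k in atTop, FeatureBounds (N k) (d k) σ φ (S k) L (K * m k ^ 2))
    (hm : ∀ k : ℕ, (k : ℝ) ≤ m k) {u v : ∀ k, ι k → ℝ} {B : ℝ}
    (huv : ∀ᶠ k in atTop, vnorm (u k) * vnorm (v k) ≤ B / Real.sqrt (m k)) :
    ∀ᵐ ω ∂μ, Tendsto (fun k => u k ⬝ᵥ gramError σ φ (S k) (m k) (Wt k ω) *ᵥ v k) atTop (𝓝 0) := by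
  refine ae_tendsto_zero_of_moment_le
    (C := Real.pi ^ 4 * absMoment 4 * ((2 * L * B) ^ 4 * K ^ 2)) ?_
  filter_upwards [hF, huv, eventually_gt_atTop 0] with k h hk hk0
  have hk0' : (0 : ℝ) < k := by exact_mod_cast hk0
  have hmk : 0 < m k := hk0'.trans_le (hm k)
  have hc : Continuous fun w : EuclideanSpace ℝ (Fin (N k) × Fin (d k)) =>
      u k ⬝ᵥ gramError σ φ (S k) (m k) (weights w) *ᵥ v k :=
    continuous_const.dotProduct
      (((h.continuous_sampleGram (m k)).sub continuous_const).matrix_mulVec continuous_const)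
  refine integral_pow_four_of_map (hlaw k) (hindep k)
    (f := fun W => u k ⬝ᵥ gramError σ φ (S k) (m k) W *ᵥ v k) hc
    (h.integrable_pow_of_abs_le_frob (m := m k) (A := (N k / m k) • meanGram σ φ (S k))
      (c := vnorm (u k) * vnorm (v k)) hc (fun w => ?_) 4) ?_
  · refine (abs_dotProduct_le _ _).trans ?_
    refine (mul_le_mul_of_nonneg_left (vnorm_mulVec_le _ _) (vnorm_nonneg _)).trans (le_of_eq ?_)
    rw [gramError]
    ring
  · have h1 := h.integral_bilin_pow_four_le hmk (u k) (v k)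
    simp only [Even.pow_abs (by decide : Even 4)] at h1
    refine h1.trans ?_
    rw [mul_div_assoc]
    refine mul_le_mul_of_nonneg_left ?_ (mul_nonneg (by positivity) (absMoment_nonneg 4))
    have hs : 0 < Real.sqrt (m k) := Real.sqrt_pos.2 hmk
    have h2 : (2 * (L / m k) * (vnorm (u k) * vnorm (v k))) ^ 4
        ≤ (2 * (L / m k) * (B / Real.sqrt (m k))) ^ 4 := by
      have hL := h.nonneg
      refine pow_le_pow_left₀ (mul_nonneg (by positivity)
        (mul_nonneg (vnorm_nonneg _) (vnorm_nonneg _))) ?_ 4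
      exact mul_le_mul_of_nonneg_left hk (by positivity)
    refine (mul_le_mul_of_nonneg_right h2 (sq_nonneg _)).trans ?_
    have e : (2 * (L / m k) * (B / Real.sqrt (m k))) ^ 4 * (K * m k ^ 2) ^ 2
        = (2 * L * B) ^ 4 * K ^ 2 / m k ^ 2 := by
      have hs4 : Real.sqrt (m k) ^ 4 = m k ^ 2 := by
        rw [show 4 = 2 * 2 from rfl, pow_mul, Real.sq_sqrt hmk.le]
      have e1 : (2 * (L / m k) * (B / Real.sqrt (m k))) ^ 4
          = (2 * L * B) ^ 4 / (m k ^ 4 * Real.sqrt (m k) ^ 4) := by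
        field_simp
      rw [e1, hs4]
      field_simp
    rw [e]
    gcongr
    exact hm k

/-- The Frobenius norm of the Gram fluctuation is of smaller order than `m ^ (3/4)`: its mean is of
order `m ^ (1/2)` and its fourth central moment is bounded. -/
lemma ae_tendsto_frob_gramError
    (hlaw : ∀ k i j, HasLaw (fun ω => Wt k ω i j) (gaussianReal 0 1) μ)
    (hindep : ∀ k, iIndepFun (fun (p : Fin (N k) × Fin (d k)) ω => Wt k ω p.1 p.2) μ)
    (hF : ∀ᶠ k in atTop, FeatureBounds (N k) (d k) σ φ (S k) L (K * m k ^ 2))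
    (hm : ∀ k : ℕ, (k : ℝ) ≤ m k) (hcard : ∀ k, (Fintype.card (ι k) : ℝ) = m k) :
    ∀ᵐ ω ∂μ, Tendsto (fun k => frob (gramError σ φ (S k) (m k) (Wt k ω))
      / (Real.sqrt (m k) * Real.sqrt (Real.sqrt (m k)))) atTop (𝓝 0) := by
  classical
  set ρ : ℕ → ℝ := fun k => Real.sqrt (m k) * Real.sqrt (Real.sqrt (m k)) with hρ
  set E : ℕ → ℝ := fun k => ∫ w, frob (gramError σ φ (S k) (m k) (weights w))
    ∂(stdGaussian (EuclideanSpace ℝ (Fin (N k) × Fin (d k)))) with hE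
  have hmtop : Tendsto m atTop atTop :=
    tendsto_atTop_mono hm tendsto_natCast_atTop_atTop
  have hfc : ∀ {k}, FeatureBounds (N k) (d k) σ φ (S k) L (K * m k ^ 2) →
      Continuous fun w : EuclideanSpace ℝ (Fin (N k) × Fin (d k)) =>
        frob (gramError σ φ (S k) (m k) (weights w)) := fun {k} h =>
    continuous_frob ((h.continuous_sampleGram (m k)).sub continuous_const)
  have hfi : ∀ {k}, FeatureBounds (N k) (d k) σ φ (S k) L (K * m k ^ 2) → ∀ q : ℕ,
      Integrable (fun w : EuclideanSpace ℝ (Fin (N k) × Fin (d k)) =>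
        frob (gramError σ φ (S k) (m k) (weights w)) ^ q)
        (stdGaussian (EuclideanSpace ℝ (Fin (N k) × Fin (d k)))) := fun {k} h q =>
    h.integrable_pow_of_abs_le_frob (m := m k) (A := (N k / m k) • meanGram σ φ (S k)) (c := 1)
      (hfc h) (fun w => by rw [abs_of_nonneg (frob_nonneg _), one_mul]; rfl) q
  have hmean : Tendsto (fun k => E k / ρ k) atTop (𝓝 0) := by
    have hlim : Tendsto (fun k => Real.pi ^ 2 * absMoment 2 * (4 * L ^ 2 * K)
        * (Real.sqrt (m k))⁻¹) atTop (𝓝 0) := by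
      have h1 : Tendsto (fun k => (Real.sqrt (m k))⁻¹) atTop (𝓝 0) :=
        (Real.tendsto_sqrt_atTop.comp hmtop).inv_tendsto_atTop
      simpa using h1.const_mul (Real.pi ^ 2 * absMoment 2 * (4 * L ^ 2 * K))
    have hsq : Tendsto (fun k => (E k / ρ k) ^ 2) atTop (𝓝 0) := by
      refine tendsto_of_tendsto_of_tendsto_of_le_of_le' tendsto_const_nhds hlim
        (Eventually.of_forall fun k => sq_nonneg _) ?_
      filter_upwards [hF, eventually_gt_atTop 0] with k h hk0
      have hmk : 0 < m k := (by exact_mod_cast hk0 : (0 : ℝ) < k).trans_le (hm k)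
      have hs : 0 < Real.sqrt (m k) := Real.sqrt_pos.2 hmk
      have h1 := sq_integral_le (by simpa using hfi h 1) (hfi h 2)
      have h2 := h.integral_frob_sub_sq_le hmk
      have h3 : E k ^ 2 ≤ Real.pi ^ 2 * absMoment 2 * (4 * L ^ 2 * K) * m k := by
        refine (h1.trans h2).trans (le_of_eq ?_)
        rw [hcard]
        field_simp
      have e : ρ k ^ 2 = m k * Real.sqrt (m k) := by
        rw [hρ, mul_pow, Real.sq_sqrt hmk.le, Real.sq_sqrt hs.le]
      rw [div_pow, e, div_le_iff₀ (by positivity)]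
      refine h3.trans (le_of_eq ?_)
      field_simp
    have h4 := hsq.sqrt
    rw [Real.sqrt_zero] at h4
    rw [tendsto_zero_iff_abs_tendsto_zero]
    exact h4.congr fun k => Real.sqrt_sq_eq_abs _
  have hdev : ∀ᵐ ω ∂μ, Tendsto (fun k =>
      (frob (gramError σ φ (S k) (m k) (Wt k ω)) - E k) / ρ k) atTop (𝓝 0) := by
    refine ae_tendsto_zero_of_moment_le (C := Real.pi ^ 4 * absMoment 4 * (L ^ 4 * K ^ 2)) ?_
    filter_upwards [hF, eventually_gt_atTop 0] with k h hk0
    have hk0' : (1 : ℝ) ≤ k := by exact_mod_cast hk0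
    have hmk : 0 < m k := by linarith [hm k]
    have hs : 0 < Real.sqrt (m k) := Real.sqrt_pos.2 hmk
    have hfi' : Integrable (fun w : EuclideanSpace ℝ (Fin (N k) × Fin (d k)) =>
        ((frob (gramError σ φ (S k) (m k) (weights w)) - E k) / ρ k) ^ 4)
        (stdGaussian (EuclideanSpace ℝ (Fin (N k) × Fin (d k)))) := by
      simp only [div_pow]
      refine Integrable.div_const ?_ _
      have e : ∀ x : ℝ, (x - E k) ^ 4 = x ^ 4 - 4 * E k * x ^ 3 + 6 * E k ^ 2 * x ^ 2
          - 4 * E k ^ 3 * x ^ 1 + E k ^ 4 := fun x => by ring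
      simp only [e]
      exact ((((hfi h 4).sub ((hfi h 3).const_mul _)).add ((hfi h 2).const_mul _)).sub
        ((hfi h 1).const_mul _)).add (integrable_const _)
    refine integral_pow_four_of_map (hlaw k) (hindep k)
      (f := fun W => (frob (gramError σ φ (S k) (m k) W) - E k) / ρ k)
      (((hfc h).sub continuous_const).div_const _) hfi' ?_
    have h1 := h.integral_frob_dev_pow_four_le hmk ((N k / m k) • meanGram σ φ (S k))
    simp only [Even.pow_abs (by decide : Even 4)] at h1
    simp only [div_pow]
    rw [integral_div]
    have e : ρ k ^ 4 = m k ^ 3 := by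
      have e1 : ρ k ^ 4 = (Real.sqrt (m k) ^ 2) ^ 2 * (Real.sqrt (Real.sqrt (m k)) ^ 2) ^ 2 := by
        rw [hρ]; ring
      rw [e1, Real.sq_sqrt hs.le, Real.sq_sqrt hmk.le]
      ring
    rw [e, div_le_div_iff₀ (by positivity) (by positivity)]
    have h2 : (L / m k) ^ 4 * (K * m k ^ 2) ^ 2 = L ^ 4 * K ^ 2 := by field_simp
    rw [h2] at h1
    have h3 : (k : ℝ) ^ 2 ≤ m k ^ 3 := by
      have e1 : (k : ℝ) ^ 2 ≤ m k ^ 2 := pow_le_pow_left₀ (by linarith) (hm k) 2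
      have e2 : 1 ≤ m k := hk0'.trans (hm k)
      nlinarith [sq_nonneg (m k)]
    have h4 : 0 ≤ Real.pi ^ 4 * absMoment 4 * (L ^ 4 * K ^ 2) :=
      mul_nonneg (mul_nonneg (by positivity) (absMoment_nonneg 4)) (by positivity)
    exact mul_le_mul h1 h3 (by positivity) h4
  filter_upwards [hdev] with ω hω
  have h := hω.add hmean
  rw [add_zero] at h
  refine h.congr fun k => ?_
  rw [← add_div, sub_add_cancel]

end GramConcentration

/-! ### The resolvent and the empirical error -/

section Comparison

variable {ι κ : Type*} [Fintype ι] [Fintype κ] [DecidableEq ι] [DecidableEq κ]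
  {U E : Matrix ι κ ℝ} {G' : Matrix ι ι ℝ} {α β a b lam : ℝ}

/-- Replacing `G'` by `G` in the regularised residual `lam (Eᵀ G U + lam)⁻¹ r` changes its squared
norm by a bilinear form of `G - G'` at vectors that do not depend on `G`, up to an error that is
quadratic in `G - G'`. -/
lemma residual_comparison (hG' : ∀ x, 0 ≤ x ⬝ᵥ G' *ᵥ x) (hGs' : G'ᵀ = G') (hlam : 0 < lam)
    (hα : 0 < α) (hA : ∀ x, α * vnorm x ^ 2 ≤ x ⬝ᵥ (U * Eᵀ) *ᵥ x) (hβ0 : 0 ≤ β)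
    (hβ : ∀ x, vnorm ((U * Eᵀ) *ᵥ x) ≤ β * vnorm x) (ha : 0 ≤ a)
    (hU : ∀ x, vnorm (Uᵀ *ᵥ x) ≤ a * vnorm x) (hb : 0 ≤ b)
    (hE : ∀ x, vnorm (Eᵀ *ᵥ x) ≤ b * vnorm x) (r : κ → ℝ) :
    ∃ u v : ι → ℝ,
      lam * vnorm v ≤ (1 + β / α) * (a * vnorm r) ∧
      lam * vnorm u ≤ (1 + β / α) * (b * (vnorm r + b * (a * vnorm r / α))) ∧
      ∀ G : Matrix ι ι ℝ, (∀ x, 0 ≤ x ⬝ᵥ G *ᵥ x) →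
        |vnorm (lam • ((Eᵀ * G * U + lam • (1 : Matrix κ κ ℝ))⁻¹ *ᵥ r)) ^ 2
            - vnorm (lam • ((Eᵀ * G' * U + lam • (1 : Matrix κ κ ℝ))⁻¹ *ᵥ r)) ^ 2|
          ≤ 2 * lam * |u ⬝ᵥ (G - G') *ᵥ v|
            + (2 * β * vnorm u * ((1 + β / α) * vnorm v) + (b * ((1 + β / α) * vnorm v)) ^ 2)
              * frob (G - G') ^ 2 := by
  set A := U * Eᵀ with hAdef
  have hq : 0 ≤ 1 + β / α := by positivity
  obtain ⟨t', ht', hr'⟩ := exists_solution_resolvent (isUnit_conj_add_smul hG' hlam hα hA) r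
  have hUr : vnorm (U *ᵥ r) ≤ a * vnorm r := by
    simpa using vnorm_transpose_mulVec_le ha hU r
  have hEr : ∀ y, vnorm (E *ᵥ y) ≤ b * vnorm y := fun y => by
    simpa using vnorm_transpose_mulVec_le hb hE y
  have htb : vnorm t' ≤ a * vnorm r / α := by
    rw [le_div_iff₀ hα, mul_comm]
    exact (coercive_solution_bound hG' hlam hA ht').trans hUr
  have hAT : ∀ x, α * vnorm x ^ 2 ≤ x ⬝ᵥ Aᵀ *ᵥ x := fun x => by
    rw [dotProduct_transpose_mulVec_self]; exact hA x
  have hβT : ∀ x, vnorm (Aᵀ *ᵥ x) ≤ β * vnorm x := vnorm_transpose_mulVec_le hβ0 hβ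
  set f := E *ᵥ (r - Eᵀ *ᵥ t') with hf
  -- the adjoint equation has a solution because `Aᵀ G' + lam` is the transpose of `G' A + lam`
  obtain ⟨u, hu⟩ : ∃ u, lam • u + Aᵀ *ᵥ (G' *ᵥ u) = f := by
    have h1 : IsUnit (Aᵀ * G' + lam • (1 : Matrix ι ι ℝ)) := by
      have h2 := (isUnit_mul_add_smul hG' hlam hα hA)
      have h3 := isUnit_transpose (A := G' * A + lam • (1 : Matrix ι ι ℝ)) |>.2 h2
      rwa [transpose_add, transpose_mul, transpose_smul, transpose_one, hGs'] at h3
    have h4 : ∃ u, (Aᵀ * G' + lam • (1 : Matrix ι ι ℝ)) *ᵥ u = f :=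
      ⟨(Aᵀ * G' + lam • (1 : Matrix ι ι ℝ))⁻¹ *ᵥ f, by
        rw [mulVec_mulVec, mul_inv_of_isUnit h1, one_mulVec]⟩
    obtain ⟨u, hu⟩ := h4
    refine ⟨u, ?_⟩
    rw [← hu, add_smul_one_mulVec, mulVec_mulVec, add_comm]
  set v := lam⁻¹ • (U *ᵥ r - A *ᵥ t') with hv
  have hc : lam • v = U *ᵥ r - A *ᵥ t' := by rw [hv, smul_inv_smul₀ hlam.ne']
  refine ⟨u, v, ?_, ?_, fun G hG => ?_⟩
  · rw [← abs_of_pos hlam, ← vnorm_smul, hc]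
    refine (vnorm_sub_le _ _).trans ?_
    have h1 := (hβ t').trans (mul_le_mul_of_nonneg_left htb hβ0)
    have e : (1 + β / α) * (a * vnorm r) = a * vnorm r + β * (a * vnorm r / α) := by ring
    rw [e]
    exact add_le_add hUr h1
  · refine (resolvent_bound_right hG' hlam hα hAT hβ0 hβT hu).trans
      (mul_le_mul_of_nonneg_left ?_ hq)
    refine (hEr _).trans (mul_le_mul_of_nonneg_left ((vnorm_sub_le _ _).trans ?_) hb)
    exact add_le_add le_rfl ((hE t').trans (mul_le_mul_of_nonneg_left htb hb))
  · obtain ⟨t, ht, hr⟩ := exists_solution_resolvent (isUnit_conj_add_smul hG hlam hα hA) r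
    obtain ⟨h1, h2⟩ := solution_comparison hG hGs' hlam hα hA hβ0 hβ ht ht' hc hu
    rw [hr, hr']
    set e := t - t' with he
    set F := frob (G - G') with hF
    have hF0 : 0 ≤ F := frob_nonneg _
    have e1 : r - Eᵀ *ᵥ t = (r - Eᵀ *ᵥ t') - Eᵀ *ᵥ e := by rw [he, mulVec_sub]; abel
    have e2 : vnorm (r - Eᵀ *ᵥ t) ^ 2 - vnorm (r - Eᵀ *ᵥ t') ^ 2
        = -2 * (f ⬝ᵥ e) + vnorm (Eᵀ *ᵥ e) ^ 2 := by
      have h3 : (r - Eᵀ *ᵥ t') ⬝ᵥ (Eᵀ *ᵥ e) = f ⬝ᵥ e := by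
        rw [dotProduct_mulVec_comm_transpose, transpose_transpose]
      rw [e1, ← h3]
      generalize r - Eᵀ *ᵥ t' = x
      generalize Eᵀ *ᵥ e = y
      rw [← dotProduct_self_eq, ← dotProduct_self_eq, ← dotProduct_self_eq, sub_dotProduct,
        dotProduct_sub, dotProduct_sub, dotProduct_comm y x]
      ring
    rw [e2]
    have h4 : vnorm (Eᵀ *ᵥ e) ^ 2 ≤ (b * ((1 + β / α) * vnorm v)) ^ 2 * F ^ 2 := by
      rw [← mul_pow]
      refine pow_le_pow_left₀ (vnorm_nonneg _) ((hE e).trans ?_) 2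
      refine (mul_le_mul_of_nonneg_left h1 hb).trans (le_of_eq ?_)
      ring
    have h5 : β * F * vnorm u * vnorm e ≤ β * vnorm u * ((1 + β / α) * vnorm v) * F ^ 2 := by
      refine (mul_le_mul_of_nonneg_left h1
        (mul_nonneg (mul_nonneg hβ0 hF0) (vnorm_nonneg u))).trans (le_of_eq ?_)
      ring
    have h6 : |-2 * (f ⬝ᵥ e) + vnorm (Eᵀ *ᵥ e) ^ 2| ≤ 2 * |f ⬝ᵥ e| + vnorm (Eᵀ *ᵥ e) ^ 2 := by
      refine (abs_add_le _ _).trans (le_of_eq ?_)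
      rw [abs_mul, abs_of_nonneg (sq_nonneg (vnorm (Eᵀ *ᵥ e)))]
      norm_num
    linarith

end Comparison

namespace Dataset

variable {d n : ℕ} {M : MRP d} (D : Dataset M n) {σ φ : ℝ → ℝ} {γ lam : ℝ} {N : ℕ}

lemma features_srcStates (hn : 0 < n) (W : Matrix (Fin N) (Fin d) ℝ) :
    features σ φ W D.srcStates = Real.sqrt n • (features σ φ W D.visitedStates * D.U) := by
  have hs : Real.sqrt n ≠ 0 := (Real.sqrt_pos.2 (by exact_mod_cast hn)).ne'
  ext i c
  have h := D.U_transpose_mulVec (features σ φ W D.visitedStates i) c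
  have e : (features σ φ W D.visitedStates * D.U) i c
      = (D.Uᵀ *ᵥ features σ φ W D.visitedStates i) c := by
    rw [mul_apply, mulVec, dotProduct]
    exact Finset.sum_congr rfl fun j _ => mul_comm _ _
  rw [Matrix.smul_apply, e, h, smul_eq_mul, ← mul_assoc, mul_one_div_cancel hs, one_mul]
  rfl

lemma features_dstStates (hn : 0 < n) (W : Matrix (Fin N) (Fin d) ℝ) :
    features σ φ W D.dstStates = Real.sqrt n • (features σ φ W D.visitedStates * D.V) := by
  have hs : Real.sqrt n ≠ 0 := (Real.sqrt_pos.2 (by exact_mod_cast hn)).ne'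
  ext i c
  have h := D.V_transpose_mulVec (features σ φ W D.visitedStates i) c
  have e : (features σ φ W D.visitedStates * D.V) i c
      = (D.Vᵀ *ᵥ features σ φ W D.visitedStates i) c := by
    rw [mul_apply, mulVec, dotProduct]
    exact Finset.sum_congr rfl fun j _ => mul_comm _ _
  rw [Matrix.smul_apply, e, h, smul_eq_mul, ← mul_assoc, mul_one_div_cancel hs, one_mul]
  rfl

lemma resolventMatrix_eq (hn : 0 < n) (W : Matrix (Fin N) (Fin d) ℝ) :
    D.resolventMatrix σ φ γ lam W
      = (D.U - γ • D.V)ᵀ * sampleGram σ φ D.visitedStates D.numVisited W * D.U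
        + lam • (1 : Matrix (Fin n) (Fin n) ℝ) := by
  have hn' : (n : ℝ) ≠ 0 := by exact_mod_cast hn.ne'
  set F := features σ φ W D.visitedStates with hF
  have h1 : features σ φ W D.srcStates - γ • features σ φ W D.dstStates
      = Real.sqrt n • (F * (D.U - γ • D.V)) := by
    rw [D.features_srcStates hn, D.features_dstStates hn, Matrix.mul_sub, Matrix.mul_smul,
      smul_sub, smul_comm γ]
  rw [resolventMatrix, h1, D.features_srcStates hn, ← hF, sampleGram, ← hF]
  congr 1
  rw [transpose_smul, Matrix.smul_mul, Matrix.mul_smul, smul_smul, smul_smul, transpose_mul,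
    Matrix.mul_smul, Matrix.smul_mul]
  have e : 1 / ((D.numVisited : ℝ) * n) * Real.sqrt n * Real.sqrt n = 1 / D.numVisited := by
    rw [mul_assoc, Real.mul_self_sqrt (Nat.cast_nonneg n), one_div_mul_eq_div,
      div_mul_cancel_right₀ hn', one_div]
  rw [e]
  simp only [Matrix.mul_assoc]

section Resolvent

variable {α : ℝ}

lemma isUnit_resolventMatrix (hn : 0 < n) (hlam : 0 < lam) (hα : 0 < α)
    (hA : ∀ x, α * vnorm x ^ 2 ≤ x ⬝ᵥ D.transitionModel γ *ᵥ x) (W : Matrix (Fin N) (Fin d) ℝ) :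
    IsUnit (D.resolventMatrix σ φ γ lam W) := by
  rw [D.resolventMatrix_eq hn]
  exact isUnit_conj_add_smul (sampleGram_nonneg (Nat.cast_nonneg _) W) hlam hα hA

/-- If `θ` solves the regularised normal equations with data `r`, then the resolvent matrix maps the
temporal-difference residual of `θ` to `lam • r`. -/
lemma resolventMatrix_mulVec_residual (hn : 0 < n) {W : Matrix (Fin N) (Fin d) ℝ}
    {θ : Fin N → ℝ} {r : Fin n → ℝ}
    (hθ : D.lstdMatrix σ φ γ (lam * (D.numVisited * n)) W *ᵥ θ
      = features σ φ W D.srcStates *ᵥ r) :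
    D.resolventMatrix σ φ γ lam W *ᵥ (r - (features σ φ W D.srcStates
      - γ • features σ φ W D.dstStates)ᵀ *ᵥ θ) = lam • r := by
  have hmn : ((D.numVisited : ℝ) * n) ≠ 0 :=
    mul_ne_zero (by exact_mod_cast (D.numVisited_pos hn).ne') (by exact_mod_cast hn.ne')
  set Fs := features σ φ W D.srcStates with hFs
  set H := Fs - γ • features σ φ W D.dstStates with hH
  rw [lstdMatrix, ← hFs, ← hH, add_smul_one_mulVec, ← mulVec_mulVec] at hθ
  have h1 : Fs *ᵥ (r - Hᵀ *ᵥ θ) = (lam * (D.numVisited * n)) • θ := by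
    rw [mulVec_sub, ← hθ]; abel
  rw [resolventMatrix, ← hFs, ← hH, add_smul_one_mulVec, smul_mulVec, ← mulVec_mulVec, h1,
    mulVec_smul, smul_smul, smul_sub, one_div, mul_comm lam, inv_mul_cancel_left₀ hmn]
  abel

lemma isUnit_lstdMatrix (hn : 0 < n) (hlam : 0 < lam) (hα : 0 < α)
    (hA : ∀ x, α * vnorm x ^ 2 ≤ x ⬝ᵥ D.transitionModel γ *ᵥ x) (W : Matrix (Fin N) (Fin d) ℝ) :
    IsUnit (D.lstdMatrix σ φ γ (lam * (D.numVisited * n)) W) := by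
  have hmn : 0 < (D.numVisited : ℝ) * n :=
    mul_pos (by exact_mod_cast D.numVisited_pos hn) (by exact_mod_cast hn)
  refine isUnit_of_mulVec_eq_zero fun θ hθ => ?_
  have h1 : D.lstdMatrix σ φ γ (lam * (D.numVisited * n)) W *ᵥ θ
      = features σ φ W D.srcStates *ᵥ 0 := by rw [hθ, mulVec_zero]
  have h2 := D.resolventMatrix_mulVec_residual hn h1
  rw [smul_zero, zero_sub] at h2
  have h3 := congrArg (fun x => (D.resolventMatrix σ φ γ lam W)⁻¹ *ᵥ x) h2
  simp only [mulVec_mulVec, inv_mul_of_isUnit (D.isUnit_resolventMatrix hn hlam hα hA W),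
    one_mulVec, mulVec_zero, neg_eq_zero] at h3
  rw [lstdMatrix, add_smul_one_mulVec, ← mulVec_mulVec, h3, mulVec_zero, zero_add] at hθ
  exact (smul_eq_zero.1 hθ).resolve_left (mul_pos hlam hmn).ne'

/-- The empirical MSBE of regularised LSTD is a quadratic form of the resolvent. -/
lemma empiricalMSBE_lstd (hn : 0 < n) (hlam : 0 < lam) (hα : 0 < α)
    (hA : ∀ x, α * vnorm x ^ 2 ≤ x ⬝ᵥ D.transitionModel γ *ᵥ x) (W : Matrix (Fin N) (Fin d) ℝ) :
    D.empiricalMSBE σ φ γ W (D.lstd σ φ γ (lam * (D.numVisited * n)) W)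
      = lam ^ 2 / n * sqNorm (D.resolvent σ φ γ lam W *ᵥ D.rewards) := by
  set θ := D.lstd σ φ γ (lam * (D.numVisited * n)) W with hθ
  have h1 : D.lstdMatrix σ φ γ (lam * (D.numVisited * n)) W *ᵥ θ
      = features σ φ W D.srcStates *ᵥ D.rewards := by
    rw [hθ, lstd, mulVec_mulVec, mul_inv_of_isUnit (D.isUnit_lstdMatrix hn hlam hα hA W),
      one_mulVec]
  have h2 := D.resolventMatrix_mulVec_residual hn h1
  have h3 := congrArg (fun x => (D.resolventMatrix σ φ γ lam W)⁻¹ *ᵥ x) h2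
  simp only [mulVec_mulVec, inv_mul_of_isUnit (D.isUnit_resolventMatrix hn hlam hα hA W),
    one_mulVec, mulVec_smul] at h3
  have h4 : D.rewards + γ • ((features σ φ W D.dstStates)ᵀ *ᵥ θ)
      - (features σ φ W D.srcStates)ᵀ *ᵥ θ
      = lam • (D.resolvent σ φ γ lam W *ᵥ D.rewards) := by
    rw [resolvent, ← h3, transpose_sub, transpose_smul, sub_mulVec, smul_mulVec]
    abel
  rw [empiricalMSBE, h4, sqNorm_eq, sqNorm_eq, vnorm_smul, mul_pow, sq_abs]
  ring

end Resolvent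

end Dataset

/-! ### The correction factors -/

open scoped MatrixOrder Matrix.Norms.L2Operator in
lemma exists_eq_transpose_mul_self {ι : Type*} [Fintype ι] [DecidableEq ι] {G : Matrix ι ι ℝ}
    (hs : Gᵀ = G) (h : ∀ x, 0 ≤ x ⬝ᵥ G *ᵥ x) : ∃ B : Matrix ι ι ℝ, G = Bᵀ * B := by
  have hp : G.PosSemidef := PosSemidef.of_dotProduct_mulVec_nonneg
    (by rw [IsHermitian, conjTranspose_eq_transpose_of_trivial, hs]) fun x => by
      rw [star_trivial]; exact h x
  obtain ⟨B, hB⟩ := CStarAlgebra.nonneg_iff_eq_star_mul_self.1 hp.nonneg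
  exact ⟨B, by rwa [star_eq_conjTranspose, conjTranspose_eq_transpose_of_trivial] at hB⟩

lemma mul_frob_sq_le_trace_conj {ι κ : Type*} [Fintype ι] [Fintype κ] [DecidableEq ι]
    {A : Matrix ι ι ℝ} {α : ℝ} (hA : ∀ x, α * vnorm x ^ 2 ≤ x ⬝ᵥ A *ᵥ x) (Y : Matrix ι κ ℝ) :
    α * frob Y ^ 2 ≤ (Yᵀ * A * Y).trace := by
  have h := trace_conj_nonneg (P := A - α • (1 : Matrix ι ι ℝ)) (fun x => by
    rw [sub_mulVec, smul_mulVec, one_mulVec, dotProduct_sub, dotProduct_smul, dotProduct_self_eq,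
      smul_eq_mul]
    linarith [hA x]) Y
  rw [Matrix.mul_sub, Matrix.sub_mul, trace_sub, Matrix.mul_smul, Matrix.smul_mul, Matrix.mul_one,
    trace_smul, ← frob_sq_eq_trace, smul_eq_mul] at h
  linarith

namespace Dataset

variable {d n : ℕ} {M : MRP d} (D : Dataset M n) {σ φ : ℝ → ℝ} {γ lam : ℝ} {N : ℕ}
  {α δ : ℝ} {B : Matrix D.visited D.visited ℝ}

lemma scaling_nonneg (hδ : 0 ≤ δ) : 0 ≤ D.scaling N δ := by
  rw [scaling]; positivity

lemma isUnit_detResolventMatrix (hlam : 0 < lam) (hα : 0 < α)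
    (hA : ∀ x, α * vnorm x ^ 2 ≤ x ⬝ᵥ D.transitionModel γ *ᵥ x)
    (hG : ∀ x, 0 ≤ x ⬝ᵥ D.gram σ φ *ᵥ x) (hδ : 0 ≤ δ) :
    IsUnit (D.detResolventMatrix σ φ γ lam N δ) := by
  have h := isUnit_conj_add_smul (U := D.U) (E := D.U - γ • D.V) (G := D.scaling N δ • D.gram σ φ)
    (fun x => by
      rw [smul_mulVec, dotProduct_smul]; exact mul_nonneg (D.scaling_nonneg hδ) (hG x)) hlam hα hA
  rwa [Matrix.mul_smul, Matrix.smul_mul] at h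

lemma detResolventMatrix_eq (hB : D.gram σ φ = Bᵀ * B) :
    D.detResolventMatrix σ φ γ lam N δ
      = D.scaling N δ • ((D.U - γ • D.V)ᵀ * (Bᵀ * B) * D.U)
        + lam • (1 : Matrix (Fin n) (Fin n) ℝ) := by
  rw [detResolventMatrix, hB]

/-- The regularised inverse of `B A Bᵀ`, where `Bᵀ B = Φ` and `A` is the transition model; it
represents the deterministic resolvent on the visited states. -/
def innerResolvent (γ lam : ℝ) (N : ℕ) (δ : ℝ) (B : Matrix D.visited D.visited ℝ) :
    Matrix D.visited D.visited ℝ :=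
  (D.scaling N δ • (B * D.transitionModel γ * Bᵀ)
    + lam • (1 : Matrix D.visited D.visited ℝ))⁻¹

lemma nonneg_of_coercive {ι : Type*} [Fintype ι] {A : Matrix ι ι ℝ} (hα : 0 < α)
    (hA : ∀ x, α * vnorm x ^ 2 ≤ x ⬝ᵥ A *ᵥ x) (x : ι → ℝ) : 0 ≤ x ⬝ᵥ A *ᵥ x :=
  (by positivity : 0 ≤ α * vnorm x ^ 2).trans (hA x)

lemma gram_nonneg_of_eq (hB : D.gram σ φ = Bᵀ * B) (x : D.visited → ℝ) :
    0 ≤ x ⬝ᵥ D.gram σ φ *ᵥ x := by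
  rw [hB, ← mulVec_mulVec, dotProduct_mulVec_comm_transpose, transpose_transpose,
    dotProduct_self_eq]
  positivity

/-- The equation of the correction factor, in terms of the accretive matrix `B A Bᵀ`. -/
lemma isCorrectionFactor_iff (hlam : 0 < lam) (hα : 0 < α)
    (hA : ∀ x, α * vnorm x ^ 2 ≤ x ⬝ᵥ D.transitionModel γ *ᵥ x) (hB : D.gram σ φ = Bᵀ * B) :
    D.IsCorrectionFactor σ φ γ lam N δ ↔ 0 ≤ δ ∧ δ = 1 / (D.numVisited : ℝ) *
      (B * D.transitionModel γ * Bᵀ * D.innerResolvent γ lam N δ B).trace := by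
  refine and_congr_right fun hδ => ?_
  have hM := D.isUnit_detResolventMatrix (N := N) hlam hα hA (D.gram_nonneg_of_eq hB) hδ
  rw [D.detResolventMatrix_eq hB] at hM
  have h := trace_push (D.scaling_nonneg hδ) hlam (nonneg_of_coercive hα hA) hM
  rw [detResolvent, D.detResolventMatrix_eq hB, hB, h]
  rfl

lemma existsUnique_isCorrectionFactor (hn : 0 < n) (hN : 0 < N) (hlam : 0 < lam) (hα : 0 < α)
    (hA : ∀ x, α * vnorm x ^ 2 ≤ x ⬝ᵥ D.transitionModel γ *ᵥ x) (hB : D.gram σ φ = Bᵀ * B) :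
    ∃! δ : ℝ, D.IsCorrectionFactor σ φ γ lam N δ := by
  have hm : (0 : ℝ) < D.numVisited := by exact_mod_cast D.numVisited_pos hn
  have hc : (0 : ℝ) < N / D.numVisited := div_pos (by exact_mod_cast hN) hm
  simp only [D.isCorrectionFactor_iff hlam hα hA hB]
  exact existsUnique_fixedPoint (conj_nonneg (nonneg_of_coercive hα hA) B) hc hlam hm

lemma numVisited_mul_correctionFactor (hn : 0 < n) (hlam : 0 < lam) (hα : 0 < α)
    (hA : ∀ x, α * vnorm x ^ 2 ≤ x ⬝ᵥ D.transitionModel γ *ᵥ x) (hB : D.gram σ φ = Bᵀ * B)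
    (hδ : D.IsCorrectionFactor σ φ γ lam N δ) :
    D.numVisited * δ
      = (B * D.transitionModel γ * Bᵀ * D.innerResolvent γ lam N δ B).trace := by
  have hm : (0 : ℝ) < D.numVisited := by exact_mod_cast D.numVisited_pos hn
  have h := ((D.isCorrectionFactor_iff hlam hα hA hB).1 hδ).2
  rw [one_div_mul_eq_div, eq_div_iff hm.ne', mul_comm] at h
  exact h

lemma correctionFactor_pos (hn : 0 < n) (hlam : 0 < lam) (hα : 0 < α)
    (hA : ∀ x, α * vnorm x ^ 2 ≤ x ⬝ᵥ D.transitionModel γ *ᵥ x) (hB : D.gram σ φ = Bᵀ * B)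
    (hδ : D.IsCorrectionFactor σ φ γ lam N δ) (hG : D.gram σ φ ≠ 0) : 0 < δ := by
  have hA0 := nonneg_of_coercive hα hA
  have hc := D.scaling_nonneg (N := N) hδ.1
  refine lt_of_le_of_ne hδ.1 fun h0 => hG ?_
  have h1 := D.numVisited_mul_correctionFactor hn hlam hα hA hB hδ
  rw [← h0, mul_zero, innerResolvent,
    trace_mul_inv_eq (conj_nonneg hA0 B) (D.scaling_nonneg le_rfl) hlam] at h1
  set X := (D.scaling N 0 • (B * D.transitionModel γ * Bᵀ)
    + lam • (1 : Matrix D.visited D.visited ℝ))⁻¹ with hX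
  have h2 := mul_frob_sq_le_trace_conj hA (Bᵀ * X)
  have e : (Bᵀ * X)ᵀ * D.transitionModel γ * (Bᵀ * X)
      = Xᵀ * (B * D.transitionModel γ * Bᵀ) * X := by
    rw [transpose_mul, transpose_transpose]
    simp only [Matrix.mul_assoc]
  rw [e] at h2
  have h3 : 0 ≤ D.scaling N 0 * frob (B * D.transitionModel γ * Bᵀ * X) ^ 2 :=
    mul_nonneg (D.scaling_nonneg le_rfl) (sq_nonneg _)
  have h4 : 0 ≤ α * frob (Bᵀ * X) ^ 2 := by positivity
  have h5 : α * frob (Bᵀ * X) ^ 2 = 0 := by nlinarith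
  have h6 : Bᵀ * X = 0 := by
    refine frob_eq_zero.1 (pow_eq_zero_iff two_ne_zero |>.1 ?_)
    exact (mul_eq_zero.1 h5).resolve_left hα.ne'
  have h7 : Bᵀ = 0 := by
    have h8 := inv_mul_of_isUnit (isUnit_accretive_add (conj_nonneg hA0 B)
      (D.scaling_nonneg (N := N) le_rfl) hlam)
    rw [← hX] at h8
    rw [← Matrix.mul_one Bᵀ, ← h8, ← Matrix.mul_assoc, h6, Matrix.zero_mul]
  rw [hB, h7, Matrix.zero_mul]

/-- The denominator of the second-order correction is at least `1 / (1 + δ)`. -/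
lemma inv_le_correctionDenom (hn : 0 < n) (hN : 0 < N) (hlam : 0 < lam) (hα : 0 < α)
    (hA : ∀ x, α * vnorm x ^ 2 ≤ x ⬝ᵥ D.transitionModel γ *ᵥ x) (hB : D.gram σ φ = Bᵀ * B)
    (hδ : D.IsCorrectionFactor σ φ γ lam N δ) :
    1 / (1 + δ) ≤ D.correctionDenom σ φ γ lam N δ := by
  have hA0 := nonneg_of_coercive hα hA
  have hc := D.scaling_nonneg (N := N) hδ.1
  have hm : (0 : ℝ) < D.numVisited := by exact_mod_cast D.numVisited_pos hn
  have hN' : (0 : ℝ) < N := by exact_mod_cast hN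
  have hδ1 : 0 < 1 + δ := by linarith [hδ.1]
  have hM := D.isUnit_detResolventMatrix (N := N) hlam hα hA (D.gram_nonneg_of_eq hB) hδ.1
  rw [D.detResolventMatrix_eq hB] at hM
  have h1 := D.numVisited_mul_correctionFactor hn hlam hα hA hB hδ
  rw [innerResolvent, trace_mul_inv_eq (conj_nonneg hA0 B) hc hlam] at h1
  have h2 := trace_conj_nonneg (conj_nonneg hA0 B) (D.scaling N δ • (B * D.transitionModel γ * Bᵀ)
    + lam • (1 : Matrix D.visited D.visited ℝ))⁻¹
  have h3 := trace_second_order hc hlam hA0 hM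
  rw [correctionDenom, Psi1, Psi2, detResolvent, D.detResolventMatrix_eq hB, hB]
  change _ ≤ 1 - 1 / (N : ℝ) * (((D.scaling N δ • ((D.U - γ • D.V)ᵀ * (Bᵀ * B)
    * (D.U - γ • D.V))) * _ * _ * _)).trace
  rw [h3]
  change _ ≤ 1 - 1 / (N : ℝ) * (D.scaling N δ ^ 2 * frob (B * D.transitionModel γ * Bᵀ * _) ^ 2)
  set F := frob (B * D.transitionModel γ * Bᵀ * (D.scaling N δ • (B * D.transitionModel γ * Bᵀ)
    + lam • (1 : Matrix D.visited D.visited ℝ))⁻¹)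
  have h4 : D.scaling N δ * F ^ 2 ≤ D.numVisited * δ := by
    rw [h1]
    have := mul_nonneg hlam.le h2
    linarith
  have h5 : 1 / (N : ℝ) * (D.scaling N δ ^ 2 * F ^ 2) ≤ δ / (1 + δ) := by
    have h6 := mul_le_mul_of_nonneg_left h4 (mul_nonneg (one_div_nonneg.2 hN'.le) hc)
    calc 1 / (N : ℝ) * (D.scaling N δ ^ 2 * F ^ 2)
        = 1 / (N : ℝ) * D.scaling N δ * (D.scaling N δ * F ^ 2) := by ring
      _ ≤ _ := h6
      _ = δ / (1 + δ) := by rw [scaling]; field_simp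
  have h7 : 1 - δ / (1 + δ) = 1 / (1 + δ) := by field_simp; ring
  exact h7.symm.le.trans (sub_le_sub_left h5 1)

lemma vnorm_innerResolvent_mulVec_le (hlam : 0 < lam) (hα : 0 < α)
    (hA : ∀ x, α * vnorm x ^ 2 ≤ x ⬝ᵥ D.transitionModel γ *ᵥ x) (hδ : 0 ≤ δ)
    (v : D.visited → ℝ) :
    vnorm (D.innerResolvent γ lam N δ B *ᵥ v) ≤ 1 / lam * vnorm v :=
  vnorm_inv_mulVec_le (conj_nonneg (nonneg_of_coercive hα hA) B) (D.scaling_nonneg hδ) hlam v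

lemma frob_mul_innerResolvent_le (hlam : 0 < lam) (hα : 0 < α)
    (hA : ∀ x, α * vnorm x ^ 2 ≤ x ⬝ᵥ D.transitionModel γ *ᵥ x) (hδ : 0 ≤ δ) :
    frob (Bᵀ * D.innerResolvent γ lam N δ B) ≤ 1 / lam * frob B := by
  rw [← frob_transpose, transpose_mul, transpose_transpose]
  exact frob_mul_le_of_bound (vnorm_transpose_mulVec_le (by positivity)
    (D.vnorm_innerResolvent_mulVec_le hlam hα hA hδ)) (by positivity) B

lemma trace_gram_eq (hB : D.gram σ φ = Bᵀ * B) : (D.gram σ φ).trace = frob B ^ 2 := by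
  rw [hB, frob_sq_eq_trace]

lemma frob_gram_le (hB : D.gram σ φ = Bᵀ * B) : frob (D.gram σ φ) ≤ (D.gram σ φ).trace := by
  rw [D.trace_gram_eq hB, hB, sq]
  refine (frob_mul_le _ _).trans (le_of_eq ?_)
  rw [frob_transpose]

/-- The correction factor inherits the smallness of the norm `β` of the transition model:
for `β` of order `1 / m` and `tr Φ` of order `m` it is of order `1 / m`. -/
lemma correctionFactor_le (hn : 0 < n) (hlam : 0 < lam) (hα : 0 < α)
    (hA : ∀ x, α * vnorm x ^ 2 ≤ x ⬝ᵥ D.transitionModel γ *ᵥ x) (hB : D.gram σ φ = Bᵀ * B)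
    (hδ : D.IsCorrectionFactor σ φ γ lam N δ) {β : ℝ} (hβ0 : 0 ≤ β)
    (hβ : ∀ x, vnorm (D.transitionModel γ *ᵥ x) ≤ β * vnorm x) :
    D.numVisited * δ ≤ β * (D.gram σ φ).trace / lam := by
  rw [D.numVisited_mul_correctionFactor hn hlam hα hA hB hδ, D.trace_gram_eq hB]
  have e : (B * D.transitionModel γ * Bᵀ * D.innerResolvent γ lam N δ B).trace
      = (B * (D.transitionModel γ * (Bᵀ * D.innerResolvent γ lam N δ B))).trace := by
    simp only [Matrix.mul_assoc]
  rw [e]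
  refine (le_abs_self _).trans ((abs_trace_mul_le _ _).trans ?_)
  have h1 := frob_mul_le_of_bound hβ hβ0 (Bᵀ * D.innerResolvent γ lam N δ B)
  have h2 := mul_le_mul_of_nonneg_left
    (D.frob_mul_innerResolvent_le (N := N) (B := B) hlam hα hA hδ.1) hβ0
  refine (mul_le_mul_of_nonneg_left (h1.trans h2) (frob_nonneg B)).trans (le_of_eq ?_)
  ring

/-- The second-order correction is nonnegative and vanishes with the norm `ε` of `Û - γ V̂`. -/
lemma secondOrderCorrection_bounds (hn : 0 < n) (hN : 0 < N) (hlam : 0 < lam) (hα : 0 < α)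
    (hA : ∀ x, α * vnorm x ^ 2 ≤ x ⬝ᵥ D.transitionModel γ *ᵥ x) (hB : D.gram σ φ = Bᵀ * B)
    (hδ : D.IsCorrectionFactor σ φ γ lam N δ) {ε : ℝ} (hε0 : 0 ≤ ε)
    (hε : ∀ x, vnorm ((D.U - γ • D.V)ᵀ *ᵥ x) ≤ ε * vnorm x) :
    0 ≤ D.secondOrderCorrection σ φ γ lam N δ ∧
      D.secondOrderCorrection σ φ γ lam N δ
        ≤ N / D.numVisited ^ 2 * (ε * (D.gram σ φ).trace / lam) ^ 2
          * (vnorm (D.U *ᵥ D.rewards) ^ 2 / n) := by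
  have hA0 := nonneg_of_coercive hα hA
  have hm : (0 : ℝ) < D.numVisited := by exact_mod_cast D.numVisited_pos hn
  have hN' : (0 : ℝ) < N := by exact_mod_cast hN
  have hn' : (0 : ℝ) < n := by exact_mod_cast hn
  have hδ1 : 0 < 1 + δ := by linarith [hδ.1]
  have hc := D.scaling_nonneg (N := N) hδ.1
  have hM := D.isUnit_detResolventMatrix (N := N) hlam hα hA (D.gram_nonneg_of_eq hB) hδ.1
  have hden := D.inv_le_correctionDenom hn hN hlam hα hA hB hδ
  have hden0 : 0 < D.correctionDenom σ φ γ lam N δ :=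
    (by positivity : 0 < 1 / (1 + δ)).trans_le hden
  have hMd := D.detResolventMatrix_eq (γ := γ) (lam := lam) (N := N) (δ := δ) hB
  have hM' := hM
  rw [hMd] at hM'
  set E := D.U - γ • D.V with hE
  set X := D.innerResolvent γ lam N δ B with hX
  set Q := D.detResolvent σ φ γ lam N δ with hQ
  set c := D.scaling N δ with hcdef
  have hQE : Q * (Eᵀ * Bᵀ) = Eᵀ * Bᵀ * X := by
    have h := inv_mul_push (B := B) (U := D.U) (E := E) hc hlam hA0 hM'
    rw [← hMd] at h
    exact h
  have hBQ : B * D.U * Q = X * (B * D.U) := by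
    have h := mul_inv_push (B := B) (U := D.U) (E := E) hc hlam hA0 hM'
    rw [← hMd] at h
    exact h
  -- the numerator
  have hnum : (Q * D.Psi2 σ φ γ N δ * Qᵀ).trace = c * frob (Eᵀ * (Bᵀ * X)) ^ 2 := by
    have e : Q * D.Psi2 σ φ γ N δ * Qᵀ = c • ((Eᵀ * (Bᵀ * X)) * (Eᵀ * (Bᵀ * X))ᵀ) := by
      have e1 : Eᵀ * (Bᵀ * X) = Q * (Eᵀ * Bᵀ) := by rw [hQE, Matrix.mul_assoc]
      rw [e1, Psi2, hB, ← hE, ← hcdef, transpose_mul, transpose_mul, transpose_transpose,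
        transpose_transpose, Matrix.mul_smul, Matrix.smul_mul]
      simp only [Matrix.mul_assoc]
    rw [e, trace_smul, smul_eq_mul, ← frob_transpose (Eᵀ * (Bᵀ * X)), frob_sq_eq_trace,
      transpose_transpose]
  have hnum_le : frob (Eᵀ * (Bᵀ * X)) ≤ ε * (1 / lam * frob B) :=
    (frob_mul_le_of_bound hε hε0 _).trans (mul_le_mul_of_nonneg_left
      (D.frob_mul_innerResolvent_le (N := N) (B := B) hlam hα hA hδ.1) hε0)
  -- the quadratic form of the rewards
  have hquad : sqNormWith (D.Psi1 σ φ N δ) (Q *ᵥ D.rewards)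
      = c * vnorm (X *ᵥ (B *ᵥ (D.U *ᵥ D.rewards))) ^ 2 := by
    have e1 : X *ᵥ (B *ᵥ (D.U *ᵥ D.rewards)) = (B * D.U) *ᵥ (Q *ᵥ D.rewards) := by
      rw [mulVec_mulVec, mulVec_mulVec, mulVec_mulVec, hBQ, Matrix.mul_assoc]
    have e2 : D.Uᵀ * (Bᵀ * B) * D.U = (B * D.U)ᵀ * (B * D.U) := by
      rw [transpose_mul]; simp only [Matrix.mul_assoc]
    rw [e1, sqNormWith, Psi1, hB, e2, smul_mulVec, dotProduct_smul, smul_eq_mul, ← mulVec_mulVec,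
      dotProduct_mulVec_comm_transpose, transpose_transpose, dotProduct_self_eq]
  have hquad_le : vnorm (X *ᵥ (B *ᵥ (D.U *ᵥ D.rewards)))
      ≤ 1 / lam * (frob B * vnorm (D.U *ᵥ D.rewards)) :=
    (D.vnorm_innerResolvent_mulVec_le hlam hα hA hδ.1 _).trans
      (mul_le_mul_of_nonneg_left (vnorm_mulVec_le _ _) (by positivity))
  set x := frob (Eᵀ * (Bᵀ * X)) with hx
  set y := vnorm (X *ᵥ (B *ᵥ (D.U *ᵥ D.rewards))) with hy
  have hx0 : 0 ≤ x := frob_nonneg _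
  have hy0 : 0 ≤ y := vnorm_nonneg _
  have hΔ : D.secondOrderCorrection σ φ γ lam N δ
      = lam ^ 2 / n * ((1 / (N : ℝ) * (c * x ^ 2)) / D.correctionDenom σ φ γ lam N δ)
        * (c * y ^ 2) := by
    rw [secondOrderCorrection, ← hQ, hnum, hquad]
  rw [hΔ]
  refine ⟨by positivity, ?_⟩
  have h1 : 1 / (N : ℝ) * (c * x ^ 2) / D.correctionDenom σ φ γ lam N δ
      ≤ 1 / D.numVisited * x ^ 2 := by
    rw [div_le_iff₀ hden0]
    have h2 : 1 / (N : ℝ) * (c * x ^ 2) = 1 / D.numVisited * x ^ 2 * (1 / (1 + δ)) := by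
      rw [hcdef, scaling]; field_simp
    rw [h2]
    exact mul_le_mul_of_nonneg_left hden (by positivity)
  have h3 : c ≤ N / D.numVisited := by
    rw [hcdef, scaling]
    refine mul_le_of_le_one_right (by positivity) ?_
    rw [div_le_one hδ1]
    linarith [hδ.1]
  have hb := frob_nonneg B
  have hu := vnorm_nonneg (D.U *ᵥ D.rewards)
  calc lam ^ 2 / n * (1 / (N : ℝ) * (c * x ^ 2) / D.correctionDenom σ φ γ lam N δ) * (c * y ^ 2)
      ≤ lam ^ 2 / n * (1 / D.numVisited * (ε * (1 / lam * frob B)) ^ 2)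
        * (N / D.numVisited * (1 / lam * (frob B * vnorm (D.U *ᵥ D.rewards))) ^ 2) := by
        gcongr
        exact h1.trans (by gcongr)
    _ = _ := by
        rw [D.trace_gram_eq hB]
        field_simp

end Dataset

/-! ### The deterministic equivalent -/

lemma vnorm_mulVec_le_opNorm {p q : ℕ} (A : Matrix (Fin p) (Fin q) ℝ) (x : Fin q → ℝ) :
    vnorm (A *ᵥ x) ≤ opNorm A * vnorm x :=
  ContinuousLinearMap.le_opNorm (LinearMap.toContinuousLinearMap (Matrix.toLpLin 2 2 A))
    (WithLp.toLp 2 x)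

namespace Dataset

variable {d n : ℕ} {M : MRP d} (D : Dataset M n) {σ φ : ℝ → ℝ} {γ lam : ℝ} {N : ℕ}

lemma vnorm_visitedStates_transpose_le (x : Fin d → ℝ) :
    vnorm (D.visitedStatesᵀ *ᵥ x) ≤ opNorm M.state * vnorm x := by
  have h0 : 0 ≤ opNorm M.state := norm_nonneg _
  refine le_trans ?_ (vnorm_transpose_mulVec_le h0 (vnorm_mulVec_le_opNorm M.state) x)
  refine (pow_le_pow_iff_left₀ (vnorm_nonneg _) (vnorm_nonneg _) two_ne_zero).1 ?_
  rw [vnorm_sq, vnorm_sq]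
  have e : ∑ j : D.visited, (D.visitedStatesᵀ *ᵥ x) j ^ 2
      = ∑ j ∈ D.visited, (M.stateᵀ *ᵥ x) j ^ 2 :=
    Finset.sum_coe_sort D.visited fun j => (M.stateᵀ *ᵥ x) j ^ 2
  rw [e]
  exact Finset.sum_le_univ_sum_of_nonneg fun j => sq_nonneg _

lemma vnorm_rewards_le {R : ℝ} (hn : 0 < n) (hR : ∀ j l, |M.reward j l| ≤ R) :
    vnorm ((Real.sqrt n)⁻¹ • D.rewards) ≤ R := by
  have hn' : (0 : ℝ) < n := by exact_mod_cast hn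
  have hR0 : 0 ≤ R := (abs_nonneg _).trans (hR (D.src ⟨0, hn⟩) (D.src ⟨0, hn⟩))
  refine (pow_le_pow_iff_left₀ (vnorm_nonneg _) hR0 two_ne_zero).1 ?_
  rw [vnorm_smul, mul_pow, vnorm_sq, sq_abs, inv_pow, Real.sq_sqrt hn'.le, inv_mul_le_iff₀ hn']
  calc ∑ i, D.rewards i ^ 2 ≤ ∑ _i : Fin n, R ^ 2 :=
        Finset.sum_le_sum fun i _ => sq_le_sq' (abs_le.1 (hR _ _)).1 (abs_le.1 (hR _ _)).2
    _ = n * R ^ 2 := by simp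

lemma scaled_sqNorm_eq (Q : Matrix (Fin n) (Fin n) ℝ) (r : Fin n → ℝ) :
    lam ^ 2 / n * sqNorm (Q *ᵥ r) = vnorm (lam • (Q *ᵥ ((Real.sqrt n)⁻¹ • r))) ^ 2 := by
  rw [sqNorm_eq, mulVec_smul, vnorm_smul, vnorm_smul, mul_pow, mul_pow, sq_abs, sq_abs, inv_pow,
    Real.sq_sqrt (Nat.cast_nonneg n)]
  ring

set_option maxHeartbeats 1600000 in
/-- The deterministic equivalent at a fixed problem, with constants that depend on the problem only
through the bounds of its data. The error of LSTD and the first term of its deterministic equivalent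
are the squared norms of the residuals for the sample Gram matrix and for `Φ` scaled by
`(N / m) / (1 + δ)`; the difference of these two matrices is the Gram fluctuation plus a multiple of
`Φ` of bounded norm, since `δ` is of order `1 / m`. -/
lemma exists_abs_empiricalMSBE_sub_le (hlam : 0 < lam) {K C R : ℝ} (hK : 1 ≤ K) (hC : 0 ≤ C)
    (hR : 0 ≤ R) :
    ∃ A : ℝ, ∀ {d n N : ℕ} {M : MRP d} (D : Dataset M n) {σ φ : ℝ → ℝ} {α δ : ℝ}
      {B : Matrix D.visited D.visited ℝ},
      0 < n → 0 < N → 0 < α → 1 / (K * D.numVisited) ≤ α →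
      (∀ x, α * vnorm x ^ 2 ≤ x ⬝ᵥ D.transitionModel γ *ᵥ x) →
      (∀ x, vnorm (D.transitionModel γ *ᵥ x) ≤ K / D.numVisited * vnorm x) →
      (∀ x, vnorm (D.Uᵀ *ᵥ x) ^ 2 ≤ K / D.numVisited * vnorm x ^ 2) →
      (∀ x, vnorm ((D.U - γ • D.V)ᵀ *ᵥ x) ^ 2 ≤ K / Real.sqrt D.numVisited * vnorm x ^ 2) →
      D.gram σ φ = Bᵀ * B → D.IsCorrectionFactor σ φ γ lam N δ →
      N ≤ C * D.numVisited → (D.gram σ φ).trace ≤ C * D.numVisited →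
      (∀ j l, |M.reward j l| ≤ R) →
      ∃ u v : D.visited → ℝ, vnorm u * vnorm v ≤ A / Real.sqrt D.numVisited ∧
        ∀ W : Matrix (Fin N) (Fin d) ℝ,
          |D.empiricalMSBE σ φ γ W (D.lstd σ φ γ (lam * (D.numVisited * n)) W)
              - D.detEmpiricalMSBE σ φ γ lam N δ|
            ≤ A * (|u ⬝ᵥ gramError σ φ D.visitedStates D.numVisited W *ᵥ v|
              + (frob (gramError σ φ D.visitedStates D.numVisited W)
                / (Real.sqrt D.numVisited * Real.sqrt (Real.sqrt D.numVisited))) ^ 2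
              + 1 / Real.sqrt D.numVisited) := by
  have hK0 : 0 ≤ K := by linarith
  set k₀ := Real.sqrt K with hk₀
  have hk₀0 : 0 ≤ k₀ := Real.sqrt_nonneg K
  have hk₀2 : k₀ ^ 2 = K := Real.sq_sqrt hK0
  set q := 1 + K ^ 2 with hq
  have hq0 : 0 ≤ q := by positivity
  set Vc := q * (k₀ * R) / lam with hVc
  have hVc0 : 0 ≤ Vc := by positivity
  set Uc := q * (k₀ * R * q) / lam with hUc
  have hUc0 : 0 ≤ Uc := by positivity
  set D₁ := K * C ^ 3 / lam with hD₁
  have hD₁0 : 0 ≤ D₁ := by positivity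
  set C₂ := 2 * K * Uc * (q * Vc) + (k₀ * (q * Vc)) ^ 2 with hC₂
  have hC₂0 : 0 ≤ C₂ := by positivity
  set C₃ := C ^ 3 * K ^ 2 * R ^ 2 / lam ^ 2 with hC₃
  have hC₃0 : 0 ≤ C₃ := by positivity
  set A := Uc * Vc + 2 * lam + 2 * lam * (D₁ * (Uc * Vc)) + 2 * C₂ + 2 * C₂ * D₁ ^ 2 + C₃ with hA
  refine ⟨A, fun {d n N M} D {σ φ α δ B} hn hN hα hαK hAc hβ hU hE hB hδ hNC htr hrew => ?_⟩
  have hm1 : (1 : ℝ) ≤ D.numVisited := by exact_mod_cast D.numVisited_pos hn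
  set m : ℝ := (D.numVisited : ℝ) with hm
  have hm0 : 0 < m := by linarith
  -- all quantities are powers of `p = m ^ (1 / 4)`
  set p := Real.sqrt (Real.sqrt m) with hp
  have hs1 : 1 ≤ Real.sqrt m := Real.one_le_sqrt.2 hm1
  have hp1 : 1 ≤ p := Real.one_le_sqrt.2 hs1
  have hp0 : 0 < p := by linarith
  have hsp : Real.sqrt m = p ^ 2 := (Real.sq_sqrt (Real.sqrt_nonneg m)).symm
  have hmp : m = p ^ 4 := by
    rw [show p ^ 4 = (p ^ 2) ^ 2 by ring, ← hsp, Real.sq_sqrt hm0.le]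
  have hβα : 1 + K / m / α ≤ q := by
    have h1 : 1 ≤ α * (K * m) := by
      rwa [div_le_iff₀ (by positivity)] at hαK
    have h2 : K / m / α ≤ K ^ 2 := by
      rw [div_div, div_le_iff₀ (by positivity)]
      nlinarith
    linarith
  have hβα0 : 0 ≤ 1 + K / m / α := by positivity
  have hsqrt_le : ∀ {κ τ : Type} [Fintype κ] [Fintype τ] {T : Matrix κ τ ℝ} {c : ℝ}, 0 ≤ c →
      (∀ x, vnorm (T *ᵥ x) ^ 2 ≤ c ^ 2 * vnorm x ^ 2) → ∀ x, vnorm (T *ᵥ x) ≤ c * vnorm x := by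
    intro κ τ _ _ T c hc h x
    refine (pow_le_pow_iff_left₀ (vnorm_nonneg _) (mul_nonneg hc (vnorm_nonneg _)) two_ne_zero).1 ?_
    rw [mul_pow]
    exact h x
  have ha0 : 0 ≤ k₀ / p ^ 2 := by positivity
  have hb0 : 0 ≤ k₀ / p := by positivity
  have hU' : ∀ x, vnorm (D.Uᵀ *ᵥ x) ≤ k₀ / p ^ 2 * vnorm x := hsqrt_le ha0 fun x => by
    have e : (k₀ / p ^ 2) ^ 2 = K / m := by rw [div_pow, hk₀2, hmp]; ring
    rw [e]; exact hU x
  have hE' : ∀ x, vnorm ((D.U - γ • D.V)ᵀ *ᵥ x) ≤ k₀ / p * vnorm x := hsqrt_le hb0 fun x => by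
    have e : (k₀ / p) ^ 2 = K / Real.sqrt m := by rw [div_pow, hk₀2, hsp]
    rw [e]; exact hE x
  -- the factor `1 / n` of the empirical error is absorbed in the rewards
  set r := (Real.sqrt n)⁻¹ • D.rewards with hr
  have hrR : vnorm r ≤ R := D.vnorm_rewards_le hn hrew
  have hr0 : 0 ≤ vnorm r := vnorm_nonneg r
  have hG0 := D.gram_nonneg_of_eq hB
  have hsc := D.scaling_nonneg (N := N) hδ.1
  set G' := D.scaling N δ • D.gram σ φ with hG'
  have hG'0 : ∀ x, 0 ≤ x ⬝ᵥ G' *ᵥ x := fun x => by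
    rw [hG', smul_mulVec, dotProduct_smul]; exact mul_nonneg hsc (hG0 x)
  have hG's : G'ᵀ = G' := by
    rw [hG', transpose_smul]
    exact congrArg _ meanGram_transpose
  obtain ⟨u, v, hv, hu, hcomp⟩ := residual_comparison hG'0 hG's hlam hα hAc
    (by positivity : 0 ≤ K / m) hβ ha0 hU' hb0 hE' r
  have hvV : vnorm v ≤ Vc / p ^ 2 := by
    have h1 : lam * vnorm v ≤ q * (k₀ / p ^ 2 * R) := hv.trans (by gcongr)
    rw [hVc, div_div, le_div_iff₀ (by positivity)]
    have e : q * (k₀ / p ^ 2 * R) = q * (k₀ * R) / p ^ 2 := by ring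
    rw [e, le_div_iff₀ (by positivity)] at h1
    linarith
  have huU : vnorm u ≤ Uc := by
    have h0 : k₀ / p ^ 2 * vnorm r / α ≤ k₀ * K * R * p ^ 2 := by
      have h1 : 1 / α ≤ K * p ^ 4 := by
        rw [← hmp, div_le_iff₀ hα, mul_comm]
        rwa [div_le_iff₀ (by positivity)] at hαK
      calc k₀ / p ^ 2 * vnorm r / α = k₀ / p ^ 2 * vnorm r * (1 / α) := by ring
        _ ≤ k₀ / p ^ 2 * R * (K * p ^ 4) := by gcongr
        _ = _ := by field_simp
    have h1 : k₀ / p * (vnorm r + k₀ / p * (k₀ / p ^ 2 * vnorm r / α)) ≤ k₀ * R * q := by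
      calc k₀ / p * (vnorm r + k₀ / p * (k₀ / p ^ 2 * vnorm r / α))
          ≤ k₀ / p * (R + k₀ / p * (k₀ * K * R * p ^ 2)) := by gcongr
        _ = k₀ * R * (1 / p) + k₀ * R * (k₀ ^ 2 * K) := by field_simp
        _ ≤ k₀ * R * 1 + k₀ * R * (K * K) := by
            rw [hk₀2]
            have : 1 / p ≤ 1 := by rw [div_le_one hp0]; exact hp1
            gcongr
        _ = k₀ * R * q := by rw [hq]; ring
    have h2 : lam * vnorm u ≤ q * (k₀ * R * q) := hu.trans (by gcongr)
    rw [hUc, le_div_iff₀ hlam]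
    linarith
  have huv : vnorm u * vnorm v ≤ Uc * Vc / p ^ 2 := by
    rw [mul_div_assoc]
    exact mul_le_mul huU hvV (vnorm_nonneg _) hUc0
  have hcoef : 2 * (K / m) * vnorm u * ((1 + K / m / α) * vnorm v)
      + (k₀ / p * ((1 + K / m / α) * vnorm v)) ^ 2 ≤ C₂ / p ^ 6 := by
    have hv0 := vnorm_nonneg v
    have h1 : (1 + K / m / α) * vnorm v ≤ q * (Vc / p ^ 2) := by gcongr
    have h1' : 0 ≤ (1 + K / m / α) * vnorm v := by positivity
    calc _ ≤ 2 * (K / m) * Uc * (q * (Vc / p ^ 2)) + (k₀ / p * (q * (Vc / p ^ 2))) ^ 2 := by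
          gcongr
      _ = C₂ / p ^ 6 := by rw [hC₂, hmp]; field_simp
  -- the correction factor is of order `1 / m`, the mean Gram matrix of order `m`
  have hδ0 := hδ.1
  have hδle : δ ≤ K * C / (lam * m) := by
    have h1 := D.correctionFactor_le hn hlam hα hAc hB hδ (by positivity : 0 ≤ K / m) hβ
    have h2 : K / m * (D.gram σ φ).trace / lam ≤ K / m * (C * m) / lam := by gcongr
    have h3 : K / m * (C * m) / lam = K * C / lam := by field_simp
    rw [le_div_iff₀ (by positivity)]
    have h4 := h1.trans (h2.trans h3.le)
    rw [le_div_iff₀ hlam] at h4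
    linarith
  set τ := N / m - D.scaling N δ with hτ
  have hτe : τ = N / m * (δ / (1 + δ)) := by
    rw [hτ, scaling, ← hm]; field_simp; ring
  have hτ0 : 0 ≤ τ := by rw [hτe]; positivity
  have hNm : N / m ≤ C := by rwa [div_le_iff₀ hm0]
  have hτle : τ ≤ C * (K * C / (lam * m)) := by
    rw [hτe]
    have h1 : δ / (1 + δ) ≤ δ := div_le_self hδ0 (by linarith)
    have h2 := h1.trans hδle
    gcongr
  have hτΦ : τ * frob (D.gram σ φ) ≤ D₁ := by
    have h1 := (D.frob_gram_le hB).trans htr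
    calc τ * frob (D.gram σ φ) ≤ C * (K * C / (lam * m)) * (C * m) :=
          mul_le_mul hτle h1 (frob_nonneg _) (by positivity)
      _ = D₁ := by rw [hD₁]; field_simp
  -- the second-order correction
  obtain ⟨hΔ0, hΔ⟩ := D.secondOrderCorrection_bounds hn hN hlam hα hAc hB hδ hb0 hE'
  have hΔle : D.secondOrderCorrection σ φ γ lam N δ ≤ C₃ / p ^ 2 := by
    have h1 : vnorm (D.U *ᵥ D.rewards) ^ 2 / n ≤ (k₀ / p ^ 2 * R) ^ 2 := by
      have e : vnorm (D.U *ᵥ D.rewards) ^ 2 / n = vnorm (D.U *ᵥ r) ^ 2 := by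
        rw [hr, mulVec_smul, vnorm_smul, mul_pow, sq_abs, inv_pow, Real.sq_sqrt (Nat.cast_nonneg n)]
        ring
      rw [e]
      refine pow_le_pow_left₀ (vnorm_nonneg _) ?_ 2
      have h2 := vnorm_transpose_mulVec_le ha0 hU' r
      rw [transpose_transpose] at h2
      exact h2.trans (by gcongr)
    have htr0 : 0 ≤ (D.gram σ φ).trace := by rw [D.trace_gram_eq hB]; positivity
    calc D.secondOrderCorrection σ φ γ lam N δ
        ≤ N / m ^ 2 * (k₀ / p * (D.gram σ φ).trace / lam) ^ 2
          * (vnorm (D.U *ᵥ D.rewards) ^ 2 / n) := hΔ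
      _ ≤ C * m / m ^ 2 * (k₀ / p * (C * m) / lam) ^ 2 * (k₀ / p ^ 2 * R) ^ 2 := by gcongr
      _ = C ^ 3 * (k₀ ^ 2) ^ 2 * R ^ 2 / lam ^ 2 / p ^ 2 := by rw [hmp]; field_simp
      _ = C₃ / p ^ 2 := by rw [hk₀2]
  refine ⟨u, v, huv.trans ?_, fun W => ?_⟩
  · rw [hsp]
    gcongr
    rw [hA]
    have : 0 ≤ 2 * lam + 2 * lam * (D₁ * (Uc * Vc)) + 2 * C₂ + 2 * C₂ * D₁ ^ 2 + C₃ := by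
      positivity
    linarith
  set R₀ := gramError σ φ D.visitedStates m W with hR₀
  have hdiff : sampleGram σ φ D.visitedStates m W - G' = R₀ + τ • D.gram σ φ := by
    have e : D.gram σ φ = meanGram σ φ D.visitedStates := rfl
    rw [hR₀, gramError, hG', e, hτ, sub_smul]
    abel
  have h1 := hcomp _ (sampleGram_nonneg (σ := σ) (φ := φ) (S := D.visitedStates) hm0.le W)
  rw [hdiff] at h1
  have h2 : |u ⬝ᵥ (R₀ + τ • D.gram σ φ) *ᵥ v|
      ≤ |u ⬝ᵥ R₀ *ᵥ v| + D₁ * (Uc * Vc / p ^ 2) := by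
    rw [add_mulVec, dotProduct_add]
    refine (abs_add_le _ _).trans (add_le_add le_rfl ?_)
    rw [smul_mulVec, dotProduct_smul, smul_eq_mul, abs_mul, abs_of_nonneg hτ0]
    calc τ * |u ⬝ᵥ D.gram σ φ *ᵥ v|
        ≤ τ * (vnorm u * (frob (D.gram σ φ) * vnorm v)) := by
          refine mul_le_mul_of_nonneg_left ((abs_dotProduct_le _ _).trans ?_) hτ0
          exact mul_le_mul_of_nonneg_left (vnorm_mulVec_le _ _) (vnorm_nonneg _)
      _ = τ * frob (D.gram σ φ) * (vnorm u * vnorm v) := by ring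
      _ ≤ _ := mul_le_mul hτΦ huv (mul_nonneg (vnorm_nonneg _) (vnorm_nonneg _)) hD₁0
  have h3 : frob (R₀ + τ • D.gram σ φ) ^ 2 ≤ 2 * frob R₀ ^ 2 + 2 * D₁ ^ 2 := by
    have e1 : frob (R₀ + τ • D.gram σ φ) ≤ frob R₀ + D₁ := by
      refine (frob_add_le _ _).trans (add_le_add le_rfl ?_)
      rw [frob_smul, abs_of_nonneg hτ0]
      exact hτΦ
    have e2 := pow_le_pow_left₀ (frob_nonneg _) e1 2
    have e3 := add_sq_le (a := frob R₀) (b := D₁)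
    linarith
  have h4 : (2 * (K / m) * vnorm u * ((1 + K / m / α) * vnorm v)
      + (k₀ / p * ((1 + K / m / α) * vnorm v)) ^ 2) * frob (R₀ + τ • D.gram σ φ) ^ 2
      ≤ C₂ / p ^ 6 * (2 * frob R₀ ^ 2 + 2 * D₁ ^ 2) :=
    mul_le_mul hcoef h3 (sq_nonneg _) (by positivity)
  have e1 : D.empiricalMSBE σ φ γ W (D.lstd σ φ γ (lam * (m * n)) W)
      - D.detEmpiricalMSBE σ φ γ lam N δ
      = (vnorm (lam • (((D.U - γ • D.V)ᵀ * sampleGram σ φ D.visitedStates m W * D.U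
          + lam • (1 : Matrix (Fin n) (Fin n) ℝ))⁻¹ *ᵥ r)) ^ 2
        - vnorm (lam • (((D.U - γ • D.V)ᵀ * G' * D.U
          + lam • (1 : Matrix (Fin n) (Fin n) ℝ))⁻¹ *ᵥ r)) ^ 2)
        - D.secondOrderCorrection σ φ γ lam N δ := by
    rw [hm, D.empiricalMSBE_lstd hn hlam hα hAc, detEmpiricalMSBE, scaled_sqNorm_eq,
      scaled_sqNorm_eq, resolvent, D.resolventMatrix_eq hn, detResolvent, detResolventMatrix, hG',
      Matrix.mul_smul, Matrix.smul_mul]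
    ring
  rw [e1]
  refine (abs_sub _ _).trans ?_
  rw [abs_of_nonneg hΔ0]
  have h5 : (frob R₀ / (Real.sqrt m * p)) ^ 2 = frob R₀ ^ 2 / p ^ 6 := by
    rw [hsp]; field_simp
  have h6 : 1 / p ^ 6 ≤ 1 / p ^ 2 :=
    one_div_le_one_div_of_le (by positivity) (pow_le_pow_right₀ hp1 (by norm_num))
  rw [h5, hsp]
  set X := |u ⬝ᵥ R₀ *ᵥ v| with hX
  have hX0 : 0 ≤ X := abs_nonneg _
  set Y := frob R₀ ^ 2 / p ^ 6 with hY
  have hY0 : 0 ≤ Y := by positivity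
  set Z := 1 / p ^ 2 with hZ
  have hZ0 : 0 ≤ Z := by positivity
  have h7 : C₂ / p ^ 6 * (2 * frob R₀ ^ 2 + 2 * D₁ ^ 2)
      ≤ 2 * C₂ * Y + 2 * C₂ * D₁ ^ 2 * Z := by
    have e : C₂ / p ^ 6 * (2 * frob R₀ ^ 2 + 2 * D₁ ^ 2)
        = 2 * C₂ * Y + 2 * C₂ * D₁ ^ 2 * (1 / p ^ 6) := by rw [hY]; ring
    rw [e]
    gcongr
  have h8 : 2 * lam * |u ⬝ᵥ (R₀ + τ • D.gram σ φ) *ᵥ v|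
      ≤ 2 * lam * X + 2 * lam * (D₁ * (Uc * Vc)) * Z := by
    have e : 2 * lam * (X + D₁ * (Uc * Vc / p ^ 2))
        = 2 * lam * X + 2 * lam * (D₁ * (Uc * Vc)) * Z := by rw [hZ]; ring
    rw [← e]
    exact mul_le_mul_of_nonneg_left h2 (by positivity)
  have h9 : D.secondOrderCorrection σ φ γ lam N δ ≤ C₃ * Z := by
    refine hΔle.trans (le_of_eq ?_)
    rw [hZ]; ring
  have h10 : 0 ≤ Uc * Vc := by positivity
  have h11 : 2 * lam * X + 2 * lam * (D₁ * (Uc * Vc)) * Z + (2 * C₂ * Y + 2 * C₂ * D₁ ^ 2 * Z)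
      + C₃ * Z ≤ A * (X + Y + Z) := by
    have a1 : 0 ≤ 2 * lam * (D₁ * (Uc * Vc)) := by positivity
    have a2 : 0 ≤ 2 * C₂ * D₁ ^ 2 := by positivity
    have f1 : 2 * lam * X ≤ A * X := mul_le_mul_of_nonneg_right (by rw [hA]; linarith) hX0
    have f2 : 2 * C₂ * Y ≤ A * Y := mul_le_mul_of_nonneg_right (by rw [hA]; linarith) hY0
    have f3 : (2 * lam * (D₁ * (Uc * Vc)) + 2 * C₂ * D₁ ^ 2 + C₃) * Z ≤ A * Z :=
      mul_le_mul_of_nonneg_right (by rw [hA]; linarith) hZ0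
    linarith
  linarith

end Dataset

namespace Dataset

variable {d n : ℕ} {M : MRP d} (D : Dataset M n) {σ φ : ℝ → ℝ}

/-- The second moment matrix `Φ` is positive semidefinite, hence of the form `Bᵀ B`. The bounds for
a single feature `N = 1` at scale `m = 1` suffice. -/
lemma exists_gram_eq {a b : ℝ} (ha : 0 ≤ a) (hσ : ∀ x y, |σ x - σ y| ≤ a * |x - y|) (hb : 0 ≤ b)
    (hφ : ∀ x y, |φ x - φ y| ≤ b * |x - y|) :
    ∃ B : Matrix D.visited D.visited ℝ, D.gram σ φ = Bᵀ * B := by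
  obtain ⟨K, -, hK⟩ := exists_featureBounds σ φ ha hσ hb hφ (norm_nonneg _ : 0 ≤ opNorm M.state)
    (by positivity : (0 : ℝ) ≤ 1 + d + D.numVisited)
  have hF := hK (N := 1) D.visitedStates 1 D.vnorm_visitedStates_transpose_le zero_le_one
    (by push_cast; linarith [(Nat.cast_nonneg d : (0 : ℝ) ≤ d),
      (Nat.cast_nonneg D.numVisited : (0 : ℝ) ≤ D.numVisited)])
    (by linarith [(Nat.cast_nonneg D.numVisited : (0 : ℝ) ≤ D.numVisited)])
    (by
      rw [Fintype.card_coe]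
      change (D.numVisited : ℝ) ≤ _
      linarith [(Nat.cast_nonneg d : (0 : ℝ) ≤ d)])
  exact exists_eq_transpose_mul_self meanGram_transpose (hF.meanGram_nonneg one_pos)

end Dataset

/-- The almost sure deterministic equivalent of the empirical MSBE. -/
lemma ae_tendsto_empiricalMSBE_sub {Ω : Type*} [MeasurableSpace Ω] {μ : Measure Ω}
    [IsProbabilityMeasure μ] {σ φ : ℝ → ℝ} {a b : ℝ} (ha : 0 ≤ a)
    (hσ : ∀ x y, |σ x - σ y| ≤ a * |x - y|) (hb : 0 ≤ b) (hφ : ∀ x y, |φ x - φ y| ≤ b * |x - y|)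
    {γ lam : ℝ} (hγ : 0 ≤ γ) (hγ1 : γ < 1) (hlam : 0 < lam) {N d n : ℕ → ℕ} (hN : ∀ k, 0 < N k)
    (hn : ∀ k, 0 < n k) {M : ∀ k, MRP (d k)} {D : ∀ k, Dataset (M k) (n k)}
    (hregime : DoubleAsymptoticRegime N d n M D) (hspec : BoundedEigenspectrum γ D)
    {Wt : ∀ k, Ω → Matrix (Fin (N k)) (Fin (d k)) ℝ}
    (hlaw : ∀ k i j, HasLaw (fun ω => Wt k ω i j) (gaussianReal 0 1) μ)
    (hindep : ∀ k, iIndepFun (fun (p : Fin (N k) × Fin (d k)) ω => Wt k ω p.1 p.2) μ)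
    {δ : ℕ → ℝ} (hδ : ∀ k, (D k).IsCorrectionFactor σ φ γ lam (N k) (δ k)) :
    ∀ᵐ ω ∂μ, Tendsto
      (fun k => (D k).empiricalMSBE σ φ γ (Wt k ω)
          ((D k).lstd σ φ γ (lam * ((D k).numVisited * n k)) (Wt k ω))
        - (D k).detEmpiricalMSBE σ φ γ lam (N k) (δ k)) atTop (𝓝 0) := by
  obtain ⟨K, hK, hstruct⟩ := exists_structural_bounds hγ hγ1 hn hspec
  obtain ⟨c, C, hc, hratio⟩ := hregime.ratios
  obtain ⟨s, hs⟩ := hregime.states_bounded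
  obtain ⟨R, hR⟩ := hregime.rewards_bounded
  set m : ℕ → ℝ := fun k => ((D k).numVisited : ℝ) with hm
  have hmk : ∀ k : ℕ, (k : ℝ) ≤ m k := fun k =>
    Nat.cast_le.2 (hregime.strictMono_numVisited.le_apply (x := k))
  have hm0 : ∀ k, 0 < m k := fun k => Nat.cast_pos.2 ((D k).numVisited_pos (hn k))
  have hmtop : Tendsto m atTop atTop := tendsto_atTop_mono hmk tendsto_natCast_atTop_atTop
  -- the dimensions are at most a multiple of `m`
  obtain ⟨T, hT0, hT⟩ := exists_featureBounds σ φ ha hσ hb hφ (abs_nonneg s)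
    (by positivity : 0 ≤ |C| + 1)
  have hF : ∀ᶠ k in atTop, FeatureBounds (N k) (d k) σ φ (D k).visitedStates (a * |s| * b)
      (T * m k ^ 2) := by
    filter_upwards [hratio, hs] with k hk hsk
    have hle : ∀ {x : ℝ}, x / m k ≤ C → x ≤ (|C| + 1) * m k := fun {x} hx => by
      rw [div_le_iff₀ (hm0 k)] at hx
      nlinarith [le_abs_self C, hm0 k]
    refine hT _ _ (fun x => ((D k).vnorm_visitedStates_transpose_le x).trans ?_) (hm0 k).le
      (hle hk.1.2) (hle hk.2.1.2) ?_
    · exact mul_le_mul_of_nonneg_right (hsk.trans (le_abs_self s)) (vnorm_nonneg x)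
    · rw [Fintype.card_coe]
      change m k ≤ _
      nlinarith [abs_nonneg C, hm0 k]
  -- the constants of the comparison of the two errors
  set C' := |C| + T / c with hC'
  have hC'0 : 0 ≤ C' := by positivity
  obtain ⟨A, hA⟩ := Dataset.exists_abs_empiricalMSBE_sub_le (γ := γ) hlam hK hC'0 (abs_nonneg R)
  -- the test vectors are chosen for all `k`, as zero where the bounds do not hold yet
  have hgood : ∀ k, ∃ u v : (D k).visited → ℝ,
      FeatureBounds (N k) (d k) σ φ (D k).visitedStates (a * |s| * b) (T * m k ^ 2) →
      (N k : ℝ) / m k ∈ Set.Icc c C →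
      vnorm u * vnorm v ≤ A / Real.sqrt (m k) ∧ ∀ W : Matrix (Fin (N k)) (Fin (d k)) ℝ,
        |(D k).empiricalMSBE σ φ γ W ((D k).lstd σ φ γ (lam * ((D k).numVisited * n k)) W)
            - (D k).detEmpiricalMSBE σ φ γ lam (N k) (δ k)|
          ≤ A * (|u ⬝ᵥ gramError σ φ (D k).visitedStates (m k) W *ᵥ v|
            + (frob (gramError σ φ (D k).visitedStates (m k) W)
              / (Real.sqrt (m k) * Real.sqrt (Real.sqrt (m k)))) ^ 2
            + 1 / Real.sqrt (m k)) := by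
    intro k
    by_cases hk : FeatureBounds (N k) (d k) σ φ (D k).visitedStates (a * |s| * b) (T * m k ^ 2) ∧
      (N k : ℝ) / m k ∈ Set.Icc c C
    · obtain ⟨hFk, hNk⟩ := hk
      obtain ⟨α, hα, hαK, hAc, hβ, hU, hE⟩ := hstruct k
      obtain ⟨B, hB⟩ := (D k).exists_gram_eq ha hσ hb hφ
      have hNpos : (0 : ℝ) < N k := by exact_mod_cast hN k
      have hTc : 0 ≤ T / c := by positivity
      have h1 : (N k : ℝ) ≤ C' * m k := by
        have := hNk.2
        rw [div_le_iff₀ (hm0 k)] at this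
        nlinarith [le_abs_self C, hm0 k]
      have h2 : ((D k).gram σ φ).trace ≤ C' * m k := by
        refine (hFk.trace_meanGram_le (hN k)).trans ?_
        have h3 := hNk.1
        rw [le_div_iff₀ (hm0 k)] at h3
        have h4 : T * m k ^ 2 / N k ≤ T * m k ^ 2 / (c * m k) := by
          have := hm0 k
          gcongr
        refine h4.trans ?_
        have h5 : T * m k ^ 2 / (c * m k) = T / c * m k := by
          have := (hm0 k).ne'
          field_simp
        rw [h5]
        exact mul_le_mul_of_nonneg_right (by linarith [abs_nonneg C]) (hm0 k).le
      obtain ⟨u, v, h⟩ := hA (D k) (hn k) (hN k) hα hαK hAc hβ hU hE hB (hδ k) h1 h2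
        fun j l => (hR k j l).trans (le_abs_self R)
      exact ⟨u, v, fun _ _ => h⟩
    · exact ⟨0, 0, fun h1 h2 => absurd ⟨h1, h2⟩ hk⟩
  choose u v huv using hgood
  have huv' : ∀ᶠ k in atTop, vnorm (u k) * vnorm (v k) ≤ A / Real.sqrt (m k) := by
    filter_upwards [hF, hratio] with k h1 h2
    exact (huv k h1 h2.1).1
  filter_upwards [ae_tendsto_bilin_gramError hlaw hindep hF hmk huv',
    ae_tendsto_frob_gramError hlaw hindep hF hmk fun k => by rw [Fintype.card_coe]; rfl]
    with ω h1 h2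
  have h3 : Tendsto (fun k => 1 / Real.sqrt (m k)) atTop (𝓝 0) := by
    simp only [one_div]
    exact (Real.tendsto_sqrt_atTop.comp hmtop).inv_tendsto_atTop
  have h4 := (((h1.abs.add (h2.pow 2)).add h3).const_mul A)
  simp only [abs_zero, ne_eq, OfNat.ofNat_ne_zero, not_false_eq_true, zero_pow, add_zero,
    mul_zero] at h4
  refine squeeze_zero_norm' ?_ h4
  filter_upwards [hF, hratio] with k e1 e2
  exact (huv k e1 e2.1).2 (Wt k ω)

end

end RegLSTD

theorem theorem2
    {Ω : Type*} [MeasurableSpace Ω] (μ : Measure Ω) [IsProbabilityMeasure μ]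
    (σ φ : ℝ → ℝ) (hσ : ∃ K, LipschitzWith K σ) (hφ : ∃ K, LipschitzWith K φ)
    (γ lam : ℝ) (hγ : 0 ≤ γ) (hγ1 : γ < 1) (hlam : 0 < lam)
    (N d n : ℕ → ℕ) (hN : ∀ k, 0 < N k) (hn : ∀ k, 0 < n k)
    (M : ∀ k, MRP (d k)) (D : ∀ k, Dataset (M k) (n k))
    (hregime : DoubleAsymptoticRegime N d n M D)
    (hspec : BoundedEigenspectrum γ D)
    (Wt : ∀ k, Ω → Matrix (Fin (N k)) (Fin (d k)) ℝ)
    (hlaw : ∀ k i j, HasLaw (fun ω => Wt k ω i j) (gaussianReal 0 1) μ)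
    (hindep : ∀ k, iIndepFun (fun (p : Fin (N k) × Fin (d k)) ω => Wt k ω p.1 p.2) μ) :
    -- the empirical MSBE of regularized LSTD in terms of the resolvent
    (∀ k ω,
      IsUnit ((D k).lstdMatrix σ φ γ (lam * ((D k).numVisited * n k)) (Wt k ω)) ∧
      IsUnit ((D k).resolventMatrix σ φ γ lam (Wt k ω)) ∧
      (D k).empiricalMSBE σ φ γ (Wt k ω)
          ((D k).lstd σ φ γ (lam * ((D k).numVisited * n k)) (Wt k ω)) =
        lam ^ 2 / n k * sqNorm ((D k).resolvent σ φ γ lam (Wt k ω) *ᵥ (D k).rewards)) ∧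
    -- existence, uniqueness and positivity of the correction factor
    (∀ k, ∃! δ : ℝ, (D k).IsCorrectionFactor σ φ γ lam (N k) δ) ∧
    (∀ k, ∀ δ : ℝ, (D k).IsCorrectionFactor σ φ γ lam (N k) δ →
      ((D k).gram σ φ ≠ 0 → 0 < δ) ∧
      IsUnit ((D k).detResolventMatrix σ φ γ lam (N k) δ) ∧
      0 < (D k).correctionDenom σ φ γ lam (N k) δ) ∧
    -- the almost sure deterministic equivalent
    (∀ δ : ℕ → ℝ, (∀ k, (D k).IsCorrectionFactor σ φ γ lam (N k) (δ k)) →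
      ∀ᵐ ω ∂μ, Tendsto
        (fun k => (D k).empiricalMSBE σ φ γ (Wt k ω)
            ((D k).lstd σ φ γ (lam * ((D k).numVisited * n k)) (Wt k ω))
          - (D k).detEmpiricalMSBE σ φ γ lam (N k) (δ k))
        atTop (𝓝 0)) := by
  have hlip : ∀ {f : ℝ → ℝ}, (∃ K, LipschitzWith K f) →
      ∃ c : ℝ, 0 ≤ c ∧ ∀ x y, |f x - f y| ≤ c * |x - y| := fun {f} ⟨K, hK⟩ =>
    ⟨K, K.2, fun x y => hK.dist_le_mul x y⟩
  obtain ⟨a, ha, hσ⟩ := hlip hσ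
  obtain ⟨b, hb, hφ⟩ := hlip hφ
  obtain ⟨K, -, hstruct⟩ := exists_structural_bounds hγ hγ1 hn hspec
  refine ⟨fun k ω => ?_, fun k => ?_, fun k δ hδ => ?_, fun δ hδ =>
    ae_tendsto_empiricalMSBE_sub ha hσ hb hφ hγ hγ1 hlam hN hn hregime hspec hlaw hindep hδ⟩
  · obtain ⟨α, hα, -, hA, -⟩ := hstruct k
    exact ⟨(D k).isUnit_lstdMatrix (hn k) hlam hα hA _,
      (D k).isUnit_resolventMatrix (hn k) hlam hα hA _,
      (D k).empiricalMSBE_lstd (hn k) hlam hα hA _⟩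
  · obtain ⟨α, hα, -, hA, -⟩ := hstruct k
    obtain ⟨B, hB⟩ := (D k).exists_gram_eq ha hσ hb hφ
    exact (D k).existsUnique_isCorrectionFactor (hn k) (hN k) hlam hα hA hB
  · obtain ⟨α, hα, -, hA, -⟩ := hstruct k
    obtain ⟨B, hB⟩ := (D k).exists_gram_eq ha hσ hb hφ
    have hδ1 : 0 < 1 / (1 + δ) := one_div_pos.2 (by linarith [hδ.1])
    exact ⟨(D k).correctionFactor_pos (hn k) hlam hα hA hB hδ,
      (D k).isUnit_detResolventMatrix hlam hα hA ((D k).gram_nonneg_of_eq hB) hδ.1,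
      hδ1.trans_le ((D k).inv_le_correctionDenom (hn k) (hN k) hlam hα hA hB hδ)⟩
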